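/- **Setting.** Let $\lambda>-1$, $1\le p,q<\infty$, $\mathbb R_+=(0,\infty)$, $\Pi=\{x+iy:\ y>0\}$, $d\nu_\lambda(y)=(\lambda+1)(2y)^\lambda dy$ on $\mathbb R_+$ and $d\mu_\lambda(x+iy)=\frac1\pi(\lambda+1)(2y)^\lambda dx\,dy$ on $\Pi$. Let $F$ be the Fourier transform $(Fh)(\xi)=\frac1{\sqrt{2\pi}}\int_{\mathbb R} e^{-ix\xi}h(x)\,dx$, and let $\widehat f_{x\to\xi}$ be the distributional Fourier transform in the first variable of a distribution on $\Pi$ that is tempered in $x$. Put $U_1f=\frac1{\sqrt\pi}\widehat f_{x\to\xi}$. Let $\mathcal A^{q,p}_\lambda(\Pi)$ be the space of the holomorphic $f$ on $\Pi$ for which $\widehat f_{x\to\xi}$ is a function in $L^q(\mathbb R,L^p(\mathbb R_+,\nu_\lambda))$, with the norm $\|f\|=\|U_1f\|_{L^q(\mathbb R,L^p(\mathbb R_+,\nu_\lambda))}$. Let $$\theta(x)=\Big(\tfrac{p^{\lambda+1}x^{\lambda+1}}{2^\lambda\Gamma(\lambda+2)}\Big)^{1/p},\qquad \psi(x,t)=\ln\frac{\Gamma(\lambda+1)}{\Gamma(\lambda+1,pxt)}\quad(x,t>0),$$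 let $\beta(x,\cdot)$ be the inverse function of $\psi(x,\cdot):\mathbb R_+\to\mathbb R_+$, and put $$(U_2\varphi)(x,y)=\tfrac1{\theta(|x|)}e^{-y/p+|x|\beta(|x|,y)}\varphi(x,\beta(|x|,y)),\qquad U_\lambda=U_2U_1,$$ $$(R_0f)(x,y)=\chi_+(x)f(x)e^{-y/p},\qquad (R_0^{-1}\varphi)(x)=\chi_+(x)\int_0^\infty\varphi(x,\eta)e^{-(p-1)\eta/p}\,d\eta,$$ $$R_\lambda=R_0^{-1}U_\lambda,\qquad R_\lambda^{-1}=U_\lambda^{-1}R_0 .$$ The Bergman projection onto $\mathcal A^{q,p}_\lambda(\Pi)$ is $B=R_\lambda^{-1}R_\lambda=U_\lambda^{-1}R_0R_0^{-1}U_\lambda$. It is defined on those locally integrable $f$ on $\Pi$, tempered in $x$ as distributions, for which $\widehat f_{x\to\xi}$ is a function, the integral in $R_\lambda f=R_0^{-1}U_\lambda f$ converges absolutely for almost all $x>0$, and $Bf\in\mathcal A^{q,p}_\lambda(\Pi)$. Let $a=a(y)$ be a complex function on $\mathbb R_+$ such that $a(y)e^{-\varepsilon y}\in L^1(\mathbb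 R_+)$ for every $\varepsilon>0$ and, if $-1<\lambda<0$, $a(y)y^\lambda$ is integrable near $0$. The (possibly unbounded) Toeplitz operator in $\mathcal A^{q,p}_\lambda(\Pi)$ is $T_a^{(\lambda)}f=B(af)$, on the domain of all $f\in\mathcal A^{q,p}_\lambda(\Pi)$ such that $B(af)$ is defined. **Theorem.** 1. $R_\lambda$ is an isometric isomorphism of $\mathcal A^{q,p}_\lambda(\Pi)$ onto $L^q(\mathbb R_+)$ (for $f\in\mathcal A^{q,p}_\lambda(\Pi)$ the integral in $R_0^{-1}U_\lambda f$ converges absolutely for almost all $x>0$). Its inverse is given, with an absolutely convergent integral for every $z\in\Pi$, by $$(R_\lambda^{-1}\varphi)(z)=\frac{p^{(\lambda+1)/p}}{\sqrt2\,(2^\lambda\Gamma(\lambda+2))^{1/p}}\int_0^\infty\varphi(\xi)\,\xi^{(\lambda+1)/p}e^{i\xi z}\,d\xi .$$ For $f\in\mathcal A^{q,p}_\lambda(\Pi)$ and almost all $x>0$, $$(R_\lambda f)(x)=\theta(x)^{p-1}\int_0^\infty (U_1f)(x,\eta)\,e^{-(p-1)x\eta}\,d\nu_\lambda(\eta),$$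 where the integral converges absolutely; and for almost all $x>0$, whenever the following integral converges absolutely, $$(R_\lambda f)(x)=\tfrac1{\sqrt2}\,\theta(x)^{p-1}\int_\Pi f(\omega)\,e^{-ix\overline\omega}\,e^{-x(p-2)\operatorname{Im}\omega}\,d\mu_\lambda(\omega).$$ 2. The integral in $$\gamma_{a,\lambda}(x)=\frac{x^{\lambda+1}}{\Gamma(\lambda+1)}\int_0^\infty a(t/p)\,e^{-tx}\,t^\lambda\,dt$$ converges absolutely for every $x>0$, and $R_\lambda T_a^{(\lambda)}R_\lambda^{-1}=\gamma_{a,\lambda}I$ as (possibly unbounded) operators in $L^q(\mathbb R_+)$: for $\varphi,\psi\in L^q(\mathbb R_+)$, the function $R_\lambda^{-1}\varphi$ is in the domain of $T_a^{(\lambda)}$ with $T_a^{(\lambda)}R_\lambda^{-1}\varphi=R_\lambda^{-1}\psi$ if and only if $\psi=\gamma_{a,\lambda}\varphi$ almost everywhere. 3. For $p=q=2$ this $T_a^{(\lambda)}$ is the classical Toeplitz operator: if $f\in\mathcal A^{2,2}_\lambda(\Pi)$ and $af\in L^2(\Pi,\mu_\lambda)$, where $(af)(w)=a(\operatorname{Im}w)f(w)$,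 then $f$ is in the domain of $T_a^{(\lambda)}$ and, for every $z\in\Pi$, with an absolutely convergent integral, $$(T_a^{(\lambda)}f)(z)=\int_\Pi a(\operatorname{Im}w)\,f(w)\,K_\lambda(z,w)\,d\mu_\lambda(w),\qquad K_\lambda(z,w)=-\,\frac{i^\lambda}{(z-\overline w)^{2+\lambda}}\quad\text{(principal branches)}.$$ -/

import Mathlib

open MeasureTheory Set Complex
open scoped ENNReal ContDiff

noncomputable section

namespace MixedFourier

/-- Lebesgue measure on the half-line `(0, ∞)`. -/
def volPos : Measure ℝ := volume.restrict (Ioi 0)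

instance : SFinite volPos := by unfold volPos; infer_instance

/-- The point `x + i y` of the upper half-plane (only used for `y > 0`). -/
def pt (x y : ℝ) : UpperHalfPlane := UpperHalfPlane.ofComplex ((x : ℂ) + (y : ℂ) * I)

/-- `dν_λ(y) = (λ + 1) (2 y) ^ λ dy` on `(0, ∞)`. -/
def nu (lam : ℝ) : Measure ℝ :=
  volPos.withDensity fun y => ENNReal.ofReal ((lam + 1) * (2 * y) ^ lam)

instance (lam : ℝ) : SFinite (nu lam) := by unfold nu; infer_instance

/-- `dμ_λ(x + i y) = π⁻¹ (λ + 1) (2 y) ^ λ dx dy`, in the coordinates `(x, y)` of the half-plane. -/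
def mu (lam : ℝ) : Measure (ℝ × ℝ) :=
  ENNReal.ofReal (1 / Real.pi) • (volume : Measure ℝ).prod (nu lam)

/-- The inverse Fourier transform `(2 π) ^ (-1/2) ∫ e ^ {i u x} h(u) du`. -/
def invFourier (h : ℝ → ℂ) (x : ℝ) : ℂ :=
  ((1 / Real.sqrt (2 * Real.pi) : ℝ) : ℂ) * ∫ u : ℝ, Complex.exp (I * u * x) * h u

/-- The locally integrable function `f` on the half-plane is, as a distribution tempered in the first
variable, the inverse Fourier transform in the first variable of the function `φ = φ(ξ, y)`, that is,
`φ` is the distributional Fourier transform `f ^_{x → ξ}` of `f`, with the normalisation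
`(F h)(ξ) = (2 π) ^ (-1/2) ∫ e ^ {-i x ξ} h(x) dx`. It suffices to test with products `h(x) k(y)`
of test functions, since their span is dense in the space of functions that are rapidly decreasing
in `x` and compactly supported in `y`. -/
structure IsPartialFourier (f : UpperHalfPlane → ℂ) (φ : ℝ → ℝ → ℂ) : Prop where
  locallyIntegrable :
    LocallyIntegrableOn (fun w : ℝ × ℝ => f (pt w.1 w.2)) (univ ×ˢ Ioi 0) volume
  tempered : ∀ c d : ℝ, 0 < c → c < d → ∃ N : ℕ,
    Integrable (fun w : ℝ × ℝ => φ w.1 w.2 * (((1 + |w.1|) ^ N : ℝ) : ℂ)⁻¹)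
      ((volume : Measure ℝ).prod (volume.restrict (Icc c d)))
  pairing : ∀ h k : ℝ → ℂ, ContDiff ℝ ∞ h → HasCompactSupport h →
    ContDiff ℝ ∞ k → HasCompactSupport k → tsupport k ⊆ Ioi 0 →
    ∫ w, f (pt w.1 w.2) * (h w.1 * k w.2) ∂((volume : Measure ℝ).prod volPos) =
      ∫ w, φ w.1 w.2 * (invFourier h w.1 * k w.2) ∂((volume : Measure ℝ).prod volPos)

open Classical in
/-- The distributional Fourier transform in the first variable (determined almost everywhere),
for those `f` for which it is a function; zero otherwise. -/
def partialFourier (f : UpperHalfPlane → ℂ) : ℝ → ℝ → ℂ :=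
  if h : ∃ φ, IsPartialFourier f φ then h.choose else 0

/-- The norm of `L^{q,p}_λ(Π) = L^q(ℝ, L^p((0, ∞), ν_λ))`. -/
def mixedNorm (lam q p : ℝ) (φ : ℝ → ℝ → ℂ) : ℝ≥0∞ :=
  (∫⁻ ξ : ℝ, eLpNorm (φ ξ) (ENNReal.ofReal p) (nu lam) ^ q) ^ (1 / q)

/-- Membership in `L^{q,p}_λ(Π) = L^q(ℝ, L^p((0, ∞), ν_λ))`. -/
def MemMixed (lam q p : ℝ) (φ : ℝ → ℝ → ℂ) : Prop :=
  AEStronglyMeasurable (Function.uncurry φ) ((volume : Measure ℝ).prod volPos) ∧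
    mixedNorm lam q p φ < ⊤

/-- The operator `U_{1,λ} f = π ^ (-1/2) f ^_{x → ξ}`. -/
def U1 (f : UpperHalfPlane → ℂ) (ξ y : ℝ) : ℂ :=
  ((1 / Real.sqrt Real.pi : ℝ) : ℂ) * partialFourier f ξ y

/-- The mixed Fourier norm `‖f‖ = ‖U_{1,λ} f‖` of `𝓛^{q,p}_λ(Π)`. -/
def fourierMixedNorm (lam q p : ℝ) (f : UpperHalfPlane → ℂ) : ℝ≥0∞ :=
  mixedNorm lam q p (U1 f)

/-- `f` belongs to `𝓐^{q,p}_λ(Π) = Hol(Π) ∩ 𝓛^{q,p}_λ(Π)`. -/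
def MemBergman (lam q p : ℝ) (f : UpperHalfPlane → ℂ) : Prop :=
  DifferentiableOn ℂ (fun z : ℂ => f (UpperHalfPlane.ofComplex z)) {z : ℂ | 0 < z.im} ∧
    ∃ φ : ℝ → ℝ → ℂ, IsPartialFourier f φ ∧ MemMixed lam q p φ

/-- The upper incomplete Gamma function `Γ(s, x)`. -/
def incGamma (s x : ℝ) : ℝ := ∫ t in Ioi x, t ^ (s - 1) * Real.exp (-t)

/-- `θ_{λ,p}(x) = (p^{λ+1} x^{λ+1} / (2^λ Γ(λ+2)))^{1/p}`. -/
def theta (lam p x : ℝ) : ℝ :=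
  (p ^ (lam + 1) * x ^ (lam + 1) / (2 ^ lam * Real.Gamma (lam + 2))) ^ (1 / p)

/-- `ψ_λ(x, t) = ln (Γ(λ+1) / Γ(λ+1, p x t))`. -/
def psi (lam p x t : ℝ) : ℝ :=
  Real.log (Real.Gamma (lam + 1) / incGamma (lam + 1) (p * x * t))

/-- For `x > 0`, the inverse function `β_λ(x, ·)` of `ψ_λ(x, ·) : (0, ∞) → (0, ∞)`. -/
def beta (lam p x y : ℝ) : ℝ := Function.invFunOn (psi lam p x) (Ioi 0) y

/-- The operator `U_{2,λ}`. -/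
def U2 (lam p : ℝ) (φ : ℝ → ℝ → ℂ) (x y : ℝ) : ℂ :=
  ((1 / theta lam p |x| * Real.exp (-y / p + |x| * beta lam p |x| y) : ℝ) : ℂ) *
    φ x (beta lam p |x| y)

/-- `U_λ = U_{2,λ} U_{1,λ}`. -/
def U (lam p : ℝ) (f : UpperHalfPlane → ℂ) : ℝ → ℝ → ℂ := U2 lam p (U1 f)

/-- `ℓ_{0,p}(y) = e^{-y/p}`. -/
def ell (p y : ℝ) : ℝ := Real.exp (-y / p)

/-- `(R_0 f)(x, y) = χ_+(x) f(x) ℓ_{0,p}(y)`. -/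
def R0 (p : ℝ) (f : ℝ → ℂ) (x y : ℝ) : ℂ := (Ioi (0 : ℝ)).indicator f x * (ell p y : ℂ)

/-- The left inverse `(R_0⁻¹ φ)(x) = χ_+(x) ∫ φ(x, η) ℓ_{0,p}(η)^{p-1} dη` of `R_0`. -/
def R0inv (p : ℝ) (φ : ℝ → ℝ → ℂ) (x : ℝ) : ℂ :=
  (Ioi (0 : ℝ)).indicator (fun x => ∫ η in Ioi (0 : ℝ), φ x η * ((ell p η ^ (p - 1) : ℝ) : ℂ)) x

/-- `R_λ = R_0⁻¹ U_λ`. -/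
def Rop (lam p : ℝ) (f : UpperHalfPlane → ℂ) : ℝ → ℂ := R0inv p (U lam p f)

/-- For almost all `x > 0` the integral that defines `(R_λ f)(x)` converges absolutely. -/
def RopConverges (lam p : ℝ) (f : UpperHalfPlane → ℂ) : Prop :=
  ∀ᵐ x ∂volPos, IntegrableOn (fun η => U lam p f x η * ((ell p η ^ (p - 1) : ℝ) : ℂ)) (Ioi 0)

/-- `g ∈ 𝓐^{q,p}_λ(Π)` is the Bergman projection `R_λ⁻¹ R_λ f` of `f`. As `R_λ = R_0⁻¹ U_λ` and
`R_λ⁻¹ = U_λ⁻¹ R_0`, this says that `U_λ g = R_0 R_0⁻¹ U_λ f`. The function `f` need not lie in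
`𝓛^{q,p}_λ(Π)`: it is only required that its Fourier transform in the first variable is a function
and that the integral in `R_λ f` converges. -/
structure IsBergmanProjection (lam q p : ℝ) (f g : UpperHalfPlane → ℂ) : Prop where
  exists_fourier : ∃ φ, IsPartialFourier f φ
  converges : RopConverges lam p f
  mem : MemBergman lam q p g
  eq : Function.uncurry (U lam p g) =ᵐ[(volume : Measure ℝ).prod volPos]
    Function.uncurry (R0 p (R0inv p (U lam p f)))

/-- The graph of the (possibly unbounded) Toeplitz operator `T_a^{(λ)}` in `𝓐^{q,p}_λ(Π)` with symbol
`a = a(y)`: `T_a f = g` means that `f` and `g` are in `𝓐^{q,p}_λ(Π)` and that `g` is the Bergman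
projection of `a f`. The domain is maximal. -/
structure IsToeplitz (lam q p : ℝ) (a : ℝ → ℂ) (f g : UpperHalfPlane → ℂ) : Prop where
  mem : MemBergman lam q p f
  proj : IsBergmanProjection lam q p (fun z => a z.im * f z) g

/-- The class `L^1_exp(ℝ_+)`. -/
def MemL1exp (a : ℝ → ℂ) : Prop :=
  ∀ ε : ℝ, 0 < ε → IntegrableOn (fun y => a y * (Real.exp (-(ε * y)) : ℂ)) (Ioi 0)

/-- The integrand of `γ_{a,λ}(x)`. -/
def gammaIntegrand (lam p : ℝ) (a : ℝ → ℂ) (x t : ℝ) : ℂ :=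
  a (t / p) * ((Real.exp (-(t * x)) * t ^ lam : ℝ) : ℂ)

/-- `γ_{a,λ}(x) = x^{λ+1} / Γ(λ+1) ∫_0^∞ a(t/p) e^{-t x} t^λ dt`. -/
def gammaSymbol (lam p : ℝ) (a : ℝ → ℂ) (x : ℝ) : ℂ :=
  ((x ^ (lam + 1) / Real.Gamma (lam + 1) : ℝ) : ℂ) * ∫ t in Ioi (0 : ℝ), gammaIntegrand lam p a x t

/-- The integrand `f(ω) e^{-i x ω̄} e^{-x (p-2) Im ω}` of the integral formula for `R_λ`, at the point
`ω = ξ + i η` with coordinates `w = (ξ, η)`. -/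
def areaIntegrand (p : ℝ) (f : UpperHalfPlane → ℂ) (x : ℝ) (w : ℝ × ℝ) : ℂ :=
  f (pt w.1 w.2) *
    Complex.exp (-(I * (x : ℂ) * (starRingEnd ℂ) ((w.1 : ℂ) + (w.2 : ℂ) * I))) *
    ((Real.exp (-(x * (p - 2) * w.2)) : ℝ) : ℂ)

/-- The Bergman kernel `K_λ(z, w) = - i^λ / (z - w̄)^{2+λ}` (principal branches). -/
def bergmanKernel (lam : ℝ) (z w : UpperHalfPlane) : ℂ :=
  -(I ^ (lam : ℂ)) * (1 / ((z : ℂ) - (starRingEnd ℂ) (w : ℂ)) ^ ((2 + lam : ℝ) : ℂ))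

/-! ### The space `𝓐^{q,p}_λ(Π)` is a vector space -/

theorem invFourier_decay {h : ℝ → ℂ} (h1 : ContDiff ℝ ∞ h) (h2 : HasCompactSupport h) :
    Continuous (invFourier h) ∧
      ∀ N : ℕ, ∃ C : ℝ, ∀ x, ‖(((1 + |x|) ^ N : ℝ) : ℂ) * invFourier h x‖ ≤ C := by
  let g : SchwartzMap ℝ ℂ := FourierTransformInv.fourierInv (h2.toSchwartzMap h1)
  have key : ∀ x, invFourier h x
      = ((1 / Real.sqrt (2 * Real.pi) : ℝ) : ℂ) * g (x / (2 * Real.pi)) := by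
    intro x
    simp only [g, invFourier, SchwartzMap.fourierInv_coe]
    congr 1
    rw [Real.fourierInv_eq']
    refine integral_congr_ae (Filter.Eventually.of_forall fun u => ?_)
    simp only [smul_eq_mul]
    congr 2
    have : (2 * Real.pi * inner ℝ u (x / (2 * Real.pi)) : ℝ) = u * x := by
      simp
      field_simp
    rw [this]
    push_cast
    ring
  have key' : invFourier h = fun x => ((1 / Real.sqrt (2 * Real.pi) : ℝ) : ℂ) *
      g (x / (2 * Real.pi)) := funext key
  refine ⟨by rw [key']; fun_prop, fun N => ?_⟩
  obtain ⟨C, hC⟩ : ∃ C : ℝ, ∀ y, (1 + ‖y‖) ^ N * ‖g y‖ ≤ C := by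
    refine ⟨2 ^ N * ((Finset.Iic (N, 0)).sup fun m => SchwartzMap.seminorm ℂ m.1 m.2) g,
      fun y => ?_⟩
    have := SchwartzMap.one_add_le_sup_seminorm_apply (𝕜 := ℂ) (m := (N, 0)) (k := N) (n := 0)
      le_rfl le_rfl g y
    simpa using this
  refine ⟨|1 / Real.sqrt (2 * Real.pi)| * ((2 * Real.pi) ^ N * C), fun x => ?_⟩
  rw [key, norm_mul, norm_mul, Complex.norm_real, Complex.norm_real, Real.norm_eq_abs,
    Real.norm_eq_abs, abs_of_nonneg (by positivity : (0 : ℝ) ≤ (1 + |x|) ^ N), mul_left_comm]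
  refine mul_le_mul_of_nonneg_left ?_ (abs_nonneg _)
  have hpi : (1 : ℝ) ≤ 2 * Real.pi := by linarith [Real.pi_gt_three]
  have h3 : 1 + |x| ≤ (2 * Real.pi) * (1 + ‖x / (2 * Real.pi)‖) := by
    rw [norm_div, Real.norm_eq_abs, Real.norm_eq_abs, abs_of_pos (by positivity : 0 < 2 * Real.pi)]
    rw [mul_add, mul_div_cancel₀ _ (by positivity)]
    linarith
  calc (1 + |x|) ^ N * ‖g (x / (2 * Real.pi))‖
      ≤ ((2 * Real.pi) * (1 + ‖x / (2 * Real.pi)‖)) ^ N * ‖g (x / (2 * Real.pi))‖ := by gcongr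
    _ = (2 * Real.pi) ^ N * ((1 + ‖x / (2 * Real.pi)‖) ^ N * ‖g (x / (2 * Real.pi))‖) := by
      rw [mul_pow]; ring
    _ ≤ (2 * Real.pi) ^ N * C := by gcongr; exact hC _

theorem exists_Icc_of_compact {K : Set ℝ} (hK : IsCompact K) (h : K ⊆ Ioi 0) :
    ∃ c d : ℝ, 0 < c ∧ c < d ∧ K ⊆ Icc c d := by
  rcases K.eq_empty_or_nonempty with rfl | hne
  · exact ⟨1, 2, by norm_num, by norm_num, empty_subset _⟩
  · obtain ⟨m, hm, hm'⟩ := hK.exists_isLeast hne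
    obtain ⟨M, hM, hM'⟩ := hK.exists_isGreatest hne
    have : (0 : ℝ) < m := h hm
    exact ⟨m, M + 1, this, by linarith [hm' hM], fun x hx => ⟨hm' hx, by linarith [hM' hx]⟩⟩

theorem prod_restrict_eq (s : Set ℝ) :
    (volume : Measure ℝ).prod (volume.restrict s)
      = (volume : Measure (ℝ × ℝ)).restrict (univ ×ˢ s) := by
  rw [Measure.volume_eq_prod, ← Measure.prod_restrict, Measure.restrict_univ]

theorem IsPartialFourier.integrable_left {f : UpperHalfPlane → ℂ} {φ : ℝ → ℝ → ℂ}
    (H : IsPartialFourier f φ) {h k : ℝ → ℂ} (h1 : Continuous h) (h2 : HasCompactSupport h)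
    (k1 : Continuous k) (k2 : HasCompactSupport k) (k3 : tsupport k ⊆ Ioi 0) :
    Integrable (fun w : ℝ × ℝ => f (pt w.1 w.2) * (h w.1 * k w.2))
      ((volume : Measure ℝ).prod volPos) := by
  have hK : IsCompact (tsupport h ×ˢ tsupport k) := h2.isCompact.prod k2.isCompact
  have h3 := H.locallyIntegrable.integrableOn_compact_subset
    (prod_mono (subset_univ _) k3) hK
  have hc : ContinuousOn (fun w : ℝ × ℝ => h w.1 * k w.2) (tsupport h ×ˢ tsupport k) := by
    fun_prop
  have h4 := h3.mul_continuousOn hc hK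
  have h5 : Integrable (fun w : ℝ × ℝ => f (pt w.1 w.2) * (h w.1 * k w.2)) volume := by
    refine (integrableOn_iff_integrable_of_support_subset ?_).1 h4
    intro w hw
    have hw1 : h w.1 ≠ 0 := fun h0 => hw (by simp [h0])
    have hw2 : k w.2 ≠ 0 := fun h0 => hw (by simp [h0])
    exact ⟨subset_tsupport _ hw1, subset_tsupport _ hw2⟩
  rw [volPos, prod_restrict_eq]
  exact h5.restrict

theorem IsPartialFourier.integrable_right {f : UpperHalfPlane → ℂ} {φ : ℝ → ℝ → ℂ}
    (H : IsPartialFourier f φ) {h k : ℝ → ℂ} (h1 : ContDiff ℝ ∞ h) (h2 : HasCompactSupport h)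
    (k1 : Continuous k) (k2 : HasCompactSupport k) (k3 : tsupport k ⊆ Ioi 0) :
    Integrable (fun w : ℝ × ℝ => φ w.1 w.2 * (invFourier h w.1 * k w.2))
      ((volume : Measure ℝ).prod volPos) := by
  obtain ⟨c, d, hc, hcd, hK⟩ := exists_Icc_of_compact k2.isCompact k3
  obtain ⟨N, hN⟩ := H.tempered c d hc hcd
  obtain ⟨hcont, hdec⟩ := invFourier_decay h1 h2
  obtain ⟨C, hC⟩ := hdec N
  obtain ⟨D, hD⟩ := k2.exists_bound_of_continuous k1
  have h3 : Integrable (fun w : ℝ × ℝ => φ w.1 w.2 * (invFourier h w.1 * k w.2))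
      ((volume : Measure ℝ).prod (volume.restrict (Icc c d))) := by
    have h4 := hN.mul_bdd (c := C * D)
      (g := fun w : ℝ × ℝ => ((((1 + |w.1|) ^ N : ℝ) : ℂ) * invFourier h w.1) * k w.2)
      (by
        refine Continuous.aestronglyMeasurable ?_
        fun_prop)
      (Filter.Eventually.of_forall fun w => by
        rw [norm_mul]
        exact mul_le_mul (hC _) (hD _) (norm_nonneg _) ((norm_nonneg _).trans (hC w.1)))
    refine h4.congr (Filter.Eventually.of_forall fun w => ?_)
    have : (((1 + |w.1|) ^ N : ℝ) : ℂ) ≠ 0 := by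
      rw [Complex.ofReal_ne_zero]; positivity
    field_simp
  rw [volPos]
  rw [prod_restrict_eq] at h3 ⊢
  refine (IntegrableOn.of_forall_sdiff_eq_zero (s := univ ×ˢ Icc c d) (t := univ ×ˢ Ioi (0 : ℝ)) h3
    (MeasurableSet.univ.prod measurableSet_Ioi) ?_)
  rintro w ⟨-, hw⟩
  have : k w.2 = 0 := by
    by_contra h0
    exact hw ⟨mem_univ _, hK (subset_tsupport _ h0)⟩
  simp [this]

theorem IsPartialFourier.add {f g : UpperHalfPlane → ℂ} {φ χ : ℝ → ℝ → ℂ}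
    (H : IsPartialFourier f φ) (G : IsPartialFourier g χ) : IsPartialFourier (f + g) (φ + χ) where
  locallyIntegrable := H.locallyIntegrable.add G.locallyIntegrable
  tempered c d hc hcd := by
    obtain ⟨N, hN⟩ := H.tempered c d hc hcd
    obtain ⟨M, hM⟩ := G.tempered c d hc hcd
    have aux : ∀ (φ : ℝ → ℝ → ℂ) (N M : ℕ),
        Integrable (fun w : ℝ × ℝ => φ w.1 w.2 * (((1 + |w.1|) ^ N : ℝ) : ℂ)⁻¹)
          ((volume : Measure ℝ).prod (volume.restrict (Icc c d))) →
        Integrable (fun w : ℝ × ℝ => φ w.1 w.2 * (((1 + |w.1|) ^ (N + M) : ℝ) : ℂ)⁻¹)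
          ((volume : Measure ℝ).prod (volume.restrict (Icc c d))) := by
      intro φ N M hN
      have hne : ∀ (w : ℝ × ℝ) (n : ℕ), (((1 + |w.1|) ^ n : ℝ) : ℂ) ≠ 0 := fun w n => by
        rw [Complex.ofReal_ne_zero]; positivity
      have := hN.mul_bdd (c := 1) (g := fun w : ℝ × ℝ => (((1 + |w.1|) ^ M : ℝ) : ℂ)⁻¹)
        (by
          refine Continuous.aestronglyMeasurable ?_
          refine Continuous.inv₀ (by fun_prop) (fun w => hne w M))
        (Filter.Eventually.of_forall fun w => by
          rw [norm_inv, Complex.norm_real, Real.norm_eq_abs, abs_of_nonneg (by positivity)]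
          exact inv_le_one_of_one_le₀ (one_le_pow₀ (by linarith [abs_nonneg w.1])))
      refine this.congr (Filter.Eventually.of_forall fun w => ?_)
      simp only [pow_add, Complex.ofReal_mul, mul_inv, mul_assoc]
    refine ⟨N + M, ?_⟩
    have hM' := aux χ M N hM
    rw [add_comm M N] at hM'
    refine ((aux φ N M hN).add hM').congr (Filter.Eventually.of_forall fun w => ?_)
    simp only [Pi.add_apply, add_mul]
  pairing h k h1 h2 k1 k2 k3 := by
    have e1 := integral_add (H.integrable_left h1.continuous h2 k1.continuous k2 k3)
      (G.integrable_left h1.continuous h2 k1.continuous k2 k3)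
    have e2 := integral_add (H.integrable_right h1 h2 k1.continuous k2 k3)
      (G.integrable_right h1 h2 k1.continuous k2 k3)
    simp only [Pi.add_apply, add_mul]
    rw [e1, e2, H.pairing h k h1 h2 k1 k2 k3, G.pairing h k h1 h2 k1 k2 k3]

theorem IsPartialFourier.smul {f : UpperHalfPlane → ℂ} {φ : ℝ → ℝ → ℂ} (c : ℂ)
    (H : IsPartialFourier f φ) : IsPartialFourier (c • f) (c • φ) where
  locallyIntegrable := H.locallyIntegrable.smul c
  tempered a b ha hab := by
    obtain ⟨N, hN⟩ := H.tempered a b ha hab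
    refine ⟨N, (hN.const_mul c).congr (Filter.Eventually.of_forall fun w => ?_)⟩
    simp only [Pi.smul_apply, smul_eq_mul, mul_assoc]
  pairing h k h1 h2 k1 k2 k3 := by
    simp only [Pi.smul_apply, smul_eq_mul, mul_assoc]
    rw [integral_const_mul, integral_const_mul, H.pairing h k h1 h2 k1 k2 k3]

theorem IsPartialFourier.zero : IsPartialFourier 0 0 where
  locallyIntegrable := by
    simpa using! (locallyIntegrable_zero (ε'' := ℂ) (μ := (volume : Measure (ℝ × ℝ)))).locallyIntegrableOn _
  tempered c d _ _ := ⟨0, by simp⟩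
  pairing h k _ _ _ _ _ := by simp

theorem MemMixed.zero {lam q p : ℝ} (hq : 1 ≤ q) : MemMixed lam q p 0 := by
  refine ⟨aestronglyMeasurable_const (b := (0 : ℂ)), ?_⟩
  have hq0 : 0 < q := by linarith
  simp only [mixedNorm, Pi.zero_apply, eLpNorm_zero, ENNReal.zero_rpow_of_pos hq0, lintegral_zero,
    ENNReal.zero_rpow_of_pos (one_div_pos.2 hq0), ENNReal.zero_lt_top]

theorem mixedNorm_lt_top_iff {lam q p : ℝ} (hq : 1 ≤ q) (φ : ℝ → ℝ → ℂ) :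
    mixedNorm lam q p φ < ⊤ ↔
      ∫⁻ ξ : ℝ, eLpNorm (φ ξ) (ENNReal.ofReal p) (nu lam) ^ q < ⊤ := by
  rw [mixedNorm, ENNReal.rpow_lt_top_iff_of_pos (by positivity)]

theorem MemMixed.smul {lam q p : ℝ} (hq : 1 ≤ q) {φ : ℝ → ℝ → ℂ} (c : ℂ)
    (H : MemMixed lam q p φ) : MemMixed lam q p (c • φ) := by
  have hq0 : 0 ≤ q := by linarith
  refine ⟨H.1.const_smul c, ?_⟩
  have h2 := H.2
  rw [mixedNorm_lt_top_iff hq] at h2 ⊢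
  have : ∀ ξ, eLpNorm ((c • φ) ξ) (ENNReal.ofReal p) (nu lam) ^ q
      = ‖c‖ₑ ^ q * eLpNorm (φ ξ) (ENNReal.ofReal p) (nu lam) ^ q := fun ξ => by
    rw [Pi.smul_apply, eLpNorm_const_smul, ENNReal.mul_rpow_of_nonneg _ _ hq0]
  simp only [this]
  have hc : ‖c‖ₑ ^ q ≠ ⊤ := ENNReal.rpow_ne_top_of_nonneg hq0 enorm_ne_top
  rw [lintegral_const_mul' _ _ hc]
  exact ENNReal.mul_lt_top hc.lt_top h2

theorem nu_absolutelyContinuous (lam : ℝ) : nu lam ≪ volPos := withDensity_absolutelyContinuous _ _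

theorem MemMixed.add {lam q p : ℝ} (hq : 1 ≤ q) (hp : 1 ≤ p) {φ χ : ℝ → ℝ → ℂ}
    (H : MemMixed lam q p φ) (G : MemMixed lam q p χ) : MemMixed lam q p (φ + χ) := by
  have hq0 : 0 ≤ q := by linarith
  have hac : (volume : Measure ℝ).prod (nu lam) ≪ (volume : Measure ℝ).prod volPos :=
    Measure.AbsolutelyContinuous.rfl.prod (nu_absolutelyContinuous lam)
  have hp1 : 1 ≤ ENNReal.ofReal p := by simpa using ENNReal.ofReal_le_ofReal hp
  have meas : ∀ φ : ℝ → ℝ → ℂ, MemMixed lam q p φ →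
      (∀ᵐ ξ, AEStronglyMeasurable (φ ξ) (nu lam)) ∧
        AEMeasurable (fun ξ => eLpNorm (φ ξ) (ENNReal.ofReal p) (nu lam) ^ q) := by
    intro φ H
    have hm := H.1.mono_ac hac
    refine ⟨hm.prodMk_left, ?_⟩
    have hp0 : ENNReal.ofReal p ≠ 0 := (zero_lt_one.trans_le hp1).ne'
    simp only [eLpNorm_eq_lintegral_rpow_enorm_toReal hp0 ENNReal.ofReal_ne_top]
    refine AEMeasurable.pow_const (AEMeasurable.pow_const ?_ _) _
    exact AEMeasurable.lintegral_prod_right'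
      (f := fun w : ℝ × ℝ => ‖φ w.1 w.2‖ₑ ^ (ENNReal.ofReal p).toReal) (hm.enorm.pow_const _)
  refine ⟨H.1.add G.1, ?_⟩
  have h2 := H.2
  have g2 := G.2
  rw [mixedNorm_lt_top_iff hq] at h2 g2 ⊢
  have hle : ∀ᵐ ξ : ℝ, eLpNorm ((φ + χ) ξ) (ENNReal.ofReal p) (nu lam) ^ q ≤
      2 ^ (q - 1) * (eLpNorm (φ ξ) (ENNReal.ofReal p) (nu lam) ^ q +
        eLpNorm (χ ξ) (ENNReal.ofReal p) (nu lam) ^ q) := by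
    filter_upwards [(meas φ H).1, (meas χ G).1] with ξ m1 m2
    refine (ENNReal.rpow_le_rpow (eLpNorm_add_le m1 m2 hp1) hq0).trans ?_
    exact ENNReal.rpow_add_le_mul_rpow_add_rpow _ _ hq
  refine (lintegral_mono_ae hle).trans_lt ?_
  have hc : (2 : ℝ≥0∞) ^ (q - 1) ≠ ⊤ :=
    ENNReal.rpow_ne_top_of_nonneg (by linarith) (by simp)
  rw [lintegral_const_mul' _ _ hc, lintegral_add_left' (meas φ H).2]
  exact ENNReal.mul_lt_top hc.lt_top (ENNReal.add_lt_top.2 ⟨h2, g2⟩)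

/-- The space `𝓐^{q,p}_λ(Π)`. -/
def bergmanSpace (lam q p : ℝ) (hq : 1 ≤ q) (hp : 1 ≤ p) : Submodule ℂ (UpperHalfPlane → ℂ) where
  carrier := {f | MemBergman lam q p f}
  add_mem' := by
    rintro f g ⟨f1, φ, f2, f3⟩ ⟨g1, χ, g2, g3⟩
    exact ⟨f1.add g1, φ + χ, f2.add g2, f3.add hq hp g3⟩
  zero_mem' := ⟨differentiableOn_const 0, 0, IsPartialFourier.zero, MemMixed.zero hq⟩
  smul_mem' := by
    rintro c f ⟨f1, φ, f2, f3⟩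
    exact ⟨f1.const_smul c, c • φ, f2.smul c, f3.smul hq c⟩

end MixedFourier

end

open MixedFourier

noncomputable section

namespace MixedFourier

open Filter Topology FourierTransform

/-! The isometry is of Paley–Wiener type. For holomorphic `f`, the Cauchy–Riemann equation becomes
`∂_y φ = -ξ φ` for the Fourier transform `φ` in `x`, whence `φ(ξ, y) = g(ξ) e^{-ξ y}`
(`IsPartialFourier.exists_eq_mul_exp`). The measure `ν_λ` has infinite mass, so a finite norm forces
`g = 0` on `ξ ≤ 0`; for `ξ > 0` the norm of `e^{-ξ y}` in `L^p(ν_λ)` is `1 / θ(ξ)`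
(`eLpNorm_mul_exp`). Dividing `g` by `√π θ` therefore identifies the Bergman space isometrically
with `L^q(ℝ_+)` (`exists_eq_synthesis`, `fourierMixedNorm_synthesis`). The inverse map is
`synthesis`, an inverse Fourier transform on each horizontal line.

The transform is distributional and is tested on products only. Two separation results make it
usable: transforms of test functions suffice as tests in `ξ`
(`integral_mul_comp_eq_zero_of_invFourier`), and products of test functions detect functions almost
everywhere (`ae_eq_zero_of_integral_tensor`).

Multiplication by `a(y)` commutes with the Fourier transform in `x`
(`isPartialFourier_mul_synthesis`), so `U_λ` sends `a R_λ⁻¹ φ` to `φ(x) a(β(x, y)) e^{-y/p}` for `x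
> 0`. Applying `R_0⁻¹` leaves `φ(x) ∫ a(β(x, η)) e^{-η} dη`, and the substitution `η = ψ(x, t)`
turns the integral into `γ_{a,λ}(x)` (`integral_comp_beta`). The symbol `a = 1` gives `γ = 1`, which
shows that `synthesis` inverts `R_λ`; a general symbol gives the diagonalization, domains included
(`isToeplitz_synthesis_iff`).

For `p = q = 2`, Plancherel on horizontal lines and the Cauchy–Schwarz inequality show that `γ_a φ`
is in `L²` when `a f` is (`memLp_gammaSymbol_mul`). The Bergman kernel is, up to a reflection in `x`
and a constant, itself a `synthesis`, so Parseval on lines and Fubini yield the classical formula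
(`synthesis_gammaSymbol_mul`). -/

/-! ### Fourier inversion and Plancherel in the symmetric normalization. -/

theorem invFourier_eq_fourierInv (h : ℝ → ℂ) (x : ℝ) :
    invFourier h x = ((1 / Real.sqrt (2 * Real.pi) : ℝ) : ℂ) * 𝓕⁻ h (x / (2 * Real.pi)) := by
  rw [invFourier, Real.fourierInv_eq']
  congr 1
  refine integral_congr_ae (Filter.Eventually.of_forall fun u => ?_)
  simp only [smul_eq_mul]
  congr 2
  have : (2 * Real.pi * inner ℝ u (x / (2 * Real.pi)) : ℝ) = u * x := by
    simp
    field_simp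
  rw [this]
  push_cast
  ring

/-- The Jacobian `2π` of the substitution `u = 2π s` cancels the square of the prefactor
`(2π)^{-1/2}`, so no constant survives. -/
theorem invFourier_invFourier (h : ℝ → ℂ) (x : ℝ) :
    invFourier (invFourier h) x = 𝓕⁻ (𝓕⁻ h) x := by
  have hpi : (0 : ℝ) < 2 * Real.pi := by positivity
  have e1 : invFourier (invFourier h) x = ((1 / Real.sqrt (2 * Real.pi) : ℝ) : ℂ) *
      ∫ u : ℝ, (fun s : ℝ => Complex.exp (2 * Real.pi * I * s * x) *
        (((1 / Real.sqrt (2 * Real.pi) : ℝ) : ℂ) * 𝓕⁻ h s)) (u / (2 * Real.pi)) := by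
    rw [invFourier]
    congr 1
    refine integral_congr_ae (Filter.Eventually.of_forall fun u => ?_)
    simp only [invFourier_eq_fourierInv]
    congr 2
    have : (2 * Real.pi : ℂ) ≠ 0 := by exact_mod_cast hpi.ne'
    push_cast
    field_simp
  rw [e1, Measure.integral_comp_div (fun s : ℝ => Complex.exp (2 * Real.pi * I * s * x) *
        (((1 / Real.sqrt (2 * Real.pi) : ℝ) : ℂ) * 𝓕⁻ h s)), Real.fourierInv_eq', abs_of_pos hpi, real_smul,
    ← integral_const_mul, ← integral_const_mul]
  refine integral_congr_ae (Filter.Eventually.of_forall fun s => ?_)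
  simp only [smul_eq_mul]
  have h2 : (((1 / Real.sqrt (2 * Real.pi) : ℝ) : ℂ)) * (((1 / Real.sqrt (2 * Real.pi) : ℝ) : ℂ)) *
      ((2 * Real.pi : ℝ) : ℂ) = 1 := by
    rw [← Complex.ofReal_mul, ← Complex.ofReal_mul, ← Complex.ofReal_one]
    congr 1
    have := Real.mul_self_sqrt hpi.le
    field_simp
    nlinarith
  have h3 : Complex.exp (2 * Real.pi * I * s * x) =
      Complex.exp (((2 * Real.pi * inner ℝ s x : ℝ) : ℂ) * I) := by
    congr 1
    simp
    ring
  rw [h3]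
  linear_combination (Complex.exp (((2 * Real.pi * inner ℝ s x : ℝ) : ℂ) * I) * 𝓕⁻ h s) * h2

theorem invFourier_norm_le (h : ℝ → ℂ) (x : ℝ) :
    ‖invFourier h x‖ ≤ 1 / Real.sqrt (2 * Real.pi) * ∫ u, ‖h u‖ := by
  rw [invFourier, norm_mul, Complex.norm_real, Real.norm_eq_abs, abs_of_nonneg (by positivity)]
  gcongr
  refine (norm_integral_le_integral_norm _).trans_eq (integral_congr_ae (.of_forall fun u => ?_))
  have : I * u * x = ((u * x : ℝ) : ℂ) * I := by push_cast; ring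
  simp only [norm_mul, this, Complex.norm_exp_ofReal_mul_I, one_mul]

theorem continuous_invFourier {h : ℝ → ℂ} (hh : Integrable h) : Continuous (invFourier h) := by
  have : invFourier h = fun x : ℝ => ((1 / Real.sqrt (2 * Real.pi) : ℝ) : ℂ) *
    ∫ u : ℝ, Complex.exp (I * u * x) * h u := rfl
  rw [this]
  refine continuous_const.mul (continuous_of_dominated (bound := fun u => ‖h u‖) ?_ ?_ hh.norm ?_)
  · intro x
    exact (Continuous.aestronglyMeasurable (by fun_prop)).mul hh.1
  · intro x
    refine .of_forall fun u => ?_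
    have : I * u * x = ((u * x : ℝ) : ℂ) * I := by push_cast; ring
    simp only [norm_mul, this, Complex.norm_exp_ofReal_mul_I, one_mul, le_refl]
  · exact .of_forall fun u => by fun_prop

/-- Fubini, the kernel `e^{iux}` being symmetric in its two variables and of modulus one. -/
theorem integral_invFourier_mul {P K : ℝ → ℂ} (hP : Integrable P) (hK : Integrable K) :
    ∫ x, invFourier P x * K x = ∫ u, P u * invFourier K u := by
  have hint : Integrable (Function.uncurry fun x u : ℝ =>
      Complex.exp (I * u * x) * (P u * K x)) ((volume : Measure ℝ).prod volume) := by
    have h1 : Integrable (fun w : ℝ × ℝ => K w.1 * P w.2)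
      ((volume : Measure ℝ).prod volume) := hK.mul_prod hP
    refine (h1.bdd_mul (c := 1)
      (f := fun w : ℝ × ℝ => Complex.exp (I * w.2 * w.1)) ?_ ?_).congr ?_
    · exact Continuous.aestronglyMeasurable (by fun_prop)
    · refine .of_forall fun w => ?_
      have : I * w.2 * w.1 = ((w.2 * w.1 : ℝ) : ℂ) * I := by push_cast; ring
      rw [this, Complex.norm_exp_ofReal_mul_I]
    · exact .of_forall fun w => by simp only [Function.uncurry]; ring
  have e1 : ∀ x, invFourier P x * K x = ((1 / Real.sqrt (2 * Real.pi) : ℝ) : ℂ) *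
      ∫ u : ℝ, Complex.exp (I * u * x) * (P u * K x) := fun x => by
    simp only [invFourier, mul_assoc, ← integral_mul_const]
  have e2 : ∀ u, P u * invFourier K u = ((1 / Real.sqrt (2 * Real.pi) : ℝ) : ℂ) *
      ∫ x : ℝ, Complex.exp (I * u * x) * (P u * K x) := fun u => by
    rw [invFourier, mul_left_comm, ← integral_const_mul]
    congr 1
    refine integral_congr_ae (.of_forall fun x => ?_)
    simp only
    rw [show I * u * x = I * (x * u : ℂ) by ring, mul_assoc I]
    ring
  simp only [e1, e2, integral_const_mul]
  rw [integral_integral_swap hint]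

theorem integrable_pow_mul_invFourier {h : ℝ → ℂ} (h1 : ContDiff ℝ ∞ h) (h2 : HasCompactSupport h)
    (N : ℕ) : Integrable fun x : ℝ => (((1 + |x|) ^ N : ℝ) : ℂ) * invFourier h x := by
  obtain ⟨hcont, hdec⟩ := invFourier_decay h1 h2
  obtain ⟨C, hC⟩ := hdec (N + 2)
  refine (integrable_inv_one_add_sq.const_mul C).mono' (by fun_prop) (.of_forall fun x => ?_)
  have h3 := hC x
  rw [norm_mul, Complex.norm_real, Real.norm_eq_abs, abs_of_nonneg (by positivity)] at h3 ⊢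
  rw [← div_eq_mul_inv, le_div_iff₀ (by positivity)]
  refine le_trans ?_ h3
  rw [pow_add]
  have : 1 + x ^ 2 ≤ (1 + |x|) ^ 2 := by
    rw [← sq_abs x]; nlinarith [abs_nonneg x]
  calc (1 + |x|) ^ N * ‖invFourier h x‖ * (1 + x ^ 2)
      ≤ (1 + |x|) ^ N * ‖invFourier h x‖ * (1 + |x|) ^ 2 := by gcongr
    _ = _ := by ring

theorem integrable_invFourier {h : ℝ → ℂ} (h1 : ContDiff ℝ ∞ h) (h2 : HasCompactSupport h) :
    Integrable (invFourier h) := by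
  simpa using integrable_pow_mul_invFourier h1 h2 0

theorem invFourier_invFourier_of_contDiff {h : ℝ → ℂ} (h1 : ContDiff ℝ ∞ h)
    (h2 : HasCompactSupport h) (x : ℝ) : invFourier (invFourier h) x = h (-x) := by
  rw [invFourier_invFourier, Real.fourierInv_eq_fourier_neg]
  let g : SchwartzMap ℝ ℂ := h2.toSchwartzMap h1
  have : 𝓕 (𝓕⁻ g) = g := FourierTransform.fourier_fourierInv_eq g
  have h3 := congrArg (fun f : SchwartzMap ℝ ℂ => f (-x)) this
  simp only [SchwartzMap.fourier_coe, SchwartzMap.fourierInv_coe] at h3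
  exact h3

theorem ae_eq_of_integral_mul_eq {f g : ℝ → ℂ} (hf : LocallyIntegrable f)
    (hg : LocallyIntegrable g)
    (h : ∀ u : ℝ → ℂ, ContDiff ℝ ∞ u → HasCompactSupport u → ∫ x, f x * u x = ∫ x, g x * u x) :
    f =ᵐ[volume] g := by
  refine ae_eq_of_integral_contDiff_smul_eq hf hg fun u u1 u2 => ?_
  have := h (fun x => (u x : ℂ)) (Complex.ofRealCLM.contDiff.comp u1)
    (u2.comp_left (g := fun x : ℝ => (x : ℂ)) Complex.ofReal_zero)
  simpa only [real_smul, mul_comm] using this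

/-- By symmetry both transforms move onto a test function, where Schwartz inversion applies; test
functions then determine a locally integrable function. -/
theorem invFourier_invFourier_ae {h : ℝ → ℂ} (h1 : Integrable h)
    (h2 : Integrable (invFourier h)) :
    invFourier (invFourier h) =ᵐ[volume] fun x => h (-x) := by
  refine ae_eq_of_integral_mul_eq (continuous_invFourier h2).locallyIntegrable
    h1.comp_neg.locallyIntegrable fun u u1 u2 => ?_
  have hu : Integrable u := u1.continuous.integrable_of_hasCompactSupport u2
  rw [integral_invFourier_mul h2 hu, integral_invFourier_mul h1 (integrable_invFourier u1 u2)]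
  simp only [invFourier_invFourier_of_contDiff u1 u2]
  rw [← integral_neg_eq_self]
  simp

/-- The `L²` transform and the integral transform define the same tempered distribution, and both
are locally integrable. -/
theorem fourier_toLp_ae {f : ℝ → ℂ} (h1 : Integrable f) (h2 : MemLp f 2) :
    (𝓕 (h2.toLp f) : Lp ℂ 2 (volume : Measure ℝ)) =ᵐ[volume] 𝓕 f := by
  have hc : Continuous (𝓕 f) := VectorFourier.fourierIntegral_continuous
    Real.continuous_fourierChar continuous_inner h1
  have hl : LocallyIntegrable (𝓕 (h2.toLp f) : Lp ℂ 2 (volume : Measure ℝ)) volume :=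
    (Lp.memLp _).locallyIntegrable (by norm_num)
  refine ae_eq_of_integral_mul_eq hl hc.locallyIntegrable fun u u1 u2 => ?_
  let g : SchwartzMap ℝ ℂ := u2.toSchwartzMap u1
  have e1 := congrArg (fun T => T g) (Lp.fourier_toTemperedDistribution_eq (h2.toLp f))
  simp only [TemperedDistribution.fourier_apply, Lp.toTemperedDistribution_apply, smul_eq_mul] at e1
  have e2 : ∫ x, (𝓕 g) x * (h2.toLp f) x = ∫ x, (𝓕 u) x * f x := by
    refine integral_congr_ae ?_
    filter_upwards [h2.coeFn_toLp] with x hx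
    rw [hx, SchwartzMap.fourier_coe]
    rfl
  have e3 : ∫ x, (𝓕 u) x * f x = ∫ x, u x * 𝓕 f x := by
    have := VectorFourier.integral_fourierIntegral_smul_eq_flip (L := innerₗ ℝ) (μ := volume)
      (ν := volume) Real.continuous_fourierChar continuous_inner
      (u1.continuous.integrable_of_hasCompactSupport u2) h1
    simpa using! this
  simp only [mul_comm _ (u _)]
  rw [← e3, ← e2, e1]
  rfl

/-- Plancherel survives the change of normalization: the dilation by `-1/(2π)` has a Jacobian that
cancels the squared prefactor `1/(2π)`. -/
theorem eLpNorm_invFourier {f : ℝ → ℂ} (h1 : Integrable f) (h2 : MemLp f 2) :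
    ∫⁻ x, ‖invFourier f x‖ₑ ^ 2 = ∫⁻ x, ‖f x‖ₑ ^ 2 := by
  have hpi : (0 : ℝ) < 2 * Real.pi := by positivity
  have key : ∫⁻ x, ‖𝓕 f x‖ₑ ^ 2 = ∫⁻ x, ‖f x‖ₑ ^ 2 := by
    have e1 : eLpNorm (𝓕 f) 2 volume = eLpNorm f 2 volume := by
      rw [← eLpNorm_congr_ae (fourier_toLp_ae h1 h2), ← eLpNorm_congr_ae h2.coeFn_toLp,
        ← ENNReal.ofReal_toReal (Lp.eLpNorm_ne_top _), ← Lp.norm_def, Lp.norm_fourier_eq,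
        Lp.norm_def, ENNReal.ofReal_toReal (Lp.eLpNorm_ne_top _)]
    have e2 := congrArg (fun t : ℝ≥0∞ => t ^ (2 : ℝ)) e1
    rw [eLpNorm_eq_lintegral_rpow_enorm_toReal (by simp) (by simp),
      eLpNorm_eq_lintegral_rpow_enorm_toReal (by simp) (by simp)] at e2
    simp only [← ENNReal.rpow_mul] at e2
    simpa using e2
  have e3 : ∀ x, ‖invFourier f x‖ₑ ^ 2 =
      (ENNReal.ofReal (1 / (2 * Real.pi))) * ‖𝓕 f (-((2 * Real.pi)⁻¹) * x)‖ₑ ^ 2 := fun x => by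
    rw [invFourier_eq_fourierInv, Real.fourierInv_eq_fourier_neg, enorm_mul, mul_pow]
    congr 1
    · rw [← ofReal_norm, ← ENNReal.ofReal_pow (norm_nonneg _), Complex.norm_real,
        Real.norm_eq_abs, sq_abs, div_pow, Real.sq_sqrt hpi.le, one_pow]
    · congr 4; field_simp
  simp only [e3]
  have hm : Measurable fun x => ‖𝓕 f x‖ₑ ^ 2 :=
    (VectorFourier.fourierIntegral_continuous Real.continuous_fourierChar continuous_inner
      h1).measurable.enorm.pow_const 2
  have ha : -((2 * Real.pi)⁻¹) ≠ 0 := neg_ne_zero.2 (inv_pos.2 hpi).ne'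
  rw [lintegral_const_mul' _ _ ENNReal.ofReal_ne_top, ← key]
  conv_rhs => rw [← Real.smul_map_volume_mul_left ha]
  rw [lintegral_smul_measure, lintegral_map hm (by fun_prop), abs_neg, abs_of_pos (inv_pos.2 hpi),
    one_div, smul_eq_mul]

/-! ### Test functions that separate: transforms of test functions, and products. -/

theorem one_add_abs_le_mul (a b : ℝ) : 1 + |a| ≤ (1 + |a - b|) * (1 + |b|) := by
  have := abs_add_le (a - b) b
  rw [sub_add_cancel] at this
  nlinarith [abs_nonneg (a - b), abs_nonneg b, mul_nonneg (abs_nonneg (a - b)) (abs_nonneg b)]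

/-- Dilation narrows the transform to width `1/n` and modulation centres it at `s`. Transforms of
test functions thus contain an approximate identity. -/
theorem invFourier_dilate_modulate (h : ℝ → ℂ) {n : ℝ} (hn : 0 < n) (s ξ : ℝ) :
    invFourier (fun x => h (x / n) * Complex.exp (-(I * s * x))) ξ =
      n * invFourier h (n * (ξ - s)) := by
  have e : ∀ u : ℝ, Complex.exp (I * u * ξ) * (h (u / n) * Complex.exp (-(I * s * u))) =
      (fun v : ℝ => Complex.exp (I * v * (n * (ξ - s) : ℝ)) * h v) (u / n) := fun u => by
    have hn' : (n : ℂ) ≠ 0 := by exact_mod_cast hn.ne'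
    simp only
    rw [mul_left_comm, ← Complex.exp_add, mul_comm]
    congr 2
    push_cast
    field_simp
    ring
  simp only [invFourier, e]
  rw [Measure.integral_comp_div (fun v : ℝ => Complex.exp (I * v * (n * (ξ - s) : ℝ)) * h v),
    abs_of_pos hn, real_smul]
  ring

/-- Transforms of test functions include all narrow peaks `ρ(n(ξ - s))`. Superposing them with
weights `u(s)` gives mollifications of `u`, which converge to a nonzero multiple of `u` uniformly
dominated by `(1 + |ξ|)^{-N}`, and this suffices against a function of polynomial growth. -/
theorem integral_mul_comp_eq_zero_of_invFourier {Ω : Type*} [MeasurableSpace Ω] {μ : Measure Ω}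
    [SFinite μ] {X : Ω → ℝ} (hX : Measurable X) {ψ : Ω → ℂ} {N : ℕ}
    (hψ : Integrable (fun w => ψ w * (((1 + |X w|) ^ N : ℝ) : ℂ)⁻¹) μ)
    (H : ∀ h : ℝ → ℂ, ContDiff ℝ ∞ h → HasCompactSupport h →
      ∫ w, ψ w * invFourier h (X w) ∂μ = 0)
    {u : ℝ → ℂ} (u1 : Continuous u) (u2 : HasCompactSupport u) :
    ∫ w, ψ w * u (X w) ∂μ = 0 := by
  have hne : ∀ x : ℝ, (((1 + |x|) ^ N : ℝ) : ℂ) ≠ 0 := fun x => by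
    rw [Complex.ofReal_ne_zero]; positivity
  let b : ContDiffBump (0 : ℝ) := ⟨1, 2, by norm_num, by norm_num⟩
  let χ : ℝ → ℂ := fun x => (b x : ℂ)
  have χ1 : ContDiff ℝ ∞ χ := Complex.ofRealCLM.contDiff.comp b.contDiff
  have χ2 : HasCompactSupport χ :=
    b.hasCompactSupport.comp_left (g := fun x : ℝ => (x : ℂ)) Complex.ofReal_zero
  have χ0 : χ 0 = 1 := by
    simp only [χ, b.one_of_mem_closedBall (Metric.mem_closedBall_self b.rIn_pos.le), ofReal_one]
  set ρ := invFourier χ with hρ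
  have ρi : Integrable ρ := integrable_invFourier χ1 χ2
  have ρc : Continuous ρ := (invFourier_decay χ1 χ2).1
  obtain ⟨C, hC⟩ := (invFourier_decay χ1 χ2).2 N
  -- By inversion at `0` the integral of `ρ` is `√(2π) χ(0)`, and `χ(0) = 1`.
  have ρint : ∫ t, ρ t ≠ 0 := by
    intro h0
    have h1 := invFourier_invFourier_of_contDiff χ1 χ2 0
    rw [neg_zero, χ0, invFourier] at h1
    simp only [ofReal_zero, mul_zero, Complex.exp_zero, one_mul] at h1
    rw [← hρ, h0, mul_zero] at h1
    exact zero_ne_one h1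
  obtain ⟨D, hD⟩ : ∃ D, ∀ s, ‖(((1 + |s|) ^ N : ℝ) : ℂ) * u s‖ ≤ D :=
    (u2.mul_left (f := fun s : ℝ => (((1 + |s|) ^ N : ℝ) : ℂ))).exists_bound_of_continuous
      (by fun_prop)
  obtain ⟨E, hE⟩ := u2.exists_bound_of_continuous u1
  have uint : Integrable fun s : ℝ => u s * (((1 + |s|) ^ N : ℝ) : ℂ) :=
    Continuous.integrable_of_hasCompactSupport (by fun_prop) u2.mul_right
  -- vanishing of the mollified integrals
  have step1 : ∀ n : ℝ, 1 ≤ n → ∀ s : ℝ, ∫ w, ψ w * ρ (n * (X w - s)) ∂μ = 0 := by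
    intro n hn s
    have hn0 : 0 < n := by linarith
    have := H (fun x => χ (x / n) * Complex.exp (-(I * s * x)))
      ((χ1.comp (contDiff_id.div_const n)).mul
        (by
          have : ContDiff ℝ ∞ fun x : ℝ => (x : ℂ) := Complex.ofRealCLM.contDiff
          fun_prop))
      (by
        refine HasCompactSupport.mul_right ?_
        have := χ2.comp_homeomorph (Homeomorph.mulLeft₀ n⁻¹ (by positivity))
        simp only [div_eq_inv_mul]
        exact this)
    simp only [invFourier_dilate_modulate χ hn0, mul_left_comm _ (n : ℂ), integral_const_mul] at this
    exact (mul_eq_zero.1 this).resolve_left (by exact_mod_cast hn0.ne')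
  -- The growth `(1 + |X|)^N` is paid for by `(1 + |s|)^N`, harmless on the support of `u`, and by
  -- the decay of `ρ` at `n (X - s)`; this is where `n ≥ 1` is needed.
  have fub : ∀ n : ℝ, 1 ≤ n → Integrable (Function.uncurry fun (w : Ω) (s : ℝ) =>
      ψ w * (u s * ρ (n * (X w - s)))) (μ.prod volume) := by
    intro n hn
    have hn0 : 0 ≤ n := by linarith
    have h1 := hψ.mul_prod uint
    refine (h1.mul_bdd (c := C) (g := fun w : Ω × ℝ => (((1 + |X w.1|) ^ N : ℝ) : ℂ) *
      (((1 + |w.2|) ^ N : ℝ) : ℂ)⁻¹ * ρ (n * (X w.1 - w.2))) ?_ ?_).congr ?_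
    · refine Measurable.aestronglyMeasurable ?_
      have := ρc.measurable
      fun_prop
    · refine .of_forall fun w => ?_
      rw [norm_mul, norm_mul, norm_inv, Complex.norm_real, Complex.norm_real, Real.norm_eq_abs,
        Real.norm_eq_abs, abs_of_nonneg (by positivity : (0 : ℝ) ≤ (1 + |X w.1|) ^ N),
        abs_of_nonneg (by positivity : (0 : ℝ) ≤ (1 + |w.2|) ^ N)]
      refine le_trans ?_ (hC (n * (X w.1 - w.2)))
      rw [norm_mul, Complex.norm_real, Real.norm_eq_abs,
        abs_of_nonneg (by positivity : (0 : ℝ) ≤ (1 + |n * (X w.1 - w.2)|) ^ N)]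
      refine mul_le_mul_of_nonneg_right ?_ (norm_nonneg _)
      rw [← div_eq_mul_inv, div_le_iff₀ (by positivity), ← mul_pow]
      refine pow_le_pow_left₀ (by positivity) ((one_add_abs_le_mul (X w.1) w.2).trans ?_) _
      refine mul_le_mul_of_nonneg_right ?_ (by positivity)
      rw [abs_mul, abs_of_nonneg hn0]
      nlinarith [abs_nonneg (X w.1 - w.2)]
    · refine .of_forall fun w => ?_
      have h2 := hne (X w.1)
      have h3 := hne w.2
      simp only [Function.uncurry]
      field_simp
  -- The mollification at scale `1 / (n + 1)`, in the form suited to the limit; `hV` is the form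
  -- suited to `step1`. The shift `n + 1` keeps the dilation factor at least `1`.
  let V : ℕ → ℝ → ℂ := fun n ξ => ∫ t, u (ξ - t / (n + 1 : ℝ)) * ρ t
  have hV : ∀ n ξ, V n ξ = ((n + 1 : ℝ) : ℂ) * ∫ s, u s * ρ ((n + 1 : ℝ) * (ξ - s)) := by
    intro n ξ
    have hn0 : (0 : ℝ) < n + 1 := by positivity
    rw [← integral_sub_left_eq_self (fun s => u s * ρ ((n + 1 : ℝ) * (ξ - s))) volume ξ]
    have := Measure.integral_comp_div (fun t => u (ξ - t) * ρ ((n + 1 : ℝ) * t)) (n + 1 : ℝ)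
    rw [abs_of_pos hn0, real_smul] at this
    simp only [sub_sub_cancel]
    rw [← this]
    refine integral_congr_ae (.of_forall fun t => ?_)
    simp only
    rw [mul_div_cancel₀ _ hn0.ne']
  have step2 : ∀ n, ∫ w, ψ w * V n (X w) ∂μ = 0 := by
    intro n
    have hn : (1 : ℝ) ≤ n + 1 := by simp
    simp only [hV, mul_left_comm _ ((_ : ℝ) : ℂ), integral_const_mul]
    refine mul_eq_zero_of_right _ ?_
    simp only [← integral_const_mul]
    rw [integral_integral_swap (fub _ hn)]
    simp only [mul_left_comm (ψ _), integral_const_mul, step1 _ hn, mul_zero, integral_zero]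
  have Vc : ∀ n, Continuous (V n) := by
    intro n
    refine continuous_of_dominated (bound := fun t => E * ‖ρ t‖) ?_ ?_ (ρi.norm.const_mul _) ?_
    · exact fun ξ => Continuous.aestronglyMeasurable (by fun_prop)
    · exact fun ξ => .of_forall fun t => by
        rw [norm_mul]; exact mul_le_mul_of_nonneg_right (hE _) (norm_nonneg _)
    · exact .of_forall fun t => by fun_prop
  have Vlim : ∀ ξ, Tendsto (fun n => V n ξ) atTop (𝓝 (∫ t, u ξ * ρ t)) := by
    intro ξ
    refine tendsto_integral_of_dominated_convergence (fun t => E * ‖ρ t‖) ?_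
      (ρi.norm.const_mul _) ?_ ?_
    · exact fun n => Continuous.aestronglyMeasurable (by fun_prop)
    · exact fun n => .of_forall fun t => by
        rw [norm_mul]; exact mul_le_mul_of_nonneg_right (hE _) (norm_nonneg _)
    · refine .of_forall fun t => ?_
      refine Tendsto.mul_const _ ((u1.tendsto ξ).comp ?_)
      have : Tendsto (fun n : ℕ => t / (n + 1 : ℝ)) atTop (𝓝 0) :=
        tendsto_const_nhds.div_atTop (tendsto_natCast_atTop_atTop.atTop_add tendsto_const_nhds)
      simpa using tendsto_const_nhds.sub this
  -- A bound independent of `n`: the weight at `ξ` splits into a weight on `u` and one on `ρ`.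
  let M := D * ∫ t, ‖(((1 + |t|) ^ N : ℝ) : ℂ) * ρ t‖
  have Vbd : ∀ n ξ, ‖(((1 + |ξ|) ^ N : ℝ) : ℂ) * V n ξ‖ ≤ M := by
    intro n ξ
    have hn : (1 : ℝ) ≤ n + 1 := by simp
    simp only [V, M, ← integral_const_mul]
    refine norm_integral_le_of_norm_le
      (((integrable_pow_mul_invFourier χ1 χ2 N).norm).const_mul D) (.of_forall fun t => ?_)
    have h1 := hD (ξ - t / (n + 1 : ℝ))
    simp only [norm_mul, Complex.norm_real, Real.norm_eq_abs, abs_pow] at h1 ⊢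
    rw [abs_of_nonneg (by positivity : 0 ≤ 1 + |ξ|), abs_of_nonneg (by positivity : 0 ≤ 1 + |t|)]
    rw [abs_of_nonneg (by positivity)] at h1
    have h2 : 1 + |ξ| ≤ (1 + |ξ - t / (n + 1 : ℝ)|) * (1 + |t|) := by
      refine (one_add_abs_le_mul ξ (t / (n + 1 : ℝ))).trans ?_
      refine mul_le_mul_of_nonneg_left ?_ (by positivity)
      rw [abs_div, abs_of_pos (by positivity : (0 : ℝ) < n + 1)]
      have := div_le_self (abs_nonneg t) hn
      linarith
    calc (1 + |ξ|) ^ N * (‖u (ξ - t / (n + 1 : ℝ))‖ * ‖ρ t‖)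
        ≤ ((1 + |ξ - t / (n + 1 : ℝ)|) * (1 + |t|)) ^ N *
            (‖u (ξ - t / (n + 1 : ℝ))‖ * ‖ρ t‖) := by gcongr
      _ = ((1 + |ξ - t / (n + 1 : ℝ)|) ^ N * ‖u (ξ - t / (n + 1 : ℝ))‖) *
            ((1 + |t|) ^ N * ‖ρ t‖) := by rw [mul_pow]; ring
      _ ≤ _ := by gcongr
  have rew : ∀ (v : ℝ → ℂ) (w : Ω), ψ w * v (X w) = (ψ w * (((1 + |X w|) ^ N : ℝ) : ℂ)⁻¹) *
      ((((1 + |X w|) ^ N : ℝ) : ℂ) * v (X w)) := fun v w => by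
    have := hne (X w)
    field_simp
  have lim : Tendsto (fun n => ∫ w, ψ w * V n (X w) ∂μ) atTop
      (𝓝 (∫ w, ψ w * (∫ t, u (X w) * ρ t) ∂μ)) := by
    refine tendsto_integral_of_dominated_convergence
      (fun w => ‖ψ w * (((1 + |X w|) ^ N : ℝ) : ℂ)⁻¹‖ * M) ?_ (hψ.norm.mul_const _) ?_ ?_
    · intro n
      simp only [rew]
      refine hψ.1.mul (Measurable.aestronglyMeasurable ?_)
      have := (Vc n).measurable
      fun_prop
    · intro n
      refine .of_forall fun w => ?_
      rw [rew, norm_mul]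
      exact mul_le_mul_of_nonneg_left (Vbd n _) (norm_nonneg _)
    · exact .of_forall fun w => (Vlim _).const_mul _
  simp only [step2] at lim
  have h0 := tendsto_nhds_unique lim tendsto_const_nhds
  simp only [integral_const_mul, ← mul_assoc, integral_mul_const] at h0
  exact (mul_eq_zero.1 h0).resolve_right ρint

/-- Bumps equal to `1` on the ball, with outer radius `r + r/(n+1)`. All supports stay in the ball
of radius `2r`, which supplies a common dominating set. -/
theorem tendsto_bump_indicator (c : ℝ) {r : ℝ} (hr : 0 < r) :
    ∃ u : ℕ → ℝ → ℂ, (∀ n, ContDiff ℝ ∞ (u n)) ∧ (∀ n, tsupport (u n) ⊆ Metric.closedBall c (2 * r)) ∧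
      (∀ n x, ‖u n x‖ ≤ 1) ∧
      ∀ x, Tendsto (fun n => u n x) atTop (𝓝 ((Metric.closedBall c r).indicator 1 x)) := by
  let b : ℕ → ContDiffBump c := fun n => ⟨r, r + r / (n + 1 : ℝ), hr, by
    have : 0 < r / (n + 1 : ℝ) := by positivity
    linarith⟩
  refine ⟨fun n x => (b n x : ℂ), fun n => Complex.ofRealCLM.contDiff.comp (b n).contDiff,
    fun n => ?_, fun n x => ?_, fun x => ?_⟩
  · have h1 : tsupport (fun x => (b n x : ℂ)) ⊆ tsupport (b n) :=
      tsupport_comp_subset (g := fun x : ℝ => (x : ℂ)) Complex.ofReal_zero _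
    refine h1.trans ?_
    rw [(b n).tsupport_eq]
    refine Metric.closedBall_subset_closedBall ?_
    have : r / (n + 1 : ℝ) ≤ r := div_le_self hr.le (by simp)
    show r + r / (n + 1 : ℝ) ≤ 2 * r
    linarith
  · rw [Complex.norm_real, Real.norm_eq_abs, abs_of_nonneg (b n).nonneg]
    exact (b n).le_one
  · by_cases hx : x ∈ Metric.closedBall c r
    · rw [indicator_of_mem hx]
      refine tendsto_const_nhds.congr fun n => ?_
      simp only [(b n).one_of_mem_closedBall hx, ofReal_one, Pi.one_apply]
    · rw [indicator_of_notMem hx]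
      refine tendsto_const_nhds.congr' ?_
      have hx' : r < dist x c := by simpa using hx
      have : Tendsto (fun n : ℕ => r + r / (n + 1 : ℝ)) atTop (𝓝 (r + 0)) :=
        tendsto_const_nhds.add
          (tendsto_const_nhds.div_atTop (tendsto_natCast_atTop_atTop.atTop_add tendsto_const_nhds))
      rw [add_zero] at this
      filter_upwards [this.eventually_lt_const hx'] with n hn
      rw [(b n).zero_of_le_dist hn.le]
      simp

/-- Balls for the sup metric on `ℝ × ℝ` are squares, so their indicators are limits of products of
bumps. Hence the integral of `ψ` over small squares vanishes, and Lebesgue differentiation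
concludes. -/
theorem ae_eq_zero_of_integral_tensor {ψ : ℝ × ℝ → ℂ}
    (hψ : LocallyIntegrableOn ψ (univ ×ˢ Ioi 0) volume)
    (H : ∀ u k : ℝ → ℂ, ContDiff ℝ ∞ u → HasCompactSupport u → ContDiff ℝ ∞ k →
      HasCompactSupport k → tsupport k ⊆ Ioi 0 →
      ∫ w, ψ w * (u w.1 * k w.2) ∂((volume : Measure ℝ).prod volPos) = 0) :
    ψ =ᵐ[(volume : Measure ℝ).prod volPos] 0 := by
  have hsub : ∀ w : ℝ × ℝ, ∀ r : ℝ, r < w.2 →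
      Metric.closedBall w r ⊆ (univ : Set ℝ) ×ˢ Ioi (0 : ℝ) := by
    intro w r hr x hx
    refine ⟨mem_univ _, ?_⟩
    have := (abs_le.1 ((le_max_right _ _).trans hx : dist x.2 w.2 ≤ r)).1
    exact mem_Ioi.2 (by linarith)
  have box : ∀ w : ℝ × ℝ, ∀ r : ℝ, 0 < r → 2 * r < w.2 →
      ∫ x in Metric.closedBall w r, ψ x = 0 := by
    intro w r hr hrw
    obtain ⟨u, u1, u2, u3, u4⟩ := tendsto_bump_indicator w.1 hr
    obtain ⟨k, k1, k2, k3, k4⟩ := tendsto_bump_indicator w.2 hr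
    have hint : IntegrableOn ψ (Metric.closedBall w (2 * r)) volume :=
      hψ.integrableOn_compact_subset (hsub w _ hrw) (isCompact_closedBall _ _)
    have hk : ∀ n, tsupport (k n) ⊆ Ioi 0 := fun n x hx => by
      have := (abs_le.1 (Metric.mem_closedBall.1 (k2 n hx))).1
      exact mem_Ioi.2 (by linarith)
    have hz : ∀ n, ∫ x in Metric.closedBall w (2 * r), ψ x * (u n x.1 * k n x.2) = 0 := by
      intro n
      rw [← H (u n) (k n) (u1 n) (HasCompactSupport.of_support_subset_isCompact
        (isCompact_closedBall _ _) ((subset_tsupport _).trans (u2 n))) (k1 n)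
        (HasCompactSupport.of_support_subset_isCompact
        (isCompact_closedBall _ _) ((subset_tsupport _).trans (k2 n))) (hk n), volPos,
        prod_restrict_eq]
      symm
      refine setIntegral_eq_of_subset_of_forall_sdiff_eq_zero
        (MeasurableSet.univ.prod measurableSet_Ioi) (hsub w _ hrw) ?_
      rintro x ⟨-, hx⟩
      by_contra h0
      have h1 : u n x.1 ≠ 0 := fun h => h0 (by simp [h])
      have h2 : k n x.2 ≠ 0 := fun h => h0 (by simp [h])
      exact hx (max_le (Metric.mem_closedBall.1 (u2 n (subset_tsupport _ h1)))
        (Metric.mem_closedBall.1 (k2 n (subset_tsupport _ h2))))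
    have lim : Tendsto (fun n => ∫ x in Metric.closedBall w (2 * r), ψ x * (u n x.1 * k n x.2))
        atTop (𝓝 (∫ x in Metric.closedBall w (2 * r),
          (Metric.closedBall w r).indicator ψ x)) := by
      refine tendsto_integral_of_dominated_convergence (fun x => ‖ψ x‖) ?_ hint.norm ?_ ?_
      · intro n
        have h1 := (u1 n).continuous
        have h2 := (k1 n).continuous
        exact hint.1.mul (Continuous.aestronglyMeasurable (by fun_prop))
      · intro n
        refine .of_forall fun x => ?_
        rw [norm_mul, norm_mul]
        exact mul_le_of_le_one_right (norm_nonneg _)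
          (mul_le_one₀ (u3 n _) (norm_nonneg _) (k3 n _))
      · refine .of_forall fun x => ?_
        have := ((u4 x.1).mul (k4 x.2)).const_mul (ψ x)
        convert this using 2
        have hx : x ∈ Metric.closedBall w r ↔
            x.1 ∈ Metric.closedBall w.1 r ∧ x.2 ∈ Metric.closedBall w.2 r := by
          rw [← Set.mem_prod, closedBall_prod_same]
        by_cases h1 : x.1 ∈ Metric.closedBall w.1 r <;> by_cases h2 : x.2 ∈ Metric.closedBall w.2 r <;>
          simp only [indicator, hx, h1, h2, and_true, and_false, if_true, if_false,
            Pi.one_apply, mul_one, mul_zero]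
    simp only [hz] at lim
    have h0 := tendsto_nhds_unique lim tendsto_const_nhds
    rwa [setIntegral_indicator Metric.isClosed_closedBall.measurableSet,
      inter_eq_self_of_subset_right (Metric.closedBall_subset_closedBall (by linarith))] at h0
  -- The radius falls just short of the height of the centre: the closed balls stay in the open
  -- half-plane, yet the balls exhaust it. On each, `ψ` is extended by zero to a locally integrable
  -- function on the whole plane.
  have key : ∀ m : ℕ, ∀ᵐ w : ℝ × ℝ, w ∈ Metric.ball (0, (m + 1 : ℝ)) (m + 1 - 1 / (m + 2) : ℝ) → ψ w = 0 := by
    intro m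
    set c : ℝ × ℝ := (0, (m + 1 : ℝ))
    have hR : (m + 1 - 1 / (m + 2) : ℝ) < c.2 := by
      have : (0 : ℝ) < 1 / (m + 2) := by positivity
      show (m + 1 - 1 / (m + 2) : ℝ) < m + 1
      linarith
    have hint : IntegrableOn ψ (Metric.closedBall c (m + 1 - 1 / (m + 2) : ℝ)) volume :=
      hψ.integrableOn_compact_subset (hsub _ _ hR) (isCompact_closedBall _ _)
    have hl : LocallyIntegrable ((Metric.closedBall c (m + 1 - 1 / (m + 2) : ℝ)).indicator ψ) volume :=
      (hint.integrable_indicator Metric.isClosed_closedBall.measurableSet).locallyIntegrable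
    filter_upwards [IsUnifLocDoublingMeasure.ae_tendsto_average volume hl 1] with w hw hwm
    have hδ : Tendsto (fun n : ℕ => 1 / ((n : ℝ) + 1)) atTop (𝓝[>] 0) :=
      tendsto_nhdsWithin_iff.2 ⟨tendsto_one_div_add_atTop_nhds_zero_nat,
        .of_forall fun n => mem_Ioi.2 (by positivity)⟩
    have h1 := hw (fun _ => w) (fun n : ℕ => 1 / ((n : ℝ) + 1)) hδ
      (.of_forall fun n => Metric.mem_closedBall_self (by positivity))
    rw [indicator_of_mem (Metric.ball_subset_closedBall hwm)] at h1
    refine tendsto_nhds_unique h1 (tendsto_const_nhds.congr' ?_)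
    have hw2 : 0 < w.2 := (hsub c _ hR (Metric.ball_subset_closedBall hwm)).2
    have hpos : 0 < (m + 1 - 1 / (m + 2) : ℝ) - dist w c := by simpa using hwm
    have hlim := (tendsto_nhdsWithin_iff.1 hδ).1
    filter_upwards [hlim.eventually_lt_const hpos,
      hlim.eventually_lt_const (by positivity : 0 < w.2 / 2)] with n hn1 hn2
    have hsub2 : Metric.closedBall w (1 / ((n : ℝ) + 1)) ⊆ Metric.closedBall c (m + 1 - 1 / (m + 2) : ℝ) :=
      Metric.closedBall_subset_closedBall' (by linarith)
    rw [setAverage_eq, setIntegral_congr_fun (g := ψ) Metric.isClosed_closedBall.measurableSet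
      (fun x hx => indicator_of_mem (hsub2 hx) _), box w _ (by positivity) (by linarith), smul_zero]
  rw [volPos, prod_restrict_eq, EventuallyEq, ae_restrict_iff' (MeasurableSet.univ.prod measurableSet_Ioi)]
  filter_upwards [ae_all_iff.2 key] with w hw hwm
  have hw2 : 0 < w.2 := hwm.2
  obtain ⟨m, hm⟩ := exists_nat_gt (max (|w.1|) (max w.2 (1 / w.2)))
  simp only [max_lt_iff] at hm
  obtain ⟨h1, h2, h3⟩ := hm
  have h4 : (1 : ℝ) / (m + 2) < w.2 := by
    rw [div_lt_iff₀ hw2] at h3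
    rw [div_lt_iff₀ (by positivity)]
    nlinarith
  have h5 : (1 : ℝ) / (m + 2) ≤ 1 / 2 := by gcongr; simp
  refine hw m ?_
  rw [Metric.mem_ball, Prod.dist_eq, max_lt_iff, Real.dist_eq, Real.dist_eq, sub_zero, abs_lt (a := w.2 - _)]
  refine ⟨by linarith, by linarith, by linarith⟩

/-! ### Local integrability on the half-plane and uniqueness of the partial Fourier transform. -/

theorem exists_box_of_isCompact {K : Set (ℝ × ℝ)} (hK : IsCompact K) (h : K ⊆ univ ×ˢ Ioi 0) :
    ∃ M c d : ℝ, 0 < c ∧ c < d ∧ K ⊆ Icc (-M) M ×ˢ Icc c d := by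
  obtain ⟨c, d, hc, hcd, h2⟩ := exists_Icc_of_compact (hK.image continuous_snd)
    (by rintro _ ⟨w, hw, rfl⟩; exact (h hw).2)
  obtain ⟨M, hM⟩ := (hK.image continuous_fst).isBounded.subset_closedBall 0
  refine ⟨M, c, d, hc, hcd, fun w hw => ⟨?_, h2 ⟨w, hw, rfl⟩⟩⟩
  have := hM ⟨w, hw, rfl⟩
  rwa [Real.closedBall_eq_Icc, zero_sub, zero_add] at this

theorem locallyIntegrableOn_of_box {ψ : ℝ × ℝ → ℂ}
    (H : ∀ M c d : ℝ, 0 < c → c < d → IntegrableOn ψ (Icc (-M) M ×ˢ Icc c d) volume) :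
    LocallyIntegrableOn ψ (univ ×ˢ Ioi 0) volume := by
  rw [locallyIntegrableOn_iff (isOpen_univ.prod isOpen_Ioi).isLocallyClosed]
  intro K hK hKc
  obtain ⟨M, c, d, hc, hcd, hsub⟩ := exists_box_of_isCompact hKc hK
  exact (H M c d hc hcd).mono_set hsub

theorem integrable_mul_of_locallyIntegrableOn {ψ : ℝ × ℝ → ℂ}
    (hψ : LocallyIntegrableOn ψ (univ ×ˢ Ioi 0) volume) {c : ℝ × ℝ → ℂ} {u k : ℝ → ℂ}
    (hc : ContinuousOn c (univ ×ˢ Ioi 0))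
    (u1 : Continuous u) (u2 : HasCompactSupport u)
    (k1 : Continuous k) (k2 : HasCompactSupport k) (k3 : tsupport k ⊆ Ioi 0) :
    Integrable (fun w : ℝ × ℝ => ψ w * (c w * (u w.1 * k w.2))) volume ∧
    Integrable (fun w : ℝ × ℝ => ψ w * (c w * (u w.1 * k w.2)))
      ((volume : Measure ℝ).prod volPos) := by
  have hK : IsCompact (tsupport u ×ˢ tsupport k) := u2.isCompact.prod k2.isCompact
  have hs : tsupport u ×ˢ tsupport k ⊆ (univ : Set ℝ) ×ˢ Ioi 0 := prod_mono (subset_univ _) k3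
  have h3 := hψ.integrableOn_compact_subset hs hK
  have hc : ContinuousOn (fun w : ℝ × ℝ => c w * (u w.1 * k w.2)) (tsupport u ×ˢ tsupport k) :=
    (hc.mono hs).mul (by fun_prop)
  have h4 := h3.mul_continuousOn hc hK
  have h5 : Integrable (fun w : ℝ × ℝ => ψ w * (c w * (u w.1 * k w.2))) volume := by
    refine (integrableOn_iff_integrable_of_support_subset ?_).1 h4
    intro w hw
    have hw1 : u w.1 ≠ 0 := fun h0 => hw (by simp [h0])
    have hw2 : k w.2 ≠ 0 := fun h0 => hw (by simp [h0])
    exact ⟨subset_tsupport _ hw1, subset_tsupport _ hw2⟩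
  refine ⟨h5, ?_⟩
  rw [volPos, prod_restrict_eq]
  exact h5.restrict

theorem integral_prod_volPos_eq {E : ℝ × ℝ → ℂ} (hE : ∀ w : ℝ × ℝ, w.2 ≤ 0 → E w = 0) :
    ∫ w, E w ∂((volume : Measure ℝ).prod volPos) = ∫ w, E w := by
  rw [volPos, prod_restrict_eq]
  refine setIntegral_eq_integral_of_forall_compl_eq_zero fun w hw => hE w ?_
  by_contra h
  exact hw ⟨mem_univ _, not_le.1 h⟩

theorem IsPartialFourier.locallyIntegrable_right {f : UpperHalfPlane → ℂ} {φ : ℝ → ℝ → ℂ}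
    (H : IsPartialFourier f φ) :
    LocallyIntegrableOn (Function.uncurry φ) (univ ×ˢ Ioi 0) volume := by
  refine locallyIntegrableOn_of_box fun M c d hc hcd => ?_
  obtain ⟨N, hN⟩ := H.tempered c d hc hcd
  rw [prod_restrict_eq] at hN
  have h1 : IntegrableOn _ (Icc (-M) M ×ˢ Icc c d) volume :=
    IntegrableOn.mono_set hN (prod_mono (subset_univ _) subset_rfl)
  have hc : ContinuousOn (fun w : ℝ × ℝ => (((1 + |w.1|) ^ N : ℝ) : ℂ))
    (Icc (-M) M ×ˢ Icc c d) := by fun_prop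
  refine (h1.mul_continuousOn hc (isCompact_Icc.prod isCompact_Icc)).congr (.of_forall fun w => ?_)
  have : (((1 + |w.1|) ^ N : ℝ) : ℂ) ≠ 0 := by
    rw [Complex.ofReal_ne_zero]; positivity
  simp only [Function.uncurry]
  field_simp

/-- The growth exponent may depend on the strip; cutting off by `k` confines matters to one strip,
hence to one exponent. -/
theorem IsPartialFourier.exists_integrable_weight {f : UpperHalfPlane → ℂ} {φ : ℝ → ℝ → ℂ}
    (H : IsPartialFourier f φ) {k : ℝ → ℂ}
    (k1 : Continuous k) (k2 : HasCompactSupport k) (k3 : tsupport k ⊆ Ioi 0) :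
    ∃ N : ℕ, Integrable (fun w : ℝ × ℝ => φ w.1 w.2 * k w.2 * (((1 + |w.1|) ^ N : ℝ) : ℂ)⁻¹)
      ((volume : Measure ℝ).prod volPos) := by
  obtain ⟨c, d, hc, hcd, hK⟩ := exists_Icc_of_compact k2.isCompact k3
  obtain ⟨N, hN⟩ := H.tempered c d hc hcd
  obtain ⟨D, hD⟩ := k2.exists_bound_of_continuous k1
  refine ⟨N, ?_⟩
  have h3 : Integrable (fun w : ℝ × ℝ => φ w.1 w.2 * k w.2 * (((1 + |w.1|) ^ N : ℝ) : ℂ)⁻¹)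
      ((volume : Measure ℝ).prod (volume.restrict (Icc c d))) := by
    refine (hN.mul_bdd (c := D) (g := fun w : ℝ × ℝ => k w.2)
      (Continuous.aestronglyMeasurable (by fun_prop)) (.of_forall fun w => hD _)).congr
      (.of_forall fun w => ?_)
    simp only
    ring
  rw [volPos]
  rw [prod_restrict_eq] at h3 ⊢
  refine (IntegrableOn.of_forall_sdiff_eq_zero (s := univ ×ˢ Icc c d) (t := univ ×ˢ Ioi (0 : ℝ)) h3
    (MeasurableSet.univ.prod measurableSet_Ioi) ?_)
  rintro w ⟨-, hw⟩
  have : k w.2 = 0 := by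
    by_contra h0
    exact hw ⟨mem_univ _, hK (subset_tsupport _ h0)⟩
  simp [this]

/-- For fixed `k`, the function `φ k` has polynomial growth in `ξ` and annihilates transforms of
test functions, hence test functions themselves; products then separate. -/
theorem IsPartialFourier.ae_eq_zero {φ : ℝ → ℝ → ℂ} (H : IsPartialFourier 0 φ) :
    Function.uncurry φ =ᵐ[(volume : Measure ℝ).prod volPos] 0 := by
  refine ae_eq_zero_of_integral_tensor H.locallyIntegrable_right fun u k u1 u2 k1 k2 k3 => ?_
  obtain ⟨N, hN⟩ := H.exists_integrable_weight k1.continuous k2 k3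
  have := integral_mul_comp_eq_zero_of_invFourier (measurable_fst (α := ℝ) (β := ℝ)) hN
    (fun h h1 h2 => ?_) u1.continuous u2
  · rw [← this]
    refine integral_congr_ae (.of_forall fun w => ?_)
    simp only [Function.uncurry]
    ring
  · have h3 := H.pairing h k h1 h2 k1 k2 k3
    simp only [Pi.zero_apply, zero_mul, integral_zero] at h3
    rw [h3]
    refine integral_congr_ae (.of_forall fun w => ?_)
    simp only
    ring

/-- The distributional Fourier transform in the first variable is determined almost everywhere. -/
theorem IsPartialFourier.ae_unique {f : UpperHalfPlane → ℂ} {φ χ : ℝ → ℝ → ℂ}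
    (H : IsPartialFourier f φ) (G : IsPartialFourier f χ) :
    Function.uncurry φ =ᵐ[(volume : Measure ℝ).prod volPos] Function.uncurry χ := by
  have h1 : IsPartialFourier 0 (φ + (-1 : ℂ) • χ) := by
    have := H.add (G.smul (-1))
    rwa [show f + (-1 : ℂ) • f = 0 by simp] at this
  filter_upwards [h1.ae_eq_zero] with w hw
  simp only [Function.uncurry, Pi.add_apply, Pi.smul_apply, Pi.zero_apply, smul_eq_mul] at hw ⊢
  linear_combination hw

theorem partialFourier_ae_eq {f : UpperHalfPlane → ℂ} {φ : ℝ → ℝ → ℂ} (H : IsPartialFourier f φ) :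
    Function.uncurry (partialFourier f) =ᵐ[(volume : Measure ℝ).prod volPos]
      Function.uncurry φ := by
  have h : ∃ φ, IsPartialFourier f φ := ⟨φ, H⟩
  rw [partialFourier, dif_pos h]
  exact h.choose_spec.ae_unique H

/-! ### The Cauchy–Riemann equation on the Fourier side. -/

theorem integral_eq_zero_of_hasDerivAt_snd {E A : ℝ × ℝ → ℂ} (hE : Integrable E) (hA : Integrable A)
    (h : ∀ x y, HasDerivAt (fun y => E (x, y)) (A (x, y)) y) : ∫ w, A w = 0 := by
  rw [Measure.volume_eq_prod] at hE hA ⊢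
  rw [integral_prod _ hA]
  refine integral_eq_zero_of_ae ?_
  filter_upwards [hE.prod_right_ae, hA.prod_right_ae] with x h1 h2
  exact integral_eq_zero_of_hasDerivAt_of_integrable (h x) h2 h1

theorem integral_eq_zero_of_hasDerivAt_fst {E A : ℝ × ℝ → ℂ} (hE : Integrable E) (hA : Integrable A)
    (h : ∀ x y, HasDerivAt (fun x => E (x, y)) (A (x, y)) x) : ∫ w, A w = 0 := by
  rw [Measure.volume_eq_prod] at hE hA ⊢
  rw [integral_prod_symm _ hA]
  refine integral_eq_zero_of_ae ?_
  filter_upwards [hE.prod_left_ae, hA.prod_left_ae] with y h1 h2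
  exact integral_eq_zero_of_hasDerivAt_of_integrable (fun x => h x y) h2 h1

theorem invFourier_deriv {h : ℝ → ℂ} (h1 : ContDiff ℝ ∞ h) (h2 : HasCompactSupport h) (x : ℝ) :
    invFourier (deriv h) x = -(I * x) * invFourier h x := by
  have hd : Continuous (deriv h) := h1.continuous_deriv (by simp)
  have h1c := h1.continuous
  have i1 : Integrable fun u : ℝ => Complex.exp (I * u * x) * h u :=
    Continuous.integrable_of_hasCompactSupport (by fun_prop) h2.mul_left
  have i2 : Integrable fun u : ℝ => Complex.exp (I * u * x) * deriv h u :=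
    Continuous.integrable_of_hasCompactSupport (by fun_prop) h2.deriv.mul_left
  have key := integral_eq_zero_of_hasDerivAt_of_integrable
    (f := fun u : ℝ => Complex.exp (I * u * x) * h u)
    (f' := fun u : ℝ => I * x * (Complex.exp (I * u * x) * h u) + Complex.exp (I * u * x) * deriv h u)
    (fun u => by
      have e1 : HasDerivAt (fun u : ℝ => I * (u : ℂ) * x) (I * x) u := by
        have := ((Complex.ofRealCLM.hasDerivAt (x := u)).const_mul I).mul_const (x : ℂ)
        simpa using this
      have e2 := e1.cexp.mul (h1.differentiable (by simp) u).hasDerivAt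
      refine e2.congr_deriv ?_
      ring)
    ((i1.const_mul _).add i2) i1
  rw [integral_add (i1.const_mul _) i2, integral_const_mul] at key
  simp only [invFourier]
  linear_combination (((1 / Real.sqrt (2 * Real.pi) : ℝ) : ℂ)) * key

theorem eq_zero_of_tsupport {k : ℝ → ℂ} (k3 : tsupport k ⊆ Ioi 0) {y : ℝ} (hy : y ≤ 0) : k y = 0 := by
  by_contra h
  exact absurd (k3 (subset_tsupport _ h)) (not_lt.2 hy)

theorem tsupport_deriv_subset' {k : ℝ → ℂ} (k3 : tsupport k ⊆ Ioi 0) :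
    tsupport (deriv k) ⊆ Ioi 0 :=
  (closure_minimal support_deriv_subset isClosed_closure).trans k3

/-- The weak form of the Cauchy-Riemann equation. -/
theorem integral_cauchyRiemann {f : UpperHalfPlane → ℂ}
    (hf : DifferentiableOn ℂ (fun z : ℂ => f (UpperHalfPlane.ofComplex z)) {z : ℂ | 0 < z.im})
    {h k : ℝ → ℂ} (h1 : ContDiff ℝ ∞ h) (h2 : HasCompactSupport h)
    (k1 : ContDiff ℝ ∞ k) (k2 : HasCompactSupport k) (k3 : tsupport k ⊆ Ioi 0) :
    ∫ w, f (pt w.1 w.2) * (h w.1 * deriv k w.2) ∂((volume : Measure ℝ).prod volPos) =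
      I * ∫ w, f (pt w.1 w.2) * (deriv h w.1 * k w.2) ∂((volume : Measure ℝ).prod volPos) := by
  have hopen : IsOpen {z : ℂ | 0 < z.im} := isOpen_lt continuous_const Complex.continuous_im
  set g : ℂ → ℂ := fun z : ℂ => f (UpperHalfPlane.ofComplex z) with hg
  let e : ℝ × ℝ → ℂ := fun w => (w.1 : ℂ) + (w.2 : ℂ) * I
  have he : Continuous e := by fun_prop
  have hmap : MapsTo e (univ ×ˢ Ioi 0) {z : ℂ | 0 < z.im} := fun w hw => by
    simpa [e] using hw
  have gc : ContinuousOn (fun w => g (e w)) (univ ×ˢ Ioi 0) :=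
    hf.continuousOn.comp he.continuousOn hmap
  have gc' : ContinuousOn (fun w => deriv g (e w)) (univ ×ˢ Ioi 0) :=
    (hf.deriv hopen).continuousOn.comp he.continuousOn hmap
  have gd : ∀ w : ℝ × ℝ, 0 < w.2 → HasDerivAt g (deriv g (e w)) (e w) := fun w hw =>
    (hf.differentiableAt (hopen.mem_nhds (hmap ⟨mem_univ _, hw⟩))).hasDerivAt
  have hone : LocallyIntegrableOn (fun _ : ℝ × ℝ => (1 : ℂ)) (univ ×ˢ Ioi 0) volume :=
    (locallyIntegrable_const (1 : ℂ)).locallyIntegrableOn _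
  have hd : Continuous (deriv h) := h1.continuous_deriv (by simp)
  have kd : Continuous (deriv k) := k1.continuous_deriv (by simp)
  have k3' := tsupport_deriv_subset' k3
  have i0 := integrable_mul_of_locallyIntegrableOn hone gc h1.continuous h2 k1.continuous k2 k3
  have i1 := integrable_mul_of_locallyIntegrableOn hone gc h1.continuous h2 kd k2.deriv k3'
  have i2 := integrable_mul_of_locallyIntegrableOn hone gc hd h2.deriv k1.continuous k2 k3
  have i3 := integrable_mul_of_locallyIntegrableOn hone gc' h1.continuous h2 k1.continuous k2 k3
  simp only [one_mul] at i0 i1 i2 i3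
  have hh : ∀ x, HasDerivAt h (deriv h x) x := fun x => (h1.differentiable (by simp) x).hasDerivAt
  have hk : ∀ x, HasDerivAt k (deriv k x) x := fun x => (k1.differentiable (by simp) x).hasDerivAt
  -- Differentiation along `y` produces `i g'`, along `x` it produces `g'`; the combination `z1 - I
  -- * z2` eliminates `g'`. As `g` is holomorphic only in the half-plane, points off the support of
  -- `k` are treated apart: there the product vanishes locally.
  have z1 := integral_eq_zero_of_hasDerivAt_snd i0.1 ((i3.1.const_mul I).add i1.1) (fun x y => by
    by_cases hy : y ∈ tsupport k
    · have e1 : HasDerivAt (fun y : ℝ => e (x, y)) I y := by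
        have := ((Complex.ofRealCLM.hasDerivAt (x := y)).mul_const I).const_add (x : ℂ)
        simpa [e] using this
      have e2 := ((gd (x, y) (k3 hy)).scomp y e1).mul ((hk y).const_mul (h x))
      simp only [smul_eq_mul, Function.comp_def] at e2
      refine e2.congr_deriv ?_
      show _ = I * (deriv g (e (x, y)) * (h x * k y)) + g (e (x, y)) * (h x * deriv k y)
      ring
    · have e1 : (fun y => g (e (x, y)) * (h x * k y)) =ᶠ[𝓝 y] fun _ => 0 := by
        filter_upwards [(isClosed_tsupport k).isOpen_compl.mem_nhds hy] with t ht
        rw [image_eq_zero_of_notMem_tsupport ht, mul_zero, mul_zero]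
      refine ((hasDerivAt_const y (0 : ℂ)).congr_of_eventuallyEq e1).congr_deriv ?_
      have : deriv k y = 0 := image_eq_zero_of_notMem_tsupport
        fun h => hy (closure_minimal support_deriv_subset isClosed_closure h)
      simp [this, image_eq_zero_of_notMem_tsupport hy])
  have z2 := integral_eq_zero_of_hasDerivAt_fst i0.1 (i3.1.add i2.1) (fun x y => by
    by_cases hy : y ∈ tsupport k
    · have e1 : HasDerivAt (fun x : ℝ => e (x, y)) 1 x := by
        have := ((Complex.ofRealCLM.hasDerivAt (x := x)).add_const ((y : ℂ) * I))
        simpa [e] using this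
      have e2 := ((gd (x, y) (k3 hy)).scomp x e1).mul ((hh x).mul_const (k y))
      simp only [smul_eq_mul, Function.comp_def, one_mul] at e2
      exact e2
    · have hky : k y = 0 := image_eq_zero_of_notMem_tsupport hy
      simp only [hky, mul_zero, Pi.add_apply, add_zero]
      exact hasDerivAt_const x (0 : ℂ))
  simp only [Pi.add_apply] at z1 z2
  rw [integral_add (i3.1.const_mul I) i1.1, integral_const_mul] at z1
  rw [integral_add i3.1 i2.1] at z2
  rw [integral_prod_volPos_eq fun w hw => by rw [eq_zero_of_tsupport k3' hw, mul_zero, mul_zero],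
    integral_prod_volPos_eq fun w hw => by rw [eq_zero_of_tsupport k3 hw, mul_zero, mul_zero]]
  change ∫ w : ℝ × ℝ, g (e w) * (h w.1 * deriv k w.2) = I * ∫ w : ℝ × ℝ, g (e w) * (deriv h w.1 * k w.2)
  linear_combination z1 - I * z2

/-- The weak form of `∂_y φ = -ξ φ`. The transform turns `h'` into `-iξ` times the transform of `h`;
the separation lemma then frees the test function in `ξ`. -/
theorem IsPartialFourier.integral_transport {f : UpperHalfPlane → ℂ} {φ : ℝ → ℝ → ℂ}
    (H : IsPartialFourier f φ)
    (hf : DifferentiableOn ℂ (fun z : ℂ => f (UpperHalfPlane.ofComplex z)) {z : ℂ | 0 < z.im})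
    {u k : ℝ → ℂ} (u1 : Continuous u) (u2 : HasCompactSupport u)
    (k1 : ContDiff ℝ ∞ k) (k2 : HasCompactSupport k) (k3 : tsupport k ⊆ Ioi 0) :
    ∫ w, φ w.1 w.2 * (deriv k w.2 - w.1 * k w.2) * u w.1 ∂((volume : Measure ℝ).prod volPos) = 0 := by
  have kd : ContDiff ℝ ∞ (deriv k) := (contDiff_infty_iff_deriv.1 k1).2
  have k3' := tsupport_deriv_subset' k3
  obtain ⟨N, hN⟩ := H.exists_integrable_weight k1.continuous k2 k3
  obtain ⟨M, hM⟩ := H.exists_integrable_weight kd.continuous k2.deriv k3'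
  have hne : ∀ (x : ℝ) (n : ℕ), (((1 + |x|) ^ n : ℝ) : ℂ) ≠ 0 := fun x n => by
    rw [Complex.ofReal_ne_zero]; positivity
  -- The exponents `N` and `M` serve `k` and its derivative; the additional power absorbs the factor
  -- `ξ`.
  have hint : Integrable (fun w : ℝ × ℝ => φ w.1 w.2 * (deriv k w.2 - w.1 * k w.2) *
      (((1 + |w.1|) ^ (N + M + 1) : ℝ) : ℂ)⁻¹) ((volume : Measure ℝ).prod volPos) := by
    have hcont : ∀ n : ℕ, Continuous fun w : ℝ × ℝ => (((1 + |w.1|) ^ n : ℝ) : ℂ)⁻¹ := fun n =>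
      Continuous.inv₀ (by fun_prop) fun w => hne w.1 n
    have hle : ∀ (x : ℝ) (n : ℕ), ‖(((1 + |x|) ^ n : ℝ) : ℂ)⁻¹‖ ≤ 1 := fun x n => by
      rw [norm_inv, Complex.norm_real, Real.norm_eq_abs, abs_of_nonneg (by positivity)]
      exact inv_le_one_of_one_le₀ (one_le_pow₀ (by linarith [abs_nonneg x]))
    have a1 := hM.mul_bdd (c := 1) (g := fun w : ℝ × ℝ => (((1 + |w.1|) ^ (N + 1) : ℝ) : ℂ)⁻¹)
      (hcont _).aestronglyMeasurable (.of_forall fun w => hle _ _)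
    have a2 := hN.mul_bdd (c := 1)
      (g := fun w : ℝ × ℝ => (w.1 : ℂ) * (((1 + |w.1|) ^ (M + 1) : ℝ) : ℂ)⁻¹)
      ((by fun_prop : Continuous fun w : ℝ × ℝ => (w.1 : ℂ)).mul (hcont _)).aestronglyMeasurable
      (.of_forall fun w => by
        rw [norm_mul, norm_inv, Complex.norm_real, Complex.norm_real, Real.norm_eq_abs,
          Real.norm_eq_abs, abs_of_nonneg (by positivity : (0 : ℝ) ≤ (1 + |w.1|) ^ (M + 1)),
          ← div_eq_mul_inv, div_le_one (by positivity)]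
        calc |w.1| ≤ 1 + |w.1| := by linarith
          _ ≤ _ := le_self_pow₀ (by linarith [abs_nonneg w.1]) (by simp))
    refine (a1.sub a2).congr (.of_forall fun w => ?_)
    simp only [Pi.sub_apply]
    have := hne w.1 1
    have := hne w.1 N
    have := hne w.1 M
    simp only [pow_add, Complex.ofReal_mul] at *
    field_simp
  refine integral_mul_comp_eq_zero_of_invFourier (measurable_fst (α := ℝ) (β := ℝ)) hint
    (fun h h1 h2 => ?_) u1 u2
  have hd : ContDiff ℝ ∞ (deriv h) := (contDiff_infty_iff_deriv.1 h1).2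
  have e1 := integral_cauchyRiemann hf h1 h2 k1 k2 k3
  rw [H.pairing h _ h1 h2 kd k2.deriv k3', H.pairing _ k hd h2.deriv k1 k2 k3,
    ← integral_const_mul] at e1
  have i1 := H.integrable_right h1 h2 kd.continuous k2.deriv k3'
  have i2 := H.integrable_right hd h2.deriv k1.continuous k2 k3
  rw [← sub_eq_zero, ← integral_sub i1 (i2.const_mul I)] at e1
  rw [← e1]
  refine integral_congr_ae (.of_forall fun w => ?_)
  simp only [invFourier_deriv h1 h2]
  linear_combination -φ w.1 w.2 * w.1 * k w.2 * invFourier h w.1 * I_mul_I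

theorem hasDerivAt_mul_pow_div_factorial {k : ℝ → ℂ} (k1 : ContDiff ℝ ∞ k) (n : ℕ) (y : ℝ) :
    HasDerivAt (fun y : ℝ => k y * ((y ^ (n + 1) / (n + 1).factorial : ℝ) : ℂ))
      (deriv k y * ((y ^ (n + 1) / (n + 1).factorial : ℝ) : ℂ) +
        k y * ((y ^ n / n.factorial : ℝ) : ℂ)) y := by
  have e1 : HasDerivAt (fun y : ℝ => y ^ (n + 1) / (n + 1).factorial) (y ^ n / n.factorial) y := by
    refine ((hasDerivAt_pow (n + 1) y).div_const _).congr_deriv ?_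
    rw [Nat.factorial_succ]
    have : (n.factorial : ℝ) ≠ 0 := by positivity
    push_cast
    field_simp
  exact (k1.differentiable (by simp) y).hasDerivAt.mul e1.ofReal_comp

/-- Formally, the transport equation says that `e^{ξ y} φ` has zero derivative in `y`. The factor
`e^{ξ y}` is not a product of functions of `ξ` and of `y`, but each term `ξ^n y^n / n!` of its
series is, so the equation is applied term by term and summed. -/
theorem IsPartialFourier.integral_exp_mul_deriv {f : UpperHalfPlane → ℂ} {φ : ℝ → ℝ → ℂ}
    (H : IsPartialFourier f φ)
    (hf : DifferentiableOn ℂ (fun z : ℂ => f (UpperHalfPlane.ofComplex z)) {z : ℂ | 0 < z.im})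
    {u k : ℝ → ℂ} (u1 : Continuous u) (u2 : HasCompactSupport u)
    (k1 : ContDiff ℝ ∞ k) (k2 : HasCompactSupport k) (k3 : tsupport k ⊆ Ioi 0) :
    ∫ w, φ w.1 w.2 * ((Real.exp (w.1 * w.2) : ℂ) * (u w.1 * deriv k w.2))
      ∂((volume : Measure ℝ).prod volPos) = 0 := by
  have kd : ContDiff ℝ ∞ (deriv k) := (contDiff_infty_iff_deriv.1 k1).2
  have k3' := tsupport_deriv_subset' k3
  have hl := H.locallyIntegrable_right
  let S : ℕ → ℝ → ℝ := fun n t => ∑ i ∈ Finset.range (n + 1), t ^ i / i.factorial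
  have Sc : ∀ n, Continuous (S n) := fun n => by
    simp only [S]
    exact continuous_finsetSum _ fun i _ => (continuous_id.pow i).div_const _
  have iA : ∀ n, Integrable (fun w : ℝ × ℝ =>
      φ w.1 w.2 * ((S n (w.1 * w.2) : ℂ) * (u w.1 * deriv k w.2)))
      ((volume : Measure ℝ).prod volPos) := fun n =>
    (integrable_mul_of_locallyIntegrableOn hl (c := fun w => (S n (w.1 * w.2) : ℂ))
      (by have := Sc n; fun_prop) u1 u2 kd.continuous k2.deriv k3').2
  have iB : ∀ n : ℕ, Integrable (fun w : ℝ × ℝ =>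
      φ w.1 w.2 * ((w.1 : ℂ) * (((w.1 * w.2) ^ n / n.factorial : ℝ) : ℂ) * (u w.1 * k w.2)))
      ((volume : Measure ℝ).prod volPos) := fun n =>
    (integrable_mul_of_locallyIntegrableOn hl
      (c := fun w => (w.1 : ℂ) * (((w.1 * w.2) ^ n / n.factorial : ℝ) : ℂ))
      (by fun_prop) u1 u2 k1.continuous k2 k3).2
  have iAB : ∀ n : ℕ, Integrable (fun w : ℝ × ℝ =>
      φ w.1 w.2 * ((S n (w.1 * w.2) : ℂ) * (u w.1 * deriv k w.2)) -
      φ w.1 w.2 * ((w.1 : ℂ) * (((w.1 * w.2) ^ n / n.factorial : ℝ) : ℂ) * (u w.1 * k w.2)))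
      ((volume : Measure ℝ).prod volPos) := fun n => (iA n).sub (iB n)
  -- The sum telescopes: differentiating `y^{n+1}/(n+1)!` yields the term that cancels the remainder
  -- left at stage `n`, so only the last remainder `ξ (ξ y)^n / n!` survives.
  have step : ∀ n, ∫ w, (φ w.1 w.2 * ((S n (w.1 * w.2) : ℂ) * (u w.1 * deriv k w.2)) -
      φ w.1 w.2 * ((w.1 : ℂ) * (((w.1 * w.2) ^ n / n.factorial : ℝ) : ℂ) * (u w.1 * k w.2)))
      ∂((volume : Measure ℝ).prod volPos) = 0 := by
    intro n
    induction n with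
    | zero =>
      rw [← H.integral_transport hf u1 u2 k1 k2 k3]
      refine integral_congr_ae (.of_forall fun w => ?_)
      simp [S]
      ring
    | succ n ih =>
      have kn1 : ContDiff ℝ ∞ fun y : ℝ => k y * ((y ^ (n + 1) / (n + 1).factorial : ℝ) : ℂ) :=
        k1.mul (Complex.ofRealCLM.contDiff.comp (by fun_prop :
          ContDiff ℝ ∞ fun y : ℝ => y ^ (n + 1) / ((n + 1).factorial : ℝ)))
      have key := H.integral_transport hf (u := fun x : ℝ => u x * (x : ℂ) ^ (n + 1))
        (by fun_prop) u2.mul_right kn1 k2.mul_right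
        ((closure_mono (Function.support_mul_subset_left _ _)).trans k3)
      have hder : ∀ y, deriv (fun y : ℝ => k y * ((y ^ (n + 1) / (n + 1).factorial : ℝ) : ℂ)) y =
        _ := fun y => (hasDerivAt_mul_pow_div_factorial k1 n y).deriv
      simp only [hder] at key
      have e : ∀ w : ℝ × ℝ, φ w.1 w.2 * (deriv k w.2 * ((w.2 ^ (n + 1) / (n + 1).factorial : ℝ) : ℂ) +
          k w.2 * ((w.2 ^ n / n.factorial : ℝ) : ℂ) -
          w.1 * (k w.2 * ((w.2 ^ (n + 1) / (n + 1).factorial : ℝ) : ℂ))) *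
          (u w.1 * (w.1 : ℂ) ^ (n + 1)) =
          (φ w.1 w.2 * ((S (n + 1) (w.1 * w.2) : ℂ) * (u w.1 * deriv k w.2)) -
          φ w.1 w.2 * ((w.1 : ℂ) * (((w.1 * w.2) ^ (n + 1) / (n + 1).factorial : ℝ) : ℂ) *
            (u w.1 * k w.2))) -
          (φ w.1 w.2 * ((S n (w.1 * w.2) : ℂ) * (u w.1 * deriv k w.2)) -
          φ w.1 w.2 * ((w.1 : ℂ) * (((w.1 * w.2) ^ n / n.factorial : ℝ) : ℂ) *
            (u w.1 * k w.2))) := by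
        intro w
        have hS : S (n + 1) (w.1 * w.2) =
          S n (w.1 * w.2) + (w.1 * w.2) ^ (n + 1) / (n + 1).factorial :=
          Finset.sum_range_succ _ _
        rw [hS]
        push_cast
        rw [mul_pow, mul_pow]
        ring
      simp only [e] at key
      rw [integral_sub (iAB (n + 1)) (iAB n), ih, sub_zero] at key
      exact key
  -- Partial sums and single terms of the series are both at most `e^{|ξ y|}`, which is bounded on
  -- the compact supports.
  have hexp : Integrable (fun w : ℝ × ℝ =>
      ‖φ w.1 w.2 * ((Real.exp |w.1 * w.2| : ℂ) * (u w.1 * deriv k w.2))‖ +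
      ‖φ w.1 w.2 * ((w.1 : ℂ) * (Real.exp |w.1 * w.2| : ℂ) * (u w.1 * k w.2))‖)
      ((volume : Measure ℝ).prod volPos) :=
    (integrable_mul_of_locallyIntegrableOn hl (c := fun w => (Real.exp |w.1 * w.2| : ℂ))
      (by fun_prop) u1 u2 kd.continuous k2.deriv k3').2.norm.add
    (integrable_mul_of_locallyIntegrableOn hl (c := fun w => (w.1 : ℂ) * (Real.exp |w.1 * w.2| : ℂ))
      (by fun_prop) u1 u2 k1.continuous k2 k3).2.norm
  have lim := tendsto_integral_of_dominated_convergence (F := fun (n : ℕ) (w : ℝ × ℝ) =>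
      (φ w.1 w.2 * ((S n (w.1 * w.2) : ℂ) * (u w.1 * deriv k w.2)) -
      φ w.1 w.2 * ((w.1 : ℂ) * (((w.1 * w.2) ^ n / n.factorial : ℝ) : ℂ) * (u w.1 * k w.2))))
    (f := fun w => φ w.1 w.2 * ((Real.exp (w.1 * w.2) : ℂ) * (u w.1 * deriv k w.2)) -
      φ w.1 w.2 * ((w.1 : ℂ) * ((0 : ℝ) : ℂ) * (u w.1 * k w.2)))
    _ (fun n => (iAB n).1) hexp
    (fun n => .of_forall fun w => by
      refine (norm_sub_le _ _).trans (add_le_add ?_ ?_)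
      · rw [norm_mul, norm_mul, norm_mul (φ _ _), norm_mul ((Real.exp |w.1 * w.2| : ℂ))]
        gcongr
        rw [Complex.norm_real, Complex.norm_real, Real.norm_of_nonneg (Real.exp_pos _).le]
        refine le_trans ?_ (Real.sum_le_exp_of_nonneg (abs_nonneg _) (n + 1))
        refine (norm_sum_le _ _).trans (Finset.sum_le_sum fun i _ => ?_)
        rw [Real.norm_eq_abs, abs_div, abs_pow, Nat.abs_cast]
      · rw [norm_mul, norm_mul, norm_mul (w.1 : ℂ), norm_mul (φ _ _), norm_mul ((w.1 : ℂ) * _),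
          norm_mul (w.1 : ℂ)]
        gcongr
        rw [Complex.norm_real, Complex.norm_real, Real.norm_of_nonneg (Real.exp_pos _).le,
          Real.norm_eq_abs, abs_div, abs_pow, Nat.abs_cast]
        exact Real.pow_div_factorial_le_exp _ (abs_nonneg _) n)
    (.of_forall fun w => by
      have h1 : Tendsto (fun n => S n (w.1 * w.2)) atTop (𝓝 (Real.exp (w.1 * w.2))) := by
        have := (NormedSpace.expSeries_div_hasSum_exp (𝔸 := ℝ) (w.1 * w.2)).tendsto_sum_nat
        rw [← Real.exp_eq_exp_ℝ] at this
        exact this.comp (tendsto_add_atTop_nat 1)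
      have h2 := FloorSemiring.tendsto_pow_div_factorial_atTop (w.1 * w.2)
      have h1' := (Complex.continuous_ofReal.tendsto _).comp h1
      have h2' := (Complex.continuous_ofReal.tendsto _).comp h2
      exact ((h1'.mul_const _).const_mul _).sub (((h2'.const_mul _).mul_const _).const_mul _))
  simp only [step] at lim
  have h0 := tendsto_nhds_unique lim tendsto_const_nhds
  simpa using h0

/-- The primitive from `0` vanishes to the left of the support because it has not begun, and to the
right because the total integral is zero. -/
theorem exists_deriv_eq_of_integral_eq_zero {κ : ℝ → ℂ} (k1 : ContDiff ℝ ∞ κ)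
    (k2 : HasCompactSupport κ) (k3 : tsupport κ ⊆ Ioi 0) (h0 : ∫ y, κ y = 0) :
    ∃ K : ℝ → ℂ, ContDiff ℝ ∞ K ∧ HasCompactSupport K ∧ tsupport K ⊆ Ioi 0 ∧ deriv K = κ := by
  obtain ⟨c, d, hc, hcd, hK⟩ := exists_Icc_of_compact k2.isCompact k3
  have hz : ∀ y, y ∉ Icc c d → κ y = 0 := fun y hy =>
    image_eq_zero_of_notMem_tsupport fun h => hy (hK h)
  let K : ℝ → ℂ := fun y => ∫ t in (0 : ℝ)..y, κ t
  have hd : ∀ y, HasDerivAt K (κ y) y := fun y =>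
    intervalIntegral.integral_hasDerivAt_right (k1.continuous.intervalIntegrable _ _)
      (k1.continuous.stronglyMeasurableAtFilter _ _) k1.continuous.continuousAt
  have hder : deriv K = κ := funext fun y => (hd y).deriv
  have hsup : ∀ y, y ∉ Icc c d → K y = 0 := by
    intro y hy
    rcases lt_or_ge y c with h | h
    · refine (intervalIntegral.integral_congr (g := fun _ => 0) fun t ht => ?_).trans (by simp)
      refine hz t fun ht' => ?_
      have := ht.2
      have h1 : t ≤ max 0 y := this
      have h2 : max 0 y < c := max_lt hc h
      linarith [ht'.1]
    · have hy2 : d < y := by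
        by_contra h'
        exact hy ⟨h, not_lt.1 h'⟩
      have hy0 : 0 ≤ y := by linarith
      simp only [K]
      rw [intervalIntegral.integral_of_le hy0, ← h0]
      refine setIntegral_eq_integral_of_forall_compl_eq_zero fun t ht => hz t fun ht' => ht ?_
      exact ⟨hc.trans_le ht'.1, ht'.2.trans hy2.le⟩
  have hts : tsupport K ⊆ Icc c d := closure_minimal (fun y hy => by
    by_contra h
    exact hy (hsup y h)) isClosed_Icc
  refine ⟨K, contDiff_infty_iff_deriv.2 ⟨fun y => (hd y).differentiableAt, hder ▸ k1⟩,
    isCompact_Icc.of_isClosed_subset (isClosed_tsupport _) hts,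
    hts.trans fun y hy => hc.trans_le hy.1, hder⟩

/-- If `f` is holomorphic then its Fourier transform in the first variable, if it is a function,
has the form `g(ξ) e^{-ξ y}`. -/
theorem IsPartialFourier.exists_eq_mul_exp {f : UpperHalfPlane → ℂ} {φ : ℝ → ℝ → ℂ}
    (H : IsPartialFourier f φ)
    (hf : DifferentiableOn ℂ (fun z : ℂ => f (UpperHalfPlane.ofComplex z)) {z : ℂ | 0 < z.im}) :
    ∃ g : ℝ → ℂ, AEStronglyMeasurable g volume ∧
      Function.uncurry φ =ᵐ[(volume : Measure ℝ).prod volPos]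
        fun w => g w.1 * (Real.exp (-(w.1 * w.2)) : ℂ) := by
  -- The du Bois-Reymond argument needs one reference test function of integral one, supported
  -- inside the half-line.
  let b : ContDiffBump (1 : ℝ) := ⟨1 / 4, 1 / 2, by norm_num, by norm_num⟩
  let k₀ : ℝ → ℂ := fun x => (b.normed volume x : ℂ)
  have a1 : ContDiff ℝ ∞ k₀ := Complex.ofRealCLM.contDiff.comp b.contDiff_normed
  have a2 : HasCompactSupport k₀ :=
    b.hasCompactSupport_normed.comp_left (g := fun x : ℝ => (x : ℂ)) Complex.ofReal_zero
  have a3 : tsupport k₀ ⊆ Ioi 0 := by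
    refine (tsupport_comp_subset (g := fun x : ℝ => (x : ℂ)) Complex.ofReal_zero _).trans ?_
    rw [b.tsupport_normed_eq, Real.closedBall_eq_Icc]
    intro x hx
    have h1 : (1 : ℝ) - 1 / 2 ≤ x := hx.1
    exact mem_Ioi.2 (by linarith)
  have a4 : ∫ x, k₀ x = 1 := by
    simp only [k₀]
    rw [integral_complex_ofReal, b.integral_normed, ofReal_one]
  have hl := H.locallyIntegrable_right
  have hc : ContinuousOn (fun w : ℝ × ℝ => (Real.exp (w.1 * w.2) : ℂ)) (univ ×ˢ Ioi 0) := by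
    fun_prop
  -- Since `e^{ξ y} φ` should not depend on `y`, its average against `k₀` is the only candidate.
  let g : ℝ → ℂ := fun ξ => ∫ y, φ ξ y * ((Real.exp (ξ * y) : ℂ) * k₀ y) ∂volPos
  have gu : ∀ u : ℝ → ℂ, Continuous u → HasCompactSupport u → Integrable (fun ξ => g ξ * u ξ) ∧
      ∫ ξ, g ξ * u ξ = ∫ w, φ w.1 w.2 * ((Real.exp (w.1 * w.2) : ℂ) * (u w.1 * k₀ w.2))
        ∂((volume : Measure ℝ).prod volPos) := by
    intro u u1 u2
    have i1 := (integrable_mul_of_locallyIntegrableOn hl hc u1 u2 a1.continuous a2 a3).2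
    have e : ∀ ξ, ∫ y, Function.uncurry φ (ξ, y) * ((Real.exp (ξ * y) : ℂ) * (u ξ * k₀ y)) ∂volPos
        = g ξ * u ξ := fun ξ => by
      simp only [g, ← integral_mul_const]
      refine integral_congr_ae (.of_forall fun y => ?_)
      simp only [Function.uncurry]
      ring
    have i2 := i1.integral_prod_left
    simp only [e] at i2
    refine ⟨i2, ?_⟩
    have e2 := integral_prod _ i1
    simp only [e] at e2
    exact e2.symm
  have gi : ∀ M : ℝ, IntegrableOn g (Icc (-M) M) := by
    intro M
    let b' : ContDiffBump (0 : ℝ) := ⟨|M| + 1, |M| + 2, by positivity, by linarith⟩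
    have h1 := (gu (fun x => (b' x : ℂ)) (Complex.continuous_ofReal.comp b'.continuous)
      (b'.hasCompactSupport.comp_left (g := fun x : ℝ => (x : ℂ)) Complex.ofReal_zero)).1
    refine (h1.integrableOn (s := Icc (-M) M)).congr_fun (fun x hx => ?_) measurableSet_Icc
    have : b' x = 1 := b'.one_of_mem_closedBall (by
      rw [Real.closedBall_eq_Icc]
      have h2 := hx.1
      have h3 := hx.2
      have h4 := le_abs_self M
      show x ∈ Icc (0 - (|M| + 1)) (0 + (|M| + 1))
      constructor <;> linarith)
    simp only [this, ofReal_one, mul_one]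
  have gm : AEStronglyMeasurable g volume := by
    have : (volume : Measure ℝ) = volume.restrict (⋃ n : ℕ, Icc (-(n : ℝ)) n) := by
      have : (⋃ n : ℕ, Icc (-(n : ℝ)) n) = univ := by
        refine eq_univ_of_forall fun x => ?_
        obtain ⟨n, hn⟩ := exists_nat_gt |x|
        exact mem_iUnion.2 ⟨n, (abs_le.1 hn.le)⟩
      rw [this, Measure.restrict_univ]
    rw [this]
    exact aestronglyMeasurable_iUnion_iff.2 fun n => (gi n).1
  have glic : LocallyIntegrableOn (fun w : ℝ × ℝ => g w.1) (univ ×ˢ Ioi 0) volume := by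
    refine locallyIntegrableOn_of_box fun M c d hc hcd => ?_
    have h1 : IntegrableOn (fun _ : ℝ => (1 : ℂ)) (Icc c d) :=
      continuous_const.integrableOn_Icc
    have h2 := Integrable.mul_prod (gi M) h1
    rw [Measure.prod_restrict, ← Measure.volume_eq_prod] at h2
    simp only [mul_one] at h2
    exact h2
  refine ⟨g, gm, ?_⟩
  have key : (fun w : ℝ × ℝ => Function.uncurry φ w * (Real.exp (w.1 * w.2) : ℂ) - g w.1)
      =ᵐ[(volume : Measure ℝ).prod volPos] 0 := by
    have hl2 : LocallyIntegrableOn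
        (fun w : ℝ × ℝ => Function.uncurry φ w * (Real.exp (w.1 * w.2) : ℂ)) (univ ×ˢ Ioi 0) volume :=
      hl.mul_continuousOn hc (isOpen_univ.prod isOpen_Ioi).isLocallyClosed
    refine ae_eq_zero_of_integral_tensor (hl2.sub glic) fun u k u1 u2 k1 k2 k3 => ?_
    have i1 := (integrable_mul_of_locallyIntegrableOn hl hc u1.continuous u2 k1.continuous k2 k3).2
    have i0 := (integrable_mul_of_locallyIntegrableOn hl hc u1.continuous u2 a1.continuous a2 a3).2
    have hkv : Integrable k volPos :=
      (k1.continuous.integrable_of_hasCompactSupport k2).restrict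
    have i2 : Integrable (fun w : ℝ × ℝ => (g w.1 * u w.1) * k w.2)
      ((volume : Measure ℝ).prod volPos) := (gu u u1.continuous u2).1.mul_prod hkv
    have hkz : ∫ y, k y ∂volPos = ∫ y, k y := setIntegral_eq_integral_of_forall_compl_eq_zero
      fun y hy => eq_zero_of_tsupport k3 (not_lt.1 hy)
    -- Removing the mean of `k` leaves a derivative of a test function, against which `e^{ξ y} φ`
    -- integrates to zero.
    let κ : ℝ → ℂ := fun y => k y - (∫ t, k t) * k₀ y
    have κsub : tsupport κ ⊆ tsupport k ∪ tsupport k₀ := by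
      refine closure_minimal (fun y hy => ?_) ((isClosed_tsupport _).union (isClosed_tsupport _))
      by_contra h
      simp only [mem_union, not_or] at h
      exact hy (by simp [κ, image_eq_zero_of_notMem_tsupport h.1,
        image_eq_zero_of_notMem_tsupport h.2])
    obtain ⟨K, K1, K2, K3, K4⟩ := exists_deriv_eq_of_integral_eq_zero (κ := κ)
      (k1.sub (contDiff_const.mul a1))
      ((k2.isCompact.union a2.isCompact).of_isClosed_subset (isClosed_tsupport _) κsub)
      (κsub.trans (union_subset k3 a3)) (by
        simp only [κ]
        rw [integral_sub (k1.continuous.integrable_of_hasCompactSupport k2)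
          ((a1.continuous.integrable_of_hasCompactSupport a2).const_mul _), integral_const_mul, a4]
        ring)
    have z := H.integral_exp_mul_deriv hf u1.continuous u2 K1 K2 K3
    rw [K4] at z
    have e1 : ∀ w : ℝ × ℝ, φ w.1 w.2 * ((Real.exp (w.1 * w.2) : ℂ) * (u w.1 * κ w.2)) =
        Function.uncurry φ w * ((Real.exp (w.1 * w.2) : ℂ) * (u w.1 * k w.2)) - (∫ t, k t) *
        (Function.uncurry φ w * ((Real.exp (w.1 * w.2) : ℂ) * (u w.1 * k₀ w.2))) := fun w => by
      simp only [κ, Function.uncurry]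
      ring
    simp only [e1] at z
    rw [integral_sub i1 (i0.const_mul _), integral_const_mul] at z
    have e2 : ∀ w : ℝ × ℝ, (Function.uncurry φ w * (Real.exp (w.1 * w.2) : ℂ) - g w.1) *
        (u w.1 * k w.2) = Function.uncurry φ w * ((Real.exp (w.1 * w.2) : ℂ) * (u w.1 * k w.2)) -
        (g w.1 * u w.1) * k w.2 := fun w => by ring
    simp only [e2]
    rw [integral_sub i1 i2, integral_prod_mul (fun ξ => g ξ * u ξ) k, hkz,
      (gu u u1.continuous u2).2]
    simp only [Function.uncurry] at z ⊢
    linear_combination z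
  filter_upwards [key] with w hw
  simp only [Pi.zero_apply] at hw
  rw [← sub_eq_zero.1 hw, mul_assoc, ← Complex.ofReal_mul, ← Real.exp_add]
  simp

/-! ### The explicit inverse `R_λ⁻¹` and its Fourier transform. -/

/-- The Fourier transform in the first variable of the function `R_λ⁻¹ φ`. -/
def fourierDensity (lam p : ℝ) (φ : ℝ → ℂ) (ξ y : ℝ) : ℂ :=
  (Ioi (0 : ℝ)).indicator (fun ξ => ((Real.sqrt Real.pi * theta lam p ξ : ℝ) : ℂ) * φ ξ) ξ *
    (Real.exp (-(ξ * y)) : ℂ)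

/-- The explicit form of `R_λ⁻¹ φ`. -/
def synthesis (lam p : ℝ) (φ : ℝ → ℂ) (z : UpperHalfPlane) : ℂ :=
  ((p ^ ((lam + 1) / p) /
    (Real.sqrt 2 * (2 ^ lam * Real.Gamma (lam + 2)) ^ (1 / p)) : ℝ) : ℂ) *
  ∫ ξ : ℝ, φ ξ * ((ξ ^ ((lam + 1) / p) : ℝ) : ℂ) * Complex.exp (I * ξ * z) ∂volPos

theorem coe_pt {x y : ℝ} (hy : 0 < y) : (pt x y : ℂ) = (x : ℂ) + (y : ℂ) * I := by
  rw [pt, UpperHalfPlane.ofComplex_apply_of_im_pos (by simpa using hy)]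

theorem pt_im {x y : ℝ} (hy : 0 < y) : (pt x y).im = y := by
  rw [← UpperHalfPlane.coe_im, coe_pt hy]
  simp

theorem pt_re_im (z : UpperHalfPlane) : pt z.re z.im = z := by
  apply UpperHalfPlane.ext
  rw [coe_pt z.im_pos, ← UpperHalfPlane.coe_re, ← UpperHalfPlane.coe_im, Complex.re_add_im]

theorem ae_volPos_pos : ∀ᵐ x ∂volPos, 0 < x := ae_restrict_mem measurableSet_Ioi

theorem theta_eq {lam p x : ℝ} (hlam : -1 < lam) (hp : 1 ≤ p) (hx : 0 < x) :
    theta lam p x = p ^ ((lam + 1) / p) / (2 ^ lam * Real.Gamma (lam + 2)) ^ (1 / p) *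
      x ^ ((lam + 1) / p) := by
  have hp0 : 0 < p := by linarith
  have hg : 0 < Real.Gamma (lam + 2) := Real.Gamma_pos_of_pos (by linarith)
  rw [theta, Real.div_rpow (by positivity) (by positivity), Real.mul_rpow (by positivity)
    (by positivity), ← Real.rpow_mul hp0.le, ← Real.rpow_mul hx.le]
  rw [mul_one_div]
  ring

theorem theta_pos {lam p x : ℝ} (hlam : -1 < lam) (hp : 1 ≤ p) (hx : 0 < x) :
    0 < theta lam p x := by
  have hp0 : 0 < p := by linarith
  have hg : 0 < Real.Gamma (lam + 2) := Real.Gamma_pos_of_pos (by linarith)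
  rw [theta]
  positivity

theorem exists_rpow_mul_exp_le {s y : ℝ} (hs : 0 ≤ s) (hy : 0 < y) :
    ∃ C : ℝ, ∀ ξ : ℝ, 0 < ξ → ξ ^ s * Real.exp (-(ξ * y)) ≤ C := by
  obtain ⟨n, hn⟩ := exists_nat_ge s
  refine ⟨1 + n.factorial / y ^ n, fun ξ hξ => ?_⟩
  have h1 : ξ ^ s ≤ 1 + ξ ^ n := by
    rcases le_total ξ 1 with h | h
    · have := Real.rpow_le_one hξ.le h hs
      have : 0 ≤ ξ ^ n := by positivity
      linarith
    · have := Real.rpow_le_rpow_of_exponent_le h hn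
      rw [Real.rpow_natCast] at this
      linarith
  have h2 := Real.pow_div_factorial_le_exp (ξ * y) (by positivity) n
  have h3 : ξ ^ n ≤ n.factorial / y ^ n * Real.exp (ξ * y) := by
    rw [div_le_iff₀ (by positivity), mul_pow] at h2
    rw [div_mul_eq_mul_div, le_div_iff₀ (by positivity)]
    linarith
  have h4 : Real.exp (-(ξ * y)) ≤ 1 := Real.exp_le_one_iff.2 (by nlinarith [mul_pos hξ hy])
  have h5 : Real.exp (ξ * y) * Real.exp (-(ξ * y)) = 1 := by rw [← Real.exp_add]; simp
  calc ξ ^ s * Real.exp (-(ξ * y)) ≤ (1 + n.factorial / y ^ n * Real.exp (ξ * y)) *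
        Real.exp (-(ξ * y)) := by gcongr; linarith
    _ = Real.exp (-(ξ * y)) + n.factorial / y ^ n * (Real.exp (ξ * y) * Real.exp (-(ξ * y))) := by
        ring
    _ ≤ _ := by rw [h5, mul_one]; linarith

theorem integrable_rpow_mul_exp {s y : ℝ} (hs : -1 < s) (hy : 0 < y) :
    Integrable (fun ξ : ℝ => ξ ^ s * Real.exp (-(ξ * y))) volPos := by
  have := integrableOn_rpow_mul_exp_neg_mul_rpow (p := 1) hs one_pos hy
  simp only [Real.rpow_one] at this
  refine this.congr (.of_forall fun ξ => ?_)
  simp only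
  congr 2
  ring

variable {lam p q : ℝ} {φ : ℝ → ℂ}

/-- The weight is both integrable and bounded, so `|φ| ≤ 1 + |φ|^q` suffices for all `q ≥ 1` at
once, without conjugate exponents. -/
theorem integrable_mul_weight (hq : 1 ≤ q) (hφ : MemLp φ (ENNReal.ofReal q) volPos) {s y : ℝ}
    (hs : 0 ≤ s) (hy : 0 < y) :
    Integrable (fun ξ : ℝ => φ ξ * ((ξ ^ s * Real.exp (-(ξ * y)) : ℝ) : ℂ)) volPos := by
  have hq0 : 0 < q := by linarith
  obtain ⟨C, hC⟩ := exists_rpow_mul_exp_le hs hy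
  have h1 : Integrable (fun x => ‖φ x‖ ^ q) volPos := by
    have := hφ.integrable_norm_rpow (by simpa using hq0) (by simp)
    rwa [ENNReal.toReal_ofReal hq0.le] at this
  have hm : Measurable fun ξ : ℝ => ξ ^ s * Real.exp (-(ξ * y)) := by fun_prop
  refine Integrable.mono' ((integrable_rpow_mul_exp (by linarith : -1 < s) hy).add (h1.const_mul C))
    (hφ.1.mul (Complex.measurable_ofReal.comp hm).aestronglyMeasurable) ?_
  filter_upwards [ae_volPos_pos] with ξ hξ
  have hb : 0 ≤ ξ ^ s * Real.exp (-(ξ * y)) := by positivity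
  rw [norm_mul, Complex.norm_real, Real.norm_of_nonneg hb]
  have h2 : ‖φ ξ‖ ≤ 1 + ‖φ ξ‖ ^ q := by
    rcases le_total ‖φ ξ‖ 1 with h | h
    · have : 0 ≤ ‖φ ξ‖ ^ q := by positivity
      linarith
    · have := Real.self_le_rpow_of_one_le h hq
      linarith
  have h3 : 0 ≤ ‖φ ξ‖ ^ q := by positivity
  have h4 := hC ξ hξ
  simp only [Pi.add_apply]
  nlinarith

theorem norm_cexp_I_mul (ξ : ℝ) (z : ℂ) : ‖Complex.exp (I * ξ * z)‖ = Real.exp (-(ξ * z.im)) := by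
  rw [Complex.norm_exp]
  simp

theorem integrable_synthesis (hlam : -1 < lam) (hp : 1 ≤ p) (hq : 1 ≤ q)
    (hφ : MemLp φ (ENNReal.ofReal q) volPos) (z : UpperHalfPlane) :
    Integrable (fun ξ : ℝ =>
      φ ξ * ((ξ ^ ((lam + 1) / p) : ℝ) : ℂ) * Complex.exp (I * ξ * z)) volPos := by
  have hs : 0 ≤ (lam + 1) / p := div_nonneg (by linarith) (by linarith)
  refine (integrable_mul_weight hq hφ hs z.im_pos).mono ?_ ?_
  · refine (hφ.1.mul (Measurable.aestronglyMeasurable ?_)).mul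
      (Continuous.aestronglyMeasurable (by fun_prop))
    fun_prop
  · refine .of_forall fun ξ => ?_
    rw [norm_mul, norm_cexp_I_mul, norm_mul, norm_mul, Complex.norm_real, Complex.norm_real,
      norm_mul, Real.norm_of_nonneg (Real.exp_pos _).le, mul_assoc]
    rfl

theorem integrable_fourierDensity (hlam : -1 < lam) (hp : 1 ≤ p) (hq : 1 ≤ q)
    (hφ : MemLp φ (ENNReal.ofReal q) volPos) {y : ℝ} (hy : 0 < y) :
    Integrable (fun ξ => fourierDensity lam p φ ξ y) := by
  have hs : 0 ≤ (lam + 1) / p := div_nonneg (by linarith) (by linarith)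
  have h1 := (integrable_mul_weight hq hφ hs hy).const_mul
    ((Real.sqrt Real.pi * (p ^ ((lam + 1) / p) / (2 ^ lam * Real.Gamma (lam + 2)) ^ (1 / p)) : ℝ) : ℂ)
  have h2 : IntegrableOn (fun ξ => ((Real.sqrt Real.pi * theta lam p ξ : ℝ) : ℂ) * φ ξ *
      (Real.exp (-(ξ * y)) : ℂ)) (Ioi 0) volume := by
    refine IntegrableOn.congr_fun h1 (fun ξ hξ => ?_) measurableSet_Ioi
    simp only [theta_eq hlam hp hξ]
    push_cast
    ring
  refine (h2.integrable_indicator measurableSet_Ioi).congr (.of_forall fun ξ => ?_)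
  simp only [fourierDensity, indicator]
  split_ifs <;> simp

/-- On a horizontal line `e^{iξz}` splits into `e^{iξx}` and `e^{-ξy}`; the constants match because
`√π / √(2π) = 1 / √2`. -/
theorem synthesis_pt (hlam : -1 < lam) (hp : 1 ≤ p) (φ : ℝ → ℂ) {y : ℝ} (hy : 0 < y) (x : ℝ) :
    synthesis lam p φ (pt x y) = invFourier (fun ξ => fourierDensity lam p φ ξ y) x := by
  have hc : Real.sqrt Real.pi * (1 / Real.sqrt (2 * Real.pi)) = 1 / Real.sqrt 2 := by
    rw [Real.sqrt_mul (by norm_num)]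
    have : Real.sqrt Real.pi ≠ 0 := (Real.sqrt_pos.2 Real.pi_pos).ne'
    field_simp
  have e1 : ∀ u : ℝ, Complex.exp (I * u * x) * fourierDensity lam p φ u y =
      (Ioi (0 : ℝ)).indicator (fun u => ((Real.sqrt Real.pi * (p ^ ((lam + 1) / p) /
        (2 ^ lam * Real.Gamma (lam + 2)) ^ (1 / p)) : ℝ) : ℂ) * (φ u *
        ((u ^ ((lam + 1) / p) : ℝ) : ℂ) * Complex.exp (I * u * pt x y))) u := fun u => by
    simp only [fourierDensity]
    by_cases hu : u ∈ Ioi (0 : ℝ)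
    · rw [indicator_of_mem hu, indicator_of_mem hu, theta_eq hlam hp hu, coe_pt hy]
      have : Complex.exp (I * u * (x + y * I)) =
          Complex.exp (I * u * x) * (Real.exp (-(u * y)) : ℂ) := by
        rw [Complex.ofReal_exp, ← Complex.exp_add]
        congr 1
        push_cast
        linear_combination u * y * I_mul_I
      rw [this]
      push_cast
      ring
    · rw [indicator_of_notMem hu, indicator_of_notMem hu, zero_mul, mul_zero]
  simp only [invFourier, e1, synthesis]
  rw [integral_indicator measurableSet_Ioi, integral_const_mul, ← mul_assoc, ← Complex.ofReal_mul]
  rw [volPos]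
  congr 2
  rw [← mul_assoc, mul_comm (1 / Real.sqrt (2 * Real.pi)), hc]
  field_simp

theorem differentiableOn_synthesis (hlam : -1 < lam) (hp : 1 ≤ p) (hq : 1 ≤ q)
    (hφ : MemLp φ (ENNReal.ofReal q) volPos) :
    DifferentiableOn ℂ (fun z : ℂ => synthesis lam p φ (UpperHalfPlane.ofComplex z))
      {z : ℂ | 0 < z.im} := by
  have hs : 0 ≤ (lam + 1) / p := div_nonneg (by linarith) (by linarith)
  have hopen : IsOpen {z : ℂ | 0 < z.im} := isOpen_lt continuous_const Complex.continuous_im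
  have key : DifferentiableOn ℂ (fun z : ℂ => ∫ ξ : ℝ, φ ξ * ((ξ ^ ((lam + 1) / p) : ℝ) : ℂ) *
      Complex.exp (I * ξ * z) ∂volPos) {z : ℂ | 0 < z.im} := by
    intro z hz
    have hz' : 0 < z.im := hz
    refine DifferentiableAt.differentiableWithinAt ?_
    have hmeas : ∀ w : ℂ, AEStronglyMeasurable (fun ξ : ℝ => φ ξ *
        ((ξ ^ ((lam + 1) / p) : ℝ) : ℂ) * Complex.exp (I * ξ * w)) volPos := fun w =>
      (hφ.1.mul (Measurable.aestronglyMeasurable (by fun_prop))).mul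
        (Continuous.aestronglyMeasurable (by fun_prop))
    -- On the ball of radius `Im z / 2` the imaginary part stays above `Im z / 2`; the factor `ξ`
    -- from differentiation raises the power in the bound by one.
    refine (hasDerivAt_integral_of_dominated_loc_of_deriv_le
      (F' := fun (w : ℂ) (ξ : ℝ) => φ ξ * ((ξ ^ ((lam + 1) / p) : ℝ) : ℂ) *
        Complex.exp (I * ξ * w) * (I * ξ))
      (bound := fun ξ => ‖φ ξ * ((ξ ^ ((lam + 1) / p + 1) * Real.exp (-(ξ * (z.im / 2))) : ℝ) : ℂ)‖)
      (Metric.ball_mem_nhds z (half_pos hz')) (.of_forall hmeas) ?_ ?_ ?_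
      (integrable_mul_weight hq hφ (by linarith) (half_pos hz')).norm ?_).2.differentiableAt
    · exact integrable_synthesis hlam hp hq hφ ⟨z, hz⟩
    · exact (hmeas z).mul (Continuous.aestronglyMeasurable (by fun_prop))
    · filter_upwards [ae_volPos_pos] with ξ hξ w hw
      have him : z.im / 2 ≤ w.im := by
        have h1 := (Complex.abs_im_le_norm (w - z)).trans (mem_ball_iff_norm.1 hw).le
        have h2 := (abs_le.1 h1).1
        rw [Complex.sub_im] at h2
        linarith
      rw [norm_mul, norm_mul, norm_mul, norm_cexp_I_mul, norm_mul, Complex.norm_I, one_mul,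
        Complex.norm_real, Complex.norm_real, norm_mul, Complex.norm_real, norm_mul,
        Real.norm_of_nonneg (Real.exp_pos (-(ξ * (z.im / 2)))).le, Real.rpow_add hξ, Real.rpow_one,
        norm_mul]
      have : Real.exp (-(ξ * w.im)) ≤ Real.exp (-(ξ * (z.im / 2))) := by
        rw [Real.exp_le_exp]
        nlinarith
      calc ‖φ ξ‖ * ‖ξ ^ ((lam + 1) / p)‖ * Real.exp (-(ξ * w.im)) * ‖ξ‖
          ≤ ‖φ ξ‖ * ‖ξ ^ ((lam + 1) / p)‖ * Real.exp (-(ξ * (z.im / 2))) * ‖ξ‖ := by gcongr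
        _ = _ := by ring
    · refine .of_forall fun ξ w _ => ?_
      have := ((hasDerivAt_id w).const_mul (I * (ξ : ℂ))).cexp.const_mul
        (φ ξ * ((ξ ^ ((lam + 1) / p) : ℝ) : ℂ))
      simp only [id_eq, mul_one] at this
      refine this.congr_deriv ?_
      ring
  refine (key.const_mul (((p ^ ((lam + 1) / p) /
    (Real.sqrt 2 * (2 ^ lam * Real.Gamma (lam + 2)) ^ (1 / p)) : ℝ) : ℂ))).congr fun z hz => ?_
  simp only [synthesis]
  rw [UpperHalfPlane.ofComplex_apply_of_im_pos hz]

theorem continuousOn_comp_pt {f : UpperHalfPlane → ℂ}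
    (hf : DifferentiableOn ℂ (fun z : ℂ => f (UpperHalfPlane.ofComplex z)) {z : ℂ | 0 < z.im}) :
    ContinuousOn (fun w : ℝ × ℝ => f (pt w.1 w.2)) (univ ×ˢ Ioi 0) :=
  hf.continuousOn.comp (f := fun w : ℝ × ℝ => (w.1 : ℂ) + (w.2 : ℂ) * I)
    (by fun_prop : Continuous fun w : ℝ × ℝ => (w.1 : ℂ) + (w.2 : ℂ) * I).continuousOn
    fun w hw => by simpa using hw

theorem norm_fourierDensity_le {c y : ℝ} (hy : c ≤ y) (ξ : ℝ) :
    ‖fourierDensity lam p φ ξ y‖ ≤ ‖fourierDensity lam p φ ξ c‖ := by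
  simp only [fourierDensity, norm_mul]
  by_cases hξ : ξ ∈ Ioi (0 : ℝ)
  · refine mul_le_mul_of_nonneg_left ?_ (norm_nonneg _)
    rw [Complex.norm_real, Complex.norm_real, Real.norm_of_nonneg (Real.exp_pos _).le,
      Real.norm_of_nonneg (Real.exp_pos _).le, Real.exp_le_exp]
    have : 0 < ξ := hξ
    nlinarith
  · rw [indicator_of_notMem hξ, norm_zero, zero_mul, zero_mul]

theorem norm_synthesis_pt_le (hlam : -1 < lam) (hp : 1 ≤ p) (hq : 1 ≤ q)
    (hφ : MemLp φ (ENNReal.ofReal q) volPos) {c : ℝ} (hc : 0 < c) :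
    ∃ C, ∀ x y : ℝ, c ≤ y → ‖synthesis lam p φ (pt x y)‖ ≤ C := by
  refine ⟨1 / Real.sqrt (2 * Real.pi) * ∫ u, ‖fourierDensity lam p φ u c‖, fun x y hy => ?_⟩
  rw [synthesis_pt hlam hp φ (hc.trans_le hy)]
  refine (invFourier_norm_le _ _).trans ?_
  gcongr 1 / Real.sqrt (2 * Real.pi) * ?_
  refine integral_mono (integrable_fourierDensity hlam hp hq hφ (hc.trans_le hy)).norm
    (integrable_fourierDensity hlam hp hq hφ hc).norm fun ξ =>
      norm_fourierDensity_le hy ξ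

theorem aestronglyMeasurable_indicator_theta (hφ : AEStronglyMeasurable φ volPos) :
    AEStronglyMeasurable ((Ioi (0 : ℝ)).indicator
      (fun ξ => ((Real.sqrt Real.pi * theta lam p ξ : ℝ) : ℂ) * φ ξ)) volume := by
  rw [aestronglyMeasurable_indicator_iff measurableSet_Ioi]
  refine AEStronglyMeasurable.mul (Measurable.aestronglyMeasurable ?_) hφ
  unfold theta
  fun_prop

theorem aestronglyMeasurable_fourierDensity (hφ : AEStronglyMeasurable φ volPos) (ν : Measure ℝ) :
    AEStronglyMeasurable (Function.uncurry (fourierDensity lam p φ)) ((volume : Measure ℝ).prod ν) := by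
  refine ((aestronglyMeasurable_indicator_theta hφ).comp_quasiMeasurePreserving
    Measure.quasiMeasurePreserving_fst).mul
    (Continuous.aestronglyMeasurable (f := fun w : ℝ × ℝ => (Real.exp (-(w.1 * w.2)) : ℂ)) ?_)
  fun_prop

/-- The Fourier transform in the first variable of `b(y) (R_λ⁻¹ φ)(x + i y)`. -/
theorem isPartialFourier_mul_synthesis (hlam : -1 < lam) (hp : 1 ≤ p) (hq : 1 ≤ q)
    (hφ : MemLp φ (ENNReal.ofReal q) volPos) {b : ℝ → ℂ}
    (hb : LocallyIntegrableOn b (Ioi 0) volume) :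
    IsPartialFourier (fun z => b z.im * synthesis lam p φ z)
      (fun ξ y => b y * fourierDensity lam p φ ξ y) where
  locallyIntegrable := by
    have h1 : LocallyIntegrableOn (fun w : ℝ × ℝ => b w.2) (univ ×ˢ Ioi 0) volume := by
      refine locallyIntegrableOn_of_box fun M c d hc hcd => ?_
      have h1 : IntegrableOn (fun _ : ℝ => (1 : ℂ)) (Icc (-M) M) :=
        continuous_const.integrableOn_Icc
      have h2 := Integrable.mul_prod h1 (hb.integrableOn_compact_subset
        (fun x hx => hc.trans_le hx.1) (isCompact_Icc (a := c) (b := d)))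
      rw [Measure.prod_restrict, ← Measure.volume_eq_prod] at h2
      simp only [one_mul] at h2
      exact h2
    have h2 := h1.mul_continuousOn (continuousOn_comp_pt (differentiableOn_synthesis hlam hp hq hφ))
      (isOpen_univ.prod isOpen_Ioi).isLocallyClosed
    refine locallyIntegrableOn_of_box fun M c d hc hcd => ?_
    have hsub : Icc (-M) M ×ˢ Icc c d ⊆ (univ : Set ℝ) ×ˢ Ioi (0 : ℝ) :=
      prod_mono (subset_univ _) fun x hx => hc.trans_le hx.1
    refine (h2.integrableOn_compact_subset hsub (isCompact_Icc.prod isCompact_Icc)).congr_fun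
      (fun w hw => ?_) (measurableSet_Icc.prod measurableSet_Icc)
    simp only [pt_im (hsub hw).2]
  tempered c d hc hcd := by
    -- No polynomial weight is needed: on `[c, d]` the density is dominated by its slice at `y = c`,
    -- which is integrable in `ξ`.
    refine ⟨0, ?_⟩
    have hbi := hb.integrableOn_compact_subset
        (fun x hx => hc.trans_le hx.1) (isCompact_Icc (a := c) (b := d))
    have h1 := (integrable_fourierDensity hlam hp hq hφ hc).norm.mul_prod hbi.norm
    refine h1.mono' ?_ ?_
    · refine (AEStronglyMeasurable.mul ?_ (aestronglyMeasurable_fourierDensity hφ.1 _)).mul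
        (by simp only [pow_zero]; exact aestronglyMeasurable_const)
      exact hbi.1.comp_quasiMeasurePreserving Measure.quasiMeasurePreserving_snd
    · have : ∀ᵐ w ∂((volume : Measure ℝ).prod (volume.restrict (Icc c d))), w.2 ∈ Icc c d :=
        Measure.quasiMeasurePreserving_snd.ae (ae_restrict_mem measurableSet_Icc)
      filter_upwards [this] with w hw
      simp only [pow_zero, ofReal_one, inv_one, mul_one, norm_mul]
      rw [mul_comm]
      exact mul_le_mul_of_nonneg_right (norm_fourierDensity_le hw.1 _) (norm_nonneg _)
  pairing h k h1 h2 k1 k2 k3 := by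
    have hhi : Integrable h := h1.continuous.integrable_of_hasCompactSupport h2
    obtain ⟨c, d, hc, hcd, hK⟩ := exists_Icc_of_compact k2.isCompact k3
    have hk0 : ∀ y, y ∉ Icc c d → k y = 0 := fun y hy =>
      image_eq_zero_of_notMem_tsupport fun h => hy (hK h)
    have hbi := hb.integrableOn_compact_subset
        (fun x hx => hc.trans_le hx.1) (isCompact_Icc (a := c) (b := d))
    have hbk : Integrable (fun y => b y * k y) volPos := by
      have h3 := hbi.mul_continuousOn k1.continuous.continuousOn isCompact_Icc
      refine ((integrableOn_iff_integrable_of_support_subset fun y hy => ?_).1 h3).restrict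
      by_contra h0
      exact hy (by simp [hk0 y h0])
    have hpos : ∀ᵐ w ∂((volume : Measure ℝ).prod volPos), 0 < w.2 :=
      Measure.quasiMeasurePreserving_snd.ae ae_volPos_pos
    obtain ⟨C, hC⟩ := norm_synthesis_pt_le hlam hp hq hφ hc
    obtain ⟨hcont, hdec⟩ := invFourier_decay h1 h2
    obtain ⟨D, hD⟩ := hdec 0
    have iL : Integrable (fun w : ℝ × ℝ => (h w.1 * (b w.2 * k w.2)) *
        synthesis lam p φ (pt w.1 w.2)) ((volume : Measure ℝ).prod volPos) := by
      refine ((hhi.mul_prod hbk).norm.mul_const C).mono' ((hhi.mul_prod hbk).1.mul ?_) ?_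
      · rw [volPos, prod_restrict_eq]
        exact (continuousOn_comp_pt (differentiableOn_synthesis hlam hp hq hφ)).aestronglyMeasurable
          (MeasurableSet.univ.prod measurableSet_Ioi)
      · refine .of_forall fun w => ?_
        rw [norm_mul]
        by_cases hw : w.2 ∈ Icc c d
        · exact mul_le_mul_of_nonneg_left (hC _ _ hw.1) (norm_nonneg _)
        · simp [hk0 _ hw]
    have iR : Integrable (fun w : ℝ × ℝ => fourierDensity lam p φ w.1 w.2 *
        ((b w.2 * k w.2) * invFourier h w.1)) ((volume : Measure ℝ).prod volPos) := by
      refine (((integrable_fourierDensity hlam hp hq hφ hc).norm.mul_prod hbk.norm).mul_const D).mono'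
        ((aestronglyMeasurable_fourierDensity hφ.1 _).mul
          ((hbk.1.comp_quasiMeasurePreserving Measure.quasiMeasurePreserving_snd).mul
            (hcont.comp continuous_fst).aestronglyMeasurable)) ?_
      refine .of_forall fun w => ?_
      rw [norm_mul, norm_mul _ (invFourier h w.1), ← mul_assoc]
      have := hD w.1
      simp only [pow_zero, ofReal_one, one_mul] at this
      by_cases hw : w.2 ∈ Icc c d
      · gcongr
        exact norm_fourierDensity_le hw.1 _
      · simp [hk0 _ hw]
    have eL : ∫ w, b (pt w.1 w.2).im * synthesis lam p φ (pt w.1 w.2) * (h w.1 * k w.2)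
        ∂((volume : Measure ℝ).prod volPos) = ∫ w : ℝ × ℝ, (h w.1 * (b w.2 * k w.2)) *
        synthesis lam p φ (pt w.1 w.2) ∂((volume : Measure ℝ).prod volPos) := by
      refine integral_congr_ae ?_
      filter_upwards [hpos] with w hw
      rw [pt_im hw]
      ring
    have eR : ∫ w, b w.2 * fourierDensity lam p φ w.1 w.2 * (invFourier h w.1 * k w.2)
        ∂((volume : Measure ℝ).prod volPos) = ∫ w : ℝ × ℝ, fourierDensity lam p φ w.1 w.2 *
        ((b w.2 * k w.2) * invFourier h w.1) ∂((volume : Measure ℝ).prod volPos) :=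
      integral_congr_ae (.of_forall fun w => by ring)
    -- With `y` as the outer variable, `b(y) k(y)` is a constant on each line, and the claim is the
    -- symmetry of the transform there.
    rw [eL, eR, integral_prod_symm _ iL, integral_prod_symm _ iR]
    refine integral_congr_ae ?_
    filter_upwards [ae_volPos_pos] with y hy
    have := integral_invFourier_mul (integrable_fourierDensity hlam hp hq hφ hy) hhi
    simp only [synthesis_pt hlam hp φ hy]
    calc ∫ x, h x * (b y * k y) * invFourier (fun ξ => fourierDensity lam p φ ξ y) x
        = (b y * k y) * ∫ x, invFourier (fun ξ => fourierDensity lam p φ ξ y) x * h x := by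
          rw [← integral_const_mul]; congr 1; ext x; ring
      _ = _ := by rw [this, ← integral_const_mul]; congr 1; ext x; ring

theorem isPartialFourier_synthesis (hlam : -1 < lam) (hp : 1 ≤ p) (hq : 1 ≤ q)
    (hφ : MemLp φ (ENNReal.ofReal q) volPos) :
    IsPartialFourier (synthesis lam p φ) (fourierDensity lam p φ) := by
  have := isPartialFourier_mul_synthesis hlam hp hq hφ (b := fun _ => 1)
    ((locallyIntegrable_const (1 : ℂ)).locallyIntegrableOn _)
  simpa only [one_mul] using this

/-! ### Laplace integrals against `ν_λ` and the mixed norm. -/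

theorem measurable_nu_density (lam : ℝ) : Measurable fun y : ℝ => (lam + 1) * (2 * y) ^ lam := by
  fun_prop

theorem nu_density_nonneg (hlam : -1 < lam) {y : ℝ} (hy : 0 < y) :
    0 ≤ (lam + 1) * (2 * y) ^ lam := by
  have : 0 < lam + 1 := by linarith
  positivity

theorem lintegral_nu (lam : ℝ) (f : ℝ → ℝ≥0∞) :
    ∫⁻ y, f y ∂(nu lam) = ∫⁻ y, ENNReal.ofReal ((lam + 1) * (2 * y) ^ lam) * f y ∂volPos := by
  rw [nu, lintegral_withDensity_eq_lintegral_mul_non_measurable _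
    (measurable_nu_density lam).ennreal_ofReal (.of_forall fun _ => ENNReal.ofReal_lt_top)]
  rfl

theorem integral_nu (hlam : -1 < lam) (f : ℝ → ℂ) :
    ∫ y, f y ∂(nu lam) = ∫ y, (((lam + 1) * (2 * y) ^ lam : ℝ) : ℂ) * f y ∂volPos := by
  rw [nu, integral_withDensity_eq_integral_toReal_smul
    (measurable_nu_density lam).ennreal_ofReal (.of_forall fun _ => ENNReal.ofReal_lt_top)]
  refine integral_congr_ae ?_
  filter_upwards [ae_volPos_pos] with y hy
  rw [ENNReal.toReal_ofReal (nu_density_nonneg hlam hy), real_smul]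

theorem ae_nu_pos (lam : ℝ) : ∀ᵐ y ∂(nu lam), 0 < y :=
  (nu_absolutelyContinuous lam).ae_le ae_volPos_pos

theorem lintegral_exp_nu (hlam : -1 < lam) {s : ℝ} (hs : 0 < s) :
    ∫⁻ y, ENNReal.ofReal (Real.exp (-(s * y))) ∂(nu lam) =
      ENNReal.ofReal (2 ^ lam * Real.Gamma (lam + 2) / s ^ (lam + 1)) := by
  have h1 : ∫⁻ y, ENNReal.ofReal (Real.exp (-(s * y))) ∂(nu lam) =
      ∫⁻ y, ENNReal.ofReal (((lam + 1) * 2 ^ lam) * (y ^ lam * Real.exp (-(y * s)))) ∂volPos := by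
    rw [lintegral_nu]
    refine lintegral_congr_ae ?_
    filter_upwards [ae_volPos_pos] with y hy
    rw [← ENNReal.ofReal_mul (nu_density_nonneg hlam hy), Real.mul_rpow (by norm_num) hy.le,
      mul_comm s y]
    congr 1
    ring
  have hl : 0 < lam + 1 := by linarith
  rw [h1, ← ofReal_integral_eq_lintegral_ofReal ((integrable_rpow_mul_exp hlam hs).const_mul _)
    (by
      filter_upwards [ae_volPos_pos] with y hy
      show 0 ≤ _
      positivity), integral_const_mul]
  congr 1
  have h2 := Real.integral_rpow_mul_exp_neg_mul_Ioi (a := lam + 1) (r := s) (by linarith) hs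
  have h3 : ∫ y, y ^ lam * Real.exp (-(y * s)) ∂volPos =
      ∫ t in Ioi (0 : ℝ), t ^ (lam + 1 - 1) * Real.exp (-(s * t)) := by
    refine integral_congr_ae (.of_forall fun y => ?_)
    simp only
    rw [add_sub_cancel_right, mul_comm y s]
  rw [h3, h2, show lam + 2 = (lam + 1) + 1 by ring, Real.Gamma_add_one hl.ne',
    Real.div_rpow (by norm_num) hs.le, Real.one_rpow]
  ring

theorem integrable_exp_nu (hlam : -1 < lam) {s : ℝ} (hs : 0 < s) :
    Integrable (fun y => (Real.exp (-(s * y)) : ℂ)) (nu lam) := by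
  refine ⟨Continuous.aestronglyMeasurable (by fun_prop), ?_⟩
  rw [HasFiniteIntegral]
  have : ∀ y : ℝ, ‖(Real.exp (-(s * y)) : ℂ)‖ₑ = ENNReal.ofReal (Real.exp (-(s * y))) := fun y => by
    rw [← ofReal_norm, Complex.norm_real, Real.norm_of_nonneg (Real.exp_pos _).le]
  simp only [this, lintegral_exp_nu hlam hs]
  exact ENNReal.ofReal_lt_top

theorem integral_exp_nu (hlam : -1 < lam) {s : ℝ} (hs : 0 < s) :
    ∫ y, (Real.exp (-(s * y)) : ℂ) ∂(nu lam) =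
      ((2 ^ lam * Real.Gamma (lam + 2) / s ^ (lam + 1) : ℝ) : ℂ) := by
  have hg : 0 < Real.Gamma (lam + 2) := Real.Gamma_pos_of_pos (by linarith)
  rw [integral_complex_ofReal, integral_eq_lintegral_of_nonneg_ae
    (.of_forall fun y => (Real.exp_pos _).le) (Continuous.aestronglyMeasurable (by fun_prop)),
    lintegral_exp_nu hlam hs, ENNReal.toReal_ofReal (by positivity)]

theorem theta_rpow {x : ℝ} (hlam : -1 < lam) (hp : 1 ≤ p) (hx : 0 < x) :
    theta lam p x ^ p = (p * x) ^ (lam + 1) / (2 ^ lam * Real.Gamma (lam + 2)) := by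
  have hp0 : 0 < p := by linarith
  have hg : 0 < Real.Gamma (lam + 2) := Real.Gamma_pos_of_pos (by linarith)
  rw [theta, ← Real.rpow_mul (by positivity), one_div_mul_cancel hp0.ne', Real.rpow_one,
    Real.mul_rpow hp0.le hx.le]

/-- The mass dominates every integral of `e^{-s y}`, and these blow up as `s → 0`. This is what
excludes nonpositive frequencies. -/
theorem nu_univ (hlam : -1 < lam) : nu lam univ = ⊤ := by
  have hg : 0 < Real.Gamma (lam + 2) := Real.Gamma_pos_of_pos (by linarith)
  have h1 : ∀ s : ℝ, 0 < s →
      ENNReal.ofReal (2 ^ lam * Real.Gamma (lam + 2) / s ^ (lam + 1)) ≤ nu lam univ := by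
    intro s hs
    rw [← lintegral_exp_nu hlam hs, ← lintegral_one]
    refine lintegral_mono_ae ?_
    filter_upwards [ae_nu_pos lam] with y hy
    rw [ENNReal.ofReal_le_one, Real.exp_le_one_iff]
    nlinarith [mul_pos hs hy]
  have hlim : Tendsto (fun s : ℝ => 2 ^ lam * Real.Gamma (lam + 2) / s ^ (lam + 1)) (𝓝[>] 0) atTop := by
    have h2 : Tendsto (fun s : ℝ => s ^ (lam + 1)) (𝓝[>] 0) (𝓝[>] 0) := by
      refine tendsto_nhdsWithin_iff.2 ⟨?_, ?_⟩
      · have := (Real.continuousAt_rpow_const 0 (lam + 1) (Or.inr (by linarith))).tendsto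
        rw [Real.zero_rpow (by linarith)] at this
        exact this.mono_left nhdsWithin_le_nhds
      · filter_upwards [self_mem_nhdsWithin] with s hs
        exact Real.rpow_pos_of_pos hs _
    simp only [div_eq_mul_inv]
    exact (tendsto_inv_nhdsGT_zero.comp h2).const_mul_atTop (by positivity)
  have h3 := ENNReal.tendsto_ofReal_atTop.comp hlim
  refine top_le_iff.1 (le_of_tendsto h3 ?_)
  filter_upwards [self_mem_nhdsWithin] with s hs using h1 s hs

/-- The norm of `e^{-ξ y}` in `L^p(ν_λ)`. -/
theorem eLpNorm_mul_exp (hlam : -1 < lam) (hp : 1 ≤ p) (c : ℂ) (ξ : ℝ) :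
    eLpNorm (fun y => c * (Real.exp (-(ξ * y)) : ℂ)) (ENNReal.ofReal p) (nu lam) =
      ‖c‖ₑ * (if 0 < ξ then ENNReal.ofReal (1 / theta lam p ξ) else ⊤) := by
  have hp0 : 0 < p := by linarith
  have hsm : (fun y : ℝ => c * (Real.exp (-(ξ * y)) : ℂ)) =
      c • fun y : ℝ => (Real.exp (-(ξ * y)) : ℂ) := rfl
  rw [hsm, eLpNorm_const_smul]
  congr 1
  rw [eLpNorm_eq_lintegral_rpow_enorm_toReal (by simpa using hp0) (by simp),
    ENNReal.toReal_ofReal hp0.le]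
  have e : ∀ y : ℝ, ‖(Real.exp (-(ξ * y)) : ℂ)‖ₑ ^ p =
      ENNReal.ofReal (Real.exp (-(p * ξ * y))) := fun y => by
    rw [← ofReal_norm, Complex.norm_real, Real.norm_of_nonneg (Real.exp_pos _).le,
      ENNReal.ofReal_rpow_of_pos (Real.exp_pos _), ← Real.exp_mul]
    congr 2
    ring
  simp only [e]
  split_ifs with h
  · have ht := theta_pos hlam hp h
    have hg : 0 < Real.Gamma (lam + 2) := Real.Gamma_pos_of_pos (by linarith)
    rw [lintegral_exp_nu hlam (by positivity),
      ENNReal.ofReal_rpow_of_nonneg (by positivity) (by positivity)]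
    congr 1
    rw [← inv_div ((p * ξ) ^ (lam + 1)), ← theta_rpow hlam hp h, Real.inv_rpow (by positivity),
      ← Real.rpow_mul ht.le, mul_one_div_cancel hp0.ne', Real.rpow_one, one_div]
  -- For `ξ ≤ 0` the exponential is at least `1` on a space of infinite mass.
  · have : (⊤ : ℝ≥0∞) ≤ ∫⁻ y, ENNReal.ofReal (Real.exp (-(p * ξ * y))) ∂(nu lam) := by
      rw [← nu_univ hlam, ← lintegral_one]
      refine lintegral_mono_ae ?_
      filter_upwards [ae_nu_pos lam] with y hy
      rw [ENNReal.one_le_ofReal, Real.one_le_exp_iff]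
      have : p * ξ ≤ 0 := mul_nonpos_of_nonneg_of_nonpos hp0.le (not_lt.1 h)
      nlinarith
    rw [top_le_iff.1 this, ENNReal.top_rpow_of_pos (by positivity)]

theorem mixedNorm_congr {Φ Ψ : ℝ → ℝ → ℂ}
    (h : Function.uncurry Φ =ᵐ[(volume : Measure ℝ).prod volPos] Function.uncurry Ψ) :
    mixedNorm lam q p Φ = mixedNorm lam q p Ψ := by
  rw [mixedNorm, mixedNorm]
  congr 1
  refine lintegral_congr_ae ?_
  filter_upwards [Measure.ae_ae_of_ae_prod h] with ξ hξ
  congr 1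
  exact eLpNorm_congr_ae ((nu_absolutelyContinuous lam).ae_le hξ)

/-- The factor `θ(ξ)` in the density cancels the norm `1 / θ(ξ)` of the exponential. The identity
holds in `[0, ∞]`, so it also yields finiteness of the norm of `φ`. -/
theorem mixedNorm_fourierDensity (hlam : -1 < lam) (hp : 1 ≤ p) (hq : 1 ≤ q) (φ : ℝ → ℂ) :
    mixedNorm lam q p (fourierDensity lam p φ) =
      ENNReal.ofReal (Real.sqrt Real.pi) * eLpNorm φ (ENNReal.ofReal q) volPos := by
  have hq0 : 0 < q := by linarith
  have hpi : 0 ≤ Real.sqrt Real.pi := Real.sqrt_nonneg _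
  rw [eLpNorm_eq_lintegral_rpow_enorm_toReal (by simpa using hq0) (by simp),
    ENNReal.toReal_ofReal hq0.le, mixedNorm]
  have e : ∀ ξ, eLpNorm (fourierDensity lam p φ ξ) (ENNReal.ofReal p) (nu lam) ^ q =
      (Ioi (0 : ℝ)).indicator (fun ξ => ENNReal.ofReal (Real.sqrt Real.pi) ^ q * ‖φ ξ‖ₑ ^ q) ξ := by
    intro ξ
    have := eLpNorm_mul_exp hlam hp
      ((Ioi (0 : ℝ)).indicator (fun ξ => ((Real.sqrt Real.pi * theta lam p ξ : ℝ) : ℂ) * φ ξ) ξ) ξ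
    have h2 : fourierDensity lam p φ ξ = fun y => (Ioi (0 : ℝ)).indicator
      (fun ξ => ((Real.sqrt Real.pi * theta lam p ξ : ℝ) : ℂ) * φ ξ) ξ *
        (Real.exp (-(ξ * y)) : ℂ) := rfl
    rw [h2, this]
    by_cases hξ : ξ ∈ Ioi (0 : ℝ)
    · have ht := theta_pos hlam hp hξ
      rw [indicator_of_mem hξ, indicator_of_mem hξ, if_pos (mem_Ioi.1 hξ), ← ENNReal.mul_rpow_of_nonneg _ _ hq0.le]
      congr 1
      rw [enorm_mul, ← ofReal_norm ((_ : ℝ) : ℂ), Complex.norm_real, Real.norm_of_nonneg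
        (by positivity), mul_right_comm, ← ENNReal.ofReal_mul (by positivity)]
      congr 2
      field_simp
    · rw [indicator_of_notMem hξ, indicator_of_notMem hξ, enorm_zero, zero_mul,
        ENNReal.zero_rpow_of_pos hq0]
  simp only [e]
  rw [lintegral_indicator measurableSet_Ioi, lintegral_const_mul' _ _
    (ENNReal.rpow_ne_top_of_nonneg hq0.le ENNReal.ofReal_ne_top), ENNReal.mul_rpow_of_nonneg _ _
    (by positivity), ← ENNReal.rpow_mul, mul_one_div_cancel hq0.ne', ENNReal.rpow_one, volPos]

/-! ### The isomorphism of `L^q(ℝ_+)` with the Bergman space. -/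

theorem memBergman_synthesis (hlam : -1 < lam) (hp : 1 ≤ p) (hq : 1 ≤ q)
    (hφ : MemLp φ (ENNReal.ofReal q) volPos) : MemBergman lam q p (synthesis lam p φ) := by
  refine ⟨differentiableOn_synthesis hlam hp hq hφ, _, isPartialFourier_synthesis hlam hp hq hφ,
    aestronglyMeasurable_fourierDensity hφ.1 _, ?_⟩
  rw [mixedNorm_fourierDensity hlam hp hq]
  exact ENNReal.mul_lt_top ENNReal.ofReal_lt_top hφ.2

/-- A holomorphic function is determined by its Fourier transform in the first variable. -/
theorem eq_of_isPartialFourier {f g : UpperHalfPlane → ℂ} {Φ Ψ : ℝ → ℝ → ℂ}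
    (hf : DifferentiableOn ℂ (fun z : ℂ => f (UpperHalfPlane.ofComplex z)) {z : ℂ | 0 < z.im})
    (hg : DifferentiableOn ℂ (fun z : ℂ => g (UpperHalfPlane.ofComplex z)) {z : ℂ | 0 < z.im})
    (H : IsPartialFourier f Φ) (G : IsPartialFourier g Ψ)
    (h : Function.uncurry Φ =ᵐ[(volume : Measure ℝ).prod volPos] Function.uncurry Ψ) : f = g := by
  have key : (fun w : ℝ × ℝ => f (pt w.1 w.2) - g (pt w.1 w.2))
      =ᵐ[(volume : Measure ℝ).prod volPos] 0 := by
    refine ae_eq_zero_of_integral_tensor (H.locallyIntegrable.sub G.locallyIntegrable)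
      fun u k u1 u2 k1 k2 k3 => ?_
    simp only [sub_mul]
    rw [integral_sub (H.integrable_left u1.continuous u2 k1.continuous k2 k3)
      (G.integrable_left u1.continuous u2 k1.continuous k2 k3),
      H.pairing u k u1 u2 k1 k2 k3, G.pairing u k u1 u2 k1 k2 k3, sub_eq_zero]
    refine integral_congr_ae ?_
    filter_upwards [h] with w hw
    simp only [Function.uncurry] at hw
    rw [hw]
  rw [volPos, prod_restrict_eq] at key
  have h2 := Measure.eqOn_open_of_ae_eq key (isOpen_univ.prod isOpen_Ioi)
    ((continuousOn_comp_pt hf).sub (continuousOn_comp_pt hg)) continuousOn_const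
  funext z
  have := h2 (x := (z.re, z.im)) ⟨mem_univ _, z.im_pos⟩
  simp only [pt_re_im, Pi.zero_apply] at this
  exact sub_eq_zero.1 this

/-- Surjectivity: the transform is `g(ξ) e^{-ξ y}`, and normalizing `g` by `√π θ` produces the
preimage. -/
theorem exists_eq_synthesis (hlam : -1 < lam) (hp : 1 ≤ p) (hq : 1 ≤ q) {f : UpperHalfPlane → ℂ}
    (hf : MemBergman lam q p f) :
    ∃ φ : ℝ → ℂ, MemLp φ (ENNReal.ofReal q) volPos ∧ f = synthesis lam p φ := by
  have hq0 : 0 < q := by linarith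
  obtain ⟨hd, Φ, H, hΦ, hΦ'⟩ := hf
  obtain ⟨g, gm, hg⟩ := H.exists_eq_mul_exp hd
  have hpi : 0 < Real.sqrt Real.pi := Real.sqrt_pos.2 Real.pi_pos
  have hgΦ : Function.uncurry Φ =ᵐ[(volume : Measure ℝ).prod volPos]
    Function.uncurry fun ξ y => g ξ * (Real.exp (-(ξ * y)) : ℂ) := hg
  have hn := hΦ'
  rw [mixedNorm_congr hgΦ, mixedNorm_lt_top_iff hq] at hn
  simp only [eLpNorm_mul_exp hlam hp] at hn
  have htm : Measurable fun ξ => theta lam p ξ := by unfold theta; fun_prop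
  have hm : AEMeasurable (fun ξ =>
      (‖g ξ‖ₑ * if 0 < ξ then ENNReal.ofReal (1 / theta lam p ξ) else ⊤) ^ q) volume := by
    refine (gm.enorm.mul (Measurable.aemeasurable ?_)).pow_const q
    exact Measurable.ite measurableSet_Ioi (htm.const_div 1).ennreal_ofReal measurable_const
  -- At `ξ ≤ 0` the inner norm is `⊤` unless `g ξ = 0`, while finiteness of the outer integral makes
  -- it finite almost everywhere.
  have hneg : ∀ᵐ ξ : ℝ, ξ ≤ 0 → g ξ = 0 := by
    filter_upwards [ae_lt_top' hm hn.ne] with ξ h hξ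
    rw [if_neg (not_lt.2 hξ)] at h
    by_contra h0
    rw [ENNReal.mul_top (by simpa using h0), ENNReal.top_rpow_of_pos hq0] at h
    exact lt_irrefl _ h
  let φ : ℝ → ℂ := fun ξ => g ξ * (((Real.sqrt Real.pi * theta lam p ξ)⁻¹ : ℝ) : ℂ)
  have φm : AEStronglyMeasurable φ volPos :=
    gm.restrict.mul (Complex.measurable_ofReal.comp
      (htm.const_mul _).inv).aestronglyMeasurable
  have hφ : Function.uncurry (fourierDensity lam p φ) =ᵐ[(volume : Measure ℝ).prod volPos]
      Function.uncurry Φ := by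
    have := Measure.quasiMeasurePreserving_fst (μ := (volume : Measure ℝ)) (ν := volPos) |>.ae hneg
    filter_upwards [this, hgΦ] with w h1 h2
    rw [h2]
    simp only [Function.uncurry, fourierDensity]
    congr 1
    by_cases hw : w.1 ∈ Ioi (0 : ℝ)
    · rw [indicator_of_mem hw]
      have ht := theta_pos hlam hp hw
      simp only [φ]
      rw [mul_left_comm, ← Complex.ofReal_mul, mul_inv_cancel₀ (by positivity), ofReal_one, mul_one]
    · rw [indicator_of_notMem hw, h1 (not_lt.1 hw)]
  have hmem : MemLp φ (ENNReal.ofReal q) volPos := by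
    refine ⟨φm, ?_⟩
    rw [← mixedNorm_congr hφ, mixedNorm_fourierDensity hlam hp hq] at hΦ'
    by_contra h
    rw [top_le_iff.1 (not_lt.1 h), ENNReal.mul_top (by simpa using hpi)] at hΦ'
    exact lt_irrefl _ hΦ'
  exact ⟨φ, hmem, eq_of_isPartialFourier hd (differentiableOn_synthesis hlam hp hq hmem) H
    (isPartialFourier_synthesis hlam hp hq hmem) hφ.symm⟩

instance : NeZero volPos := ⟨by
  rw [volPos, Ne, Measure.restrict_eq_zero]
  simp⟩

/-- Almost every fibre contains a good point, as `volPos` is nonzero, and the property does not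
depend on which. -/
theorem ae_of_ae_prod_fst {P : ℝ → Prop}
    (h : ∀ᵐ w ∂((volume : Measure ℝ).prod volPos), P w.1) : ∀ᵐ x : ℝ, P x := by
  filter_upwards [Measure.ae_ae_of_ae_prod h] with x hx
  exact hx.exists.choose_spec

theorem synthesis_injective (hlam : -1 < lam) (hp : 1 ≤ p) (hq : 1 ≤ q) {φ ψ : ℝ → ℂ}
    (hφ : MemLp φ (ENNReal.ofReal q) volPos) (hψ : MemLp ψ (ENNReal.ofReal q) volPos)
    (h : synthesis lam p φ = synthesis lam p ψ) : φ =ᵐ[volPos] ψ := by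
  have H := isPartialFourier_synthesis hlam hp hq hφ
  rw [h] at H
  have h1 := H.ae_unique (isPartialFourier_synthesis hlam hp hq hψ)
  have h2 : ∀ᵐ x : ℝ, 0 < x → φ x = ψ x := by
    refine ae_of_ae_prod_fst ?_
    filter_upwards [h1] with w hw hx
    have ht := theta_pos hlam hp hx
    have hpi : 0 < Real.sqrt Real.pi := Real.sqrt_pos.2 Real.pi_pos
    have hne : ((Real.sqrt Real.pi * theta lam p w.1 : ℝ) : ℂ) ≠ 0 := by
      rw [Complex.ofReal_ne_zero]; positivity
    simp only [Function.uncurry, fourierDensity, indicator_of_mem (mem_Ioi.2 hx)] at hw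
    exact mul_left_cancel₀ hne (mul_right_cancel₀ (by
      rw [Complex.ofReal_ne_zero]; positivity) hw)
  rw [volPos, EventuallyEq, ae_restrict_iff' measurableSet_Ioi]
  exact h2

theorem synthesis_congr {φ ψ : ℝ → ℂ} (h : φ =ᵐ[volPos] ψ) :
    synthesis lam p φ = synthesis lam p ψ := by
  funext z
  simp only [synthesis]
  congr 1
  refine integral_congr_ae ?_
  filter_upwards [h] with ξ hξ
  rw [hξ]

/-- `R_λ⁻¹` as a linear isomorphism. -/
def synthesisEquiv (hlam : -1 < lam) (hq : 1 ≤ q) (hp : 1 ≤ p) :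
    Lp ℂ (ENNReal.ofReal q) volPos ≃ₗ[ℂ] bergmanSpace lam q p hq hp :=
  LinearEquiv.ofBijective
    { toFun := fun φ => ⟨synthesis lam p φ, memBergman_synthesis hlam hp hq (Lp.memLp φ)⟩
      map_add' := fun φ ψ => by
        ext z
        show synthesis lam p _ z = synthesis lam p φ z + synthesis lam p ψ z
        rw [synthesis_congr (Lp.coeFn_add φ ψ)]
        simp only [synthesis, Pi.add_apply, add_mul]
        rw [integral_add (integrable_synthesis hlam hp hq (Lp.memLp φ) z)
          (integrable_synthesis hlam hp hq (Lp.memLp ψ) z), mul_add]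
      map_smul' := fun c φ => by
        ext z
        show synthesis lam p _ z = c * synthesis lam p φ z
        rw [synthesis_congr (Lp.coeFn_smul c φ)]
        simp only [synthesis, Pi.smul_apply, smul_eq_mul, mul_assoc]
        rw [integral_const_mul, mul_left_comm] }
    ⟨fun φ ψ h => Lp.ext (synthesis_injective hlam hp hq (Lp.memLp φ) (Lp.memLp ψ)
        (congrArg Subtype.val h)), fun f => by
      obtain ⟨φ, hφ, h⟩ := exists_eq_synthesis hlam hp hq f.2
      exact ⟨hφ.toLp φ, Subtype.ext (h ▸ synthesis_congr hφ.coeFn_toLp)⟩⟩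

theorem synthesisEquiv_apply (hlam : -1 < lam) (hq : 1 ≤ q) (hp : 1 ≤ p)
    (φ : Lp ℂ (ENNReal.ofReal q) volPos) :
    (synthesisEquiv hlam hq hp φ : UpperHalfPlane → ℂ) = synthesis lam p φ := rfl

/-! ### The function `ψ_λ` and its inverse -/

theorem integrableOn_gammaIntegrand {s : ℝ} (hs : 0 < s) :
    IntegrableOn (fun t : ℝ => t ^ (s - 1) * Real.exp (-t)) (Ioi 0) :=
  (Real.GammaIntegral_convergent hs).congr_fun (fun _ _ => mul_comm _ _) measurableSet_Ioi

theorem setIntegral_gammaIntegrand_pos {s : ℝ} (hs : 0 < s) {S : Set ℝ} (hS : MeasurableSet S)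
    (hS0 : S ⊆ Ioi 0) (hpos : 0 < volume S) : 0 < ∫ t in S, t ^ (s - 1) * Real.exp (-t) := by
  rw [setIntegral_pos_iff_support_of_nonneg_ae]
  · refine hpos.trans_le (measure_mono fun t ht => ⟨?_, ht⟩)
    have : 0 < t := hS0 ht
    exact (by positivity : t ^ (s - 1) * Real.exp (-t) ≠ 0)
  · filter_upwards [ae_restrict_mem hS] with t ht
    have : 0 < t := hS0 ht
    show 0 ≤ t ^ (s - 1) * Real.exp (-t)
    positivity
  · exact (integrableOn_gammaIntegrand hs).mono_set hS0

theorem incGamma_pos {s x : ℝ} (hs : 0 < s) (hx : 0 ≤ x) : 0 < incGamma s x :=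
  setIntegral_gammaIntegrand_pos hs measurableSet_Ioi (Ioi_subset_Ioi hx) (by simp)

theorem incGamma_add_integral {s x : ℝ} (hs : 0 < s) (hx : 0 ≤ x) :
    (∫ t in (0 : ℝ)..x, t ^ (s - 1) * Real.exp (-t)) + incGamma s x = Real.Gamma s := by
  have h := integrableOn_gammaIntegrand hs
  rw [intervalIntegral.integral_of_le hx, incGamma, ← setIntegral_union Ioc_disjoint_Ioi_same
    measurableSet_Ioi (h.mono_set Ioc_subset_Ioi_self) (h.mono_set (Ioi_subset_Ioi hx)),
    Ioc_union_Ioi_eq_Ioi hx, Real.Gamma_eq_integral hs]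
  exact setIntegral_congr_fun measurableSet_Ioi fun t _ => mul_comm _ _

theorem incGamma_lt {s x : ℝ} (hs : 0 < s) (hx : 0 < x) : incGamma s x < Real.Gamma s := by
  rw [← incGamma_add_integral hs hx.le, intervalIntegral.integral_of_le hx.le]
  have := setIntegral_gammaIntegrand_pos hs (S := Ioc 0 x) measurableSet_Ioc
    Ioc_subset_Ioi_self (by simpa using hx)
  linarith

theorem hasDerivAt_incGamma {s x : ℝ} (hs : 0 < s) (hx : 0 < x) :
    HasDerivAt (incGamma s) (-(x ^ (s - 1) * Real.exp (-x))) x := by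
  have hint : IntervalIntegrable (fun t : ℝ => t ^ (s - 1) * Real.exp (-t)) volume 0 x := by
    rw [intervalIntegrable_iff_integrableOn_Ioc_of_le hx.le]
    exact (integrableOn_gammaIntegrand hs).mono_set Ioc_subset_Ioi_self
  have hm : Measurable fun t : ℝ => t ^ (s - 1) * Real.exp (-t) := by fun_prop
  have h1 := intervalIntegral.integral_hasDerivAt_right hint
    hm.stronglyMeasurable.stronglyMeasurableAtFilter
    ((Real.continuousAt_rpow_const x (s - 1) (Or.inl hx.ne')).mul
      (Real.continuous_exp.comp continuous_neg).continuousAt)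
  refine (h1.const_sub (Real.Gamma s)).congr_of_eventuallyEq ?_
  filter_upwards [lt_mem_nhds hx] with t ht
  rw [← incGamma_add_integral hs ht.le]
  ring

theorem tendsto_incGamma_zero {s : ℝ} (hs : 0 < s) :
    Tendsto (incGamma s) (𝓝[>] 0) (𝓝 (Real.Gamma s)) := by
  let f : ℝ → ℝ := (Ioi (0 : ℝ)).indicator fun t : ℝ => t ^ (s - 1) * Real.exp (-t)
  have hf : Integrable f := (integrableOn_gammaIntegrand hs).integrable_indicator measurableSet_Ioi
  have hc := (intervalIntegral.continuous_primitive (fun a b => hf.intervalIntegrable) 0).tendsto 0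
  rw [intervalIntegral.integral_same] at hc
  have h2 := (hc.const_sub (Real.Gamma s)).mono_left (nhdsWithin_le_nhds (s := Ioi 0))
  rw [sub_zero] at h2
  refine h2.congr' ?_
  filter_upwards [self_mem_nhdsWithin] with x hx
  have hx0 : 0 < x := hx
  rw [← incGamma_add_integral hs hx0.le, intervalIntegral.integral_of_le hx0.le,
    intervalIntegral.integral_of_le hx0.le]
  rw [setIntegral_congr_fun (g := fun t : ℝ => t ^ (s - 1) * Real.exp (-t)) measurableSet_Ioc
    fun t ht => indicator_of_mem (s := Ioi (0 : ℝ)) (mem_Ioi.2 ht.1)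
      (fun t : ℝ => t ^ (s - 1) * Real.exp (-t))]
  ring

theorem tendsto_incGamma_atTop {s : ℝ} (hs : 0 < s) : Tendsto (incGamma s) atTop (𝓝 0) := by
  have h1 := intervalIntegral_tendsto_integral_Ioi 0 (integrableOn_gammaIntegrand hs) tendsto_id
  have h2 := h1.const_sub (Real.Gamma s)
  have h3 : ∫ t in Ioi (0 : ℝ), t ^ (s - 1) * Real.exp (-t) = Real.Gamma s := by
    rw [Real.Gamma_eq_integral hs]
    exact setIntegral_congr_fun measurableSet_Ioi fun t _ => mul_comm _ _
  rw [h3, sub_self] at h2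
  refine h2.congr' ?_
  filter_upwards [eventually_ge_atTop 0] with x hx
  rw [← incGamma_add_integral hs hx]
  simp

/-- The function `ln (Γ(s) / Γ(s, x))`. -/
def logGammaRatio (s x : ℝ) : ℝ := Real.log (Real.Gamma s / incGamma s x)

theorem hasDerivAt_logGammaRatio {s x : ℝ} (hs : 0 < s) (hx : 0 < x) :
    HasDerivAt (logGammaRatio s) (x ^ (s - 1) * Real.exp (-x) / incGamma s x) x := by
  have h1 := incGamma_pos hs hx.le
  have h2 := Real.Gamma_pos_of_pos hs
  have h3 := ((hasDerivAt_incGamma hs hx).log h1.ne').const_sub (Real.log (Real.Gamma s))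
  refine (h3.congr_deriv (by ring)).congr_of_eventuallyEq ?_
  filter_upwards [lt_mem_nhds hx] with t ht
  rw [logGammaRatio, Real.log_div h2.ne' (incGamma_pos hs ht.le).ne']

theorem logGammaRatio_pos {s x : ℝ} (hs : 0 < s) (hx : 0 < x) : 0 < logGammaRatio s x :=
  Real.log_pos ((one_lt_div (incGamma_pos hs hx.le)).2 (incGamma_lt hs hx))

theorem strictMonoOn_logGammaRatio {s : ℝ} (hs : 0 < s) :
    StrictMonoOn (logGammaRatio s) (Ioi 0) := by
  refine strictMonoOn_of_deriv_pos (convex_Ioi 0)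
    (fun x hx => (hasDerivAt_logGammaRatio hs hx).continuousAt.continuousWithinAt) fun x hx => ?_
  rw [interior_Ioi] at hx
  have hx0 : 0 < x := hx
  have := incGamma_pos hs hx0.le
  rw [(hasDerivAt_logGammaRatio hs hx).deriv]
  positivity

/-- The ratio tends to `1` at `0` and to `∞` at `∞`, so the logarithm takes every positive value by
continuity. -/
theorem surjOn_logGammaRatio {s : ℝ} (hs : 0 < s) : SurjOn (logGammaRatio s) (Ioi 0) (Ioi 0) := by
  intro y hy
  have hG := Real.Gamma_pos_of_pos hs
  have h0 : Tendsto (logGammaRatio s) (𝓝[>] 0) (𝓝 0) := by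
    have h1 := ((tendsto_const_nhds (x := Real.Gamma s)).div (tendsto_incGamma_zero hs) hG.ne').log
      (by rw [div_self hG.ne']; exact one_ne_zero)
    rwa [div_self hG.ne', Real.log_one] at h1
  have hT : Tendsto (logGammaRatio s) atTop atTop := by
    refine Real.tendsto_log_atTop.comp ?_
    have h1 : Tendsto (incGamma s) atTop (𝓝[>] 0) := tendsto_nhdsWithin_iff.2
      ⟨tendsto_incGamma_atTop hs, (eventually_ge_atTop 0).mono fun x hx => incGamma_pos hs hx⟩
    simp only [div_eq_mul_inv]
    exact (tendsto_inv_nhdsGT_zero.comp h1).const_mul_atTop hG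
  obtain ⟨a, ha1, ha2⟩ := ((h0.eventually_lt_const (mem_Ioi.1 hy)).and self_mem_nhdsWithin).exists
  obtain ⟨b, hb1, hb2⟩ := ((hT.eventually_gt_atTop y).and (eventually_gt_atTop a)).exists
  have ha0 : 0 < a := ha2
  obtain ⟨t, ht1, ht2⟩ := intermediate_value_Icc hb2.le (f := logGammaRatio s)
    (fun x hx => (hasDerivAt_logGammaRatio hs
      (ha0.trans_le hx.1)).continuousAt.continuousWithinAt) ⟨ha1.le, hb1.le⟩
  exact ⟨t, ha0.trans_le ht1.1, ht2⟩

/-- Only the product `p x t` matters, so the calculus reduces to one variable. -/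
theorem psi_eq (lam p x t : ℝ) : psi lam p x t = logGammaRatio (lam + 1) (p * x * t) := rfl

theorem psi_pos (hlam : -1 < lam) (hp : 1 ≤ p) {x t : ℝ} (hx : 0 < x) (ht : 0 < t) :
    0 < psi lam p x t := by
  have hp0 : 0 < p := by linarith
  exact logGammaRatio_pos (by linarith) (by positivity)

theorem injOn_psi (hlam : -1 < lam) (hp : 1 ≤ p) {x : ℝ} (hx : 0 < x) :
    InjOn (psi lam p x) (Ioi 0) := by
  have hp0 : 0 < p := by linarith
  intro t ht t' ht' h
  have ht0 : 0 < t := ht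
  have ht0' : 0 < t' := ht'
  have := (strictMonoOn_logGammaRatio (by linarith : 0 < lam + 1)).injOn
    (mem_Ioi.2 (by positivity : 0 < p * x * t)) (mem_Ioi.2 (by positivity : 0 < p * x * t')) h
  exact mul_left_cancel₀ (by positivity) this

theorem psi_image (hlam : -1 < lam) (hp : 1 ≤ p) {x : ℝ} (hx : 0 < x) :
    psi lam p x '' Ioi 0 = Ioi 0 := by
  have hp0 : 0 < p := by linarith
  refine Subset.antisymm ?_ fun y hy => ?_
  · rintro _ ⟨t, ht, rfl⟩
    exact psi_pos hlam hp hx ht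
  · obtain ⟨t, ht, h⟩ := surjOn_logGammaRatio (by linarith : 0 < lam + 1) hy
    have ht0 : 0 < t := ht
    refine ⟨t / (p * x), mem_Ioi.2 (by positivity), ?_⟩
    rw [psi_eq, mul_div_cancel₀ _ (by positivity), h]

theorem beta_pos (hlam : -1 < lam) (hp : 1 ≤ p) {x y : ℝ} (hx : 0 < x) (hy : 0 < y) :
    0 < beta lam p x y := by
  have : y ∈ psi lam p x '' Ioi 0 := by rw [psi_image hlam hp hx]; exact hy
  exact Function.invFunOn_mem this

theorem psi_beta (hlam : -1 < lam) (hp : 1 ≤ p) {x y : ℝ} (hx : 0 < x) (hy : 0 < y) :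
    psi lam p x (beta lam p x y) = y := by
  have : y ∈ psi lam p x '' Ioi 0 := by rw [psi_image hlam hp hx]; exact hy
  exact Function.invFunOn_eq this

theorem beta_psi (hlam : -1 < lam) (hp : 1 ≤ p) {x t : ℝ} (hx : 0 < x) (ht : 0 < t) :
    beta lam p x (psi lam p x t) = t :=
  injOn_psi hlam hp hx (beta_pos hlam hp hx (psi_pos hlam hp hx ht)) ht
    (psi_beta hlam hp hx (psi_pos hlam hp hx ht))

theorem hasDerivAt_psi (hlam : -1 < lam) (hp : 1 ≤ p) {x t : ℝ} (hx : 0 < x) (ht : 0 < t) :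
    HasDerivAt (psi lam p x) ((p * x * t) ^ lam * Real.exp (-(p * x * t)) /
      incGamma (lam + 1) (p * x * t) * (p * x)) t := by
  have hp0 : 0 < p := by linarith
  have h1 := hasDerivAt_logGammaRatio (by linarith : 0 < lam + 1) (by positivity : 0 < p * x * t)
  rw [add_sub_cancel_right] at h1
  have h2 : HasDerivAt (fun t : ℝ => p * x * t) (p * x) t := by
    simpa using (hasDerivAt_id t).const_mul (p * x)
  exact h1.comp t h2

theorem exp_neg_psi (hlam : -1 < lam) (hp : 1 ≤ p) {x t : ℝ} (hx : 0 < x) (ht : 0 < t) :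
    Real.exp (-psi lam p x t) = incGamma (lam + 1) (p * x * t) / Real.Gamma (lam + 1) := by
  have hp0 : 0 < p := by linarith
  have h1 := incGamma_pos (by linarith : 0 < lam + 1) (by positivity : 0 ≤ p * x * t)
  have h2 := Real.Gamma_pos_of_pos (by linarith : 0 < lam + 1)
  rw [Real.exp_neg, psi, Real.exp_log (by positivity), inv_div]

/-- Since `e^{-ψ}` is the normalized incomplete Gamma function, it cancels the denominator of `ψ'`.
What remains is a Gamma density: `ψ(x, ·)` transports it to the exponential law. -/
theorem abs_deriv_psi_smul (hlam : -1 < lam) (hp : 1 ≤ p) {x t : ℝ} (hx : 0 < x) (ht : 0 < t)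
    (b : ℝ → ℂ) :
    |(p * x * t) ^ lam * Real.exp (-(p * x * t)) / incGamma (lam + 1) (p * x * t) * (p * x)| •
      (b (beta lam p x (psi lam p x t)) * (Real.exp (-psi lam p x t) : ℂ)) =
    (((p * x) ^ (lam + 1) / Real.Gamma (lam + 1) : ℝ) : ℂ) *
      (b t * ((t ^ lam * Real.exp (-(p * x * t)) : ℝ) : ℂ)) := by
  have hp0 : 0 < p := by linarith
  have h1 := incGamma_pos (by linarith : 0 < lam + 1) (by positivity : 0 ≤ p * x * t)
  have h2 := Real.Gamma_pos_of_pos (by linarith : 0 < lam + 1)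
  rw [beta_psi hlam hp hx ht, exp_neg_psi hlam hp hx ht, abs_of_nonneg (by positivity), real_smul,
    Real.mul_rpow (by positivity) ht.le, Real.rpow_add_one (by positivity)]
  have h1' : (incGamma (lam + 1) (p * x * t) : ℂ) ≠ 0 := by exact_mod_cast h1.ne'
  have h2' : (Real.Gamma (lam + 1) : ℂ) ≠ 0 := by exact_mod_cast h2.ne'
  push_cast
  field_simp

theorem gammaIntegrand_mul (hp : 1 ≤ p) (b : ℝ → ℂ) (x : ℝ) {t : ℝ} (ht : 0 < t) :
    gammaIntegrand lam p b x (p * t) =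
      ((p ^ lam : ℝ) : ℂ) * (b t * ((t ^ lam * Real.exp (-(p * x * t)) : ℝ) : ℂ)) := by
  have hp0 : 0 < p := by linarith
  rw [gammaIntegrand, mul_div_cancel_left₀ _ hp0.ne', Real.mul_rpow hp0.le ht.le,
    show p * t * x = p * x * t by ring]
  push_cast
  ring

theorem integrableOn_gammaIntegrand_iff (hp : 1 ≤ p) (b : ℝ → ℂ) (x : ℝ) :
    IntegrableOn (gammaIntegrand lam p b x) (Ioi 0) ↔
      Integrable (fun t => b t * ((t ^ lam * Real.exp (-(p * x * t)) : ℝ) : ℂ)) volPos := by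
  have hp0 : 0 < p := by linarith
  have h := integrableOn_Ioi_comp_mul_left_iff (gammaIntegrand lam p b x) 0 hp0
  rw [mul_zero] at h
  rw [← h, integrableOn_congr_fun (s := Ioi 0)
    (fun t (ht : t ∈ Ioi (0 : ℝ)) => gammaIntegrand_mul hp b x ht) measurableSet_Ioi]
  have hne : ((p ^ lam : ℝ) : ℂ) ≠ 0 := by
    rw [Complex.ofReal_ne_zero]; positivity
  exact integrable_const_mul_iff (isUnit_iff_ne_zero.2 hne) _

theorem gammaSymbol_eq (hp : 1 ≤ p) (b : ℝ → ℂ) {x : ℝ} (hx : 0 < x) :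
    gammaSymbol lam p b x = (((p * x) ^ (lam + 1) / Real.Gamma (lam + 1) : ℝ) : ℂ) *
      ∫ t, b t * ((t ^ lam * Real.exp (-(p * x * t)) : ℝ) : ℂ) ∂volPos := by
  have hp0 : 0 < p := by linarith
  have h := integral_comp_mul_left_Ioi (gammaIntegrand lam p b x) 0 hp0
  rw [mul_zero, setIntegral_congr_fun measurableSet_Ioi
    (fun t ht => gammaIntegrand_mul hp b x ht), integral_const_mul] at h
  have h2 : ∫ t in Ioi (0 : ℝ), gammaIntegrand lam p b x t = (p : ℂ) * (((p ^ lam : ℝ) : ℂ) *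
      ∫ t, b t * ((t ^ lam * Real.exp (-(p * x * t)) : ℝ) : ℂ) ∂volPos) := by
    have hpc : (p : ℂ) ≠ 0 := by exact_mod_cast hp0.ne'
    rw [volPos, h, real_smul, Complex.ofReal_inv, mul_inv_cancel_left₀ hpc]
  rw [gammaSymbol, h2, Real.mul_rpow hp0.le hx.le, Real.rpow_add_one hp0.ne']
  push_cast
  ring

theorem integrableOn_comp_beta_iff (hlam : -1 < lam) (hp : 1 ≤ p) (b : ℝ → ℂ) {x : ℝ} (hx : 0 < x) :
    IntegrableOn (fun η => b (beta lam p x η) * (Real.exp (-η) : ℂ)) (Ioi 0) ↔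
      IntegrableOn (gammaIntegrand lam p b x) (Ioi 0) := by
  have hp0 : 0 < p := by linarith
  have h2 := Real.Gamma_pos_of_pos (by linarith : 0 < lam + 1)
  have h := integrableOn_image_iff_integrableOn_abs_deriv_smul measurableSet_Ioi
    (fun t ht => (hasDerivAt_psi hlam hp hx ht).hasDerivWithinAt) (injOn_psi hlam hp hx)
    (fun η => b (beta lam p x η) * (Real.exp (-η) : ℂ))
  rw [psi_image hlam hp hx] at h
  rw [h, integrableOn_congr_fun (s := Ioi 0)
    (fun t (ht : t ∈ Ioi (0 : ℝ)) => abs_deriv_psi_smul hlam hp hx ht b) measurableSet_Ioi,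
    integrableOn_gammaIntegrand_iff hp]
  have hne : (((p * x) ^ (lam + 1) / Real.Gamma (lam + 1) : ℝ) : ℂ) ≠ 0 := by
    rw [Complex.ofReal_ne_zero]; positivity
  exact integrable_const_mul_iff (isUnit_iff_ne_zero.2 hne) _

/-- The substitution `η = ψ(x, t)`; this is how `γ` arises from `β`. -/
theorem integral_comp_beta (hlam : -1 < lam) (hp : 1 ≤ p) (b : ℝ → ℂ) {x : ℝ} (hx : 0 < x) :
    ∫ η in Ioi (0 : ℝ), b (beta lam p x η) * (Real.exp (-η) : ℂ) = gammaSymbol lam p b x := by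
  have h := integral_image_eq_integral_abs_deriv_smul measurableSet_Ioi
    (fun t ht => (hasDerivAt_psi hlam hp hx ht).hasDerivWithinAt) (injOn_psi hlam hp hx)
    (fun η => b (beta lam p x η) * (Real.exp (-η) : ℂ))
  rw [psi_image hlam hp hx] at h
  rw [h, setIntegral_congr_fun measurableSet_Ioi
    (fun t ht => abs_deriv_psi_smul hlam hp hx ht b), integral_const_mul, gammaSymbol_eq hp b hx]
  rfl

/-- The exponential law has mass one. With this symbol, the Toeplitz computation shows that
`synthesis` is inverted by `R_λ`. -/
theorem gammaSymbol_one (hlam : -1 < lam) (hp : 1 ≤ p) {x : ℝ} (hx : 0 < x) :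
    gammaSymbol lam p (fun _ => 1) x = 1 := by
  rw [← integral_comp_beta hlam hp _ hx]
  simp only [one_mul]
  rw [integral_complex_ofReal, integral_exp_neg_Ioi_zero, ofReal_one]

theorem integrableOn_gammaIntegrand_one (hlam : -1 < lam) (hp : 1 ≤ p) {x : ℝ} (hx : 0 < x) :
    IntegrableOn (gammaIntegrand lam p (fun _ => 1) x) (Ioi 0) := by
  rw [← integrableOn_comp_beta_iff hlam hp _ hx]
  simp only [one_mul]
  exact (integrableOn_exp_neg_Ioi 0).ofReal

/-! ### The operator `U_λ` -/

/-- `U_2` evaluates its argument at `β`, so null sets must be controlled under this substitution.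
The exceptional set is pushed forward by `(x, y) ↦ (x, ψ(|x|, y))`, and a differentiable map sends
null sets to null sets; differentiability of `|x|` requires `x ≠ 0`. -/
theorem U2_congr (hlam : -1 < lam) (hp : 1 ≤ p) {Φ Ψ : ℝ → ℝ → ℂ}
    (h : Function.uncurry Φ =ᵐ[(volume : Measure ℝ).prod volPos] Function.uncurry Ψ) :
    Function.uncurry (U2 lam p Φ) =ᵐ[(volume : Measure ℝ).prod volPos]
      Function.uncurry (U2 lam p Ψ) := by
  have hp0 : 0 < p := by linarith
  have hx0 : ∀ᵐ w ∂((volume : Measure ℝ).prod volPos), w.1 ≠ 0 :=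
    Measure.quasiMeasurePreserving_fst.ae (Measure.ae_ne volume 0)
  have hy0 : ∀ᵐ w ∂((volume : Measure ℝ).prod volPos), 0 < w.2 :=
    Measure.quasiMeasurePreserving_snd.ae ae_volPos_pos
  let T : ℝ × ℝ → ℝ × ℝ := fun w => (w.1, psi lam p |w.1| w.2)
  let N : Set (ℝ × ℝ) := {w | w.1 ≠ 0 ∧ 0 < w.2 ∧ Function.uncurry Φ w ≠ Function.uncurry Ψ w}
  have hN : volume N = 0 := by
    rw [volPos, prod_restrict_eq, EventuallyEq,
      ae_restrict_iff' (MeasurableSet.univ.prod measurableSet_Ioi)] at h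
    refine measure_mono_null (fun w hw => ?_) h
    exact fun hw' => hw.2.2 (hw' ⟨mem_univ _, hw.2.1⟩)
  have hT : DifferentiableOn ℝ T N := by
    intro w hw
    refine DifferentiableAt.differentiableWithinAt ?_
    have hpos : 0 < p * |w.1| * w.2 := mul_pos (mul_pos hp0 (abs_pos.2 hw.1)) hw.2.1
    have h1 : DifferentiableAt ℝ (fun w : ℝ × ℝ => p * |w.1| * w.2) w :=
      (((differentiableAt_abs hw.1).comp w differentiableAt_fst).const_mul p).mul
        differentiableAt_snd
    have h2 : DifferentiableAt ℝ (fun w : ℝ × ℝ => logGammaRatio (lam + 1) (p * |w.1| * w.2)) w :=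
      DifferentiableAt.comp w (g := logGammaRatio (lam + 1))
        (f := fun w : ℝ × ℝ => p * |w.1| * w.2)
        (hasDerivAt_logGammaRatio (by linarith : 0 < lam + 1) hpos).differentiableAt h1
    exact differentiableAt_fst.prodMk h2
  have hTN : volume (T '' N) = 0 :=
    addHaar_image_eq_zero_of_differentiableOn_of_addHaar_eq_zero volume hT hN
  have hTN' : ∀ᵐ w ∂((volume : Measure ℝ).prod volPos), w ∉ T '' N := by
    rw [volPos, prod_restrict_eq]
    exact ae_restrict_of_ae (measure_eq_zero_iff_ae_notMem.1 hTN)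
  filter_upwards [hx0, hy0, hTN'] with w h1 h2 h3
  have hb := beta_pos hlam hp (abs_pos.2 h1) h2
  simp only [Function.uncurry, U2]
  congr 1
  by_contra h4
  exact h3 ⟨(w.1, beta lam p |w.1| w.2), ⟨h1, hb, h4⟩,
    Prod.ext rfl (psi_beta hlam hp (abs_pos.2 h1) h2)⟩

theorem U1_ae_eq {f : UpperHalfPlane → ℂ} {Φ : ℝ → ℝ → ℂ} (H : IsPartialFourier f Φ) :
    Function.uncurry (U1 f) =ᵐ[(volume : Measure ℝ).prod volPos]
      Function.uncurry fun ξ y => ((1 / Real.sqrt Real.pi : ℝ) : ℂ) * Φ ξ y := by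
  filter_upwards [partialFourier_ae_eq H] with w hw
  simp only [Function.uncurry, U1] at hw ⊢
  rw [hw]

/-- The factor `e^{x β} / θ` in `U_2` undoes the factor `θ e^{-x y}` of the density at `y = β`. -/
theorem U_mul_synthesis (hlam : -1 < lam) (hp : 1 ≤ p) (hq : 1 ≤ q)
    (hφ : MemLp φ (ENNReal.ofReal q) volPos) {b : ℝ → ℂ}
    (hb : LocallyIntegrableOn b (Ioi 0) volume) :
    Function.uncurry (U lam p fun z => b z.im * synthesis lam p φ z)
      =ᵐ[(volume : Measure ℝ).prod volPos]
      fun w => (Ioi (0 : ℝ)).indicator φ w.1 * b (beta lam p w.1 w.2) * (ell p w.2 : ℂ) := by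
  have h1 := U2_congr hlam hp (U1_ae_eq (isPartialFourier_mul_synthesis hlam hp hq hφ hb))
  filter_upwards [h1] with w hw
  rw [U, hw]
  simp only [Function.uncurry, U2, fourierDensity]
  by_cases hx : w.1 ∈ Ioi (0 : ℝ)
  · have hx0 : 0 < w.1 := hx
    have ht := theta_pos hlam hp hx0
    have hpi : 0 < Real.sqrt Real.pi := Real.sqrt_pos.2 Real.pi_pos
    rw [indicator_of_mem hx, indicator_of_mem hx, abs_of_pos hx0, ell, Real.exp_add]
    have e : Real.exp (w.1 * beta lam p w.1 w.2) * Real.exp (-(w.1 * beta lam p w.1 w.2)) = 1 := by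
      rw [← Real.exp_add]; simp
    have e' : (Real.exp (w.1 * beta lam p w.1 w.2) : ℂ) *
        (Real.exp (-(w.1 * beta lam p w.1 w.2)) : ℂ) = 1 := by
      rw [← Complex.ofReal_mul, e, ofReal_one]
    have ht' : (theta lam p w.1 : ℂ) ≠ 0 := by exact_mod_cast ht.ne'
    have hpi' : (Real.sqrt Real.pi : ℂ) ≠ 0 := by exact_mod_cast hpi.ne'
    push_cast at e' ⊢
    field_simp
    linear_combination (φ w.1 * b (beta lam p w.1 w.2)) * e'
  · rw [indicator_of_notMem hx, indicator_of_notMem hx]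
    simp

theorem ell_mul_ell_rpow (hp : 1 ≤ p) (y : ℝ) : ell p y * ell p y ^ (p - 1) = Real.exp (-y) := by
  have hp0 : 0 < p := by linarith
  rw [ell, ← Real.exp_mul, ← Real.exp_add]
  congr 1
  field_simp
  ring

theorem ae_slice_U_mul_synthesis (hlam : -1 < lam) (hp : 1 ≤ p) (hq : 1 ≤ q)
    (hφ : MemLp φ (ENNReal.ofReal q) volPos) {b : ℝ → ℂ}
    (hb : LocallyIntegrableOn b (Ioi 0) volume) :
    ∀ᵐ x ∂volPos, (fun η => U lam p (fun z => b z.im * synthesis lam p φ z) x η *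
      ((ell p η ^ (p - 1) : ℝ) : ℂ)) =ᵐ[volPos]
      fun η => φ x * (b (beta lam p x η) * (Real.exp (-η) : ℂ)) := by
  have h := Measure.ae_ae_of_ae_prod (U_mul_synthesis hlam hp hq hφ hb)
  filter_upwards [ae_restrict_of_ae h, ae_volPos_pos] with x hx hx0
  filter_upwards [hx] with η hη
  simp only [Function.uncurry] at hη
  rw [hη, indicator_of_mem (mem_Ioi.2 hx0), ← ell_mul_ell_rpow hp η]
  push_cast
  ring

theorem ropConverges_mul_synthesis (hlam : -1 < lam) (hp : 1 ≤ p) (hq : 1 ≤ q)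
    (hφ : MemLp φ (ENNReal.ofReal q) volPos) {b : ℝ → ℂ}
    (hb : LocallyIntegrableOn b (Ioi 0) volume)
    (hb' : ∀ x > 0, IntegrableOn (gammaIntegrand lam p b x) (Ioi 0)) :
    RopConverges lam p fun z => b z.im * synthesis lam p φ z := by
  filter_upwards [ae_slice_U_mul_synthesis hlam hp hq hφ hb, ae_volPos_pos] with x hx hx0
  exact (((integrableOn_comp_beta_iff hlam hp b hx0).2 (hb' x hx0)).const_mul (φ x)).congr hx.symm

theorem Rop_mul_synthesis (hlam : -1 < lam) (hp : 1 ≤ p) (hq : 1 ≤ q)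
    (hφ : MemLp φ (ENNReal.ofReal q) volPos) {b : ℝ → ℂ}
    (hb : LocallyIntegrableOn b (Ioi 0) volume) :
    Rop lam p (fun z => b z.im * synthesis lam p φ z) =ᵐ[volPos]
      fun x => gammaSymbol lam p b x * φ x := by
  filter_upwards [ae_slice_U_mul_synthesis hlam hp hq hφ hb, ae_volPos_pos] with x hx hx0
  rw [Rop, R0inv, indicator_of_mem (mem_Ioi.2 hx0)]
  have := integral_congr_ae hx
  rw [volPos] at this
  rw [this, integral_const_mul, integral_comp_beta hlam hp b hx0, mul_comm]

theorem locallyIntegrableOn_one : LocallyIntegrableOn (fun _ : ℝ => (1 : ℂ)) (Ioi 0) volume :=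
  (locallyIntegrable_const (1 : ℂ)).locallyIntegrableOn _

theorem U_synthesis (hlam : -1 < lam) (hp : 1 ≤ p) (hq : 1 ≤ q)
    (hφ : MemLp φ (ENNReal.ofReal q) volPos) :
    Function.uncurry (U lam p (synthesis lam p φ)) =ᵐ[(volume : Measure ℝ).prod volPos]
      fun w => (Ioi (0 : ℝ)).indicator φ w.1 * (ell p w.2 : ℂ) := by
  have := U_mul_synthesis hlam hp hq hφ locallyIntegrableOn_one
  simpa only [one_mul, mul_one] using this

theorem ropConverges_synthesis (hlam : -1 < lam) (hp : 1 ≤ p) (hq : 1 ≤ q)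
    (hφ : MemLp φ (ENNReal.ofReal q) volPos) : RopConverges lam p (synthesis lam p φ) := by
  have := ropConverges_mul_synthesis hlam hp hq hφ locallyIntegrableOn_one
    fun x hx => integrableOn_gammaIntegrand_one hlam hp hx
  simpa only [one_mul] using this

theorem Rop_synthesis (hlam : -1 < lam) (hp : 1 ≤ p) (hq : 1 ≤ q)
    (hφ : MemLp φ (ENNReal.ofReal q) volPos) : Rop lam p (synthesis lam p φ) =ᵐ[volPos] φ := by
  have := Rop_mul_synthesis hlam hp hq hφ locallyIntegrableOn_one
  simp only [one_mul] at this
  filter_upwards [this, ae_volPos_pos] with x hx hx0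
  rw [hx, gammaSymbol_one hlam hp hx0, one_mul]

/-! ### Symbols -/

theorem MemL1exp.locallyIntegrableOn {a : ℝ → ℂ} (ha : MemL1exp a) :
    LocallyIntegrableOn a (Ioi 0) volume := by
  rw [locallyIntegrableOn_iff isOpen_Ioi.isLocallyClosed]
  intro K hK hKc
  have h1 := ((ha 1 one_pos).mono_set hK).mul_continuousOn
    (g' := fun y : ℝ => (Real.exp y : ℂ)) (by fun_prop) hKc
  refine h1.congr (.of_forall fun y => ?_)
  simp only
  rw [mul_assoc, ← Complex.ofReal_mul, ← Real.exp_add]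
  simp

/-- For `λ ≥ 0`, half of the exponential absorbs the power. For `λ < 0` the power is unbounded only
near `0`, where integrability is assumed; beyond `δ` it is at most `δ^λ`. -/
theorem MemL1exp.integrable_rpow_mul_exp {a : ℝ → ℂ} (ha : MemL1exp a)
    (ha0 : lam < 0 → ∃ δ > 0, IntegrableOn (fun y => a y * ((y ^ lam : ℝ) : ℂ)) (Ioo 0 δ))
    {c : ℝ} (hc : 0 < c) :
    Integrable (fun t => a t * ((t ^ lam * Real.exp (-(c * t)) : ℝ) : ℂ)) volPos := by
  have hexp : Measurable fun t : ℝ => Real.exp (-(c * t)) := by fun_prop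
  rcases le_or_gt 0 lam with h | h
  · obtain ⟨C, hC⟩ := exists_rpow_mul_exp_le h (half_pos hc)
    have h1 : Integrable _ volPos := ha (c / 2) (half_pos hc)
    have hm : Measurable fun t : ℝ => (Ioi (0 : ℝ)).indicator (fun t => t ^ lam *
      Real.exp (-(t * (c / 2)))) t := Measurable.indicator (by fun_prop) measurableSet_Ioi
    refine (h1.mul_bdd (c := max C 0) (Complex.measurable_ofReal.comp hm).aestronglyMeasurable
      (.of_forall fun t => ?_)).congr ?_
    · simp only [Function.comp]
      rw [Complex.norm_real]
      by_cases ht : t ∈ Ioi (0 : ℝ)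
      · have ht0 : 0 < t := ht
        rw [indicator_of_mem ht, Real.norm_of_nonneg (by positivity)]
        exact (hC t ht).trans (le_max_left _ _)
      · rw [indicator_of_notMem ht, norm_zero]
        exact le_max_right _ _
    · filter_upwards [ae_volPos_pos] with t ht
      simp only [Function.comp]
      rw [indicator_of_mem (mem_Ioi.2 ht), mul_assoc, ← Complex.ofReal_mul]
      congr 2
      rw [mul_left_comm, ← Real.exp_add]
      congr 2
      ring
  · obtain ⟨δ, hδ, hi⟩ := ha0 h
    have h1 : IntegrableOn (fun t => a t * ((t ^ lam * Real.exp (-(c * t)) : ℝ) : ℂ)) (Ioo 0 δ) := by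
      refine (Integrable.mul_bdd (c := 1) (g := fun t : ℝ => (Real.exp (-(c * t)) : ℂ)) hi
        (Complex.measurable_ofReal.comp hexp).aestronglyMeasurable ?_).congr
        (.of_forall fun t => ?_)
      · filter_upwards [ae_restrict_mem measurableSet_Ioo] with t ht
        rw [Complex.norm_real, Real.norm_of_nonneg (Real.exp_pos _).le, Real.exp_le_one_iff]
        nlinarith [mul_pos hc ht.1]
      · simp only
        push_cast
        ring
    have h2 : IntegrableOn (fun t => a t * ((t ^ lam * Real.exp (-(c * t)) : ℝ) : ℂ)) (Ici δ) := by
      have h3 : IntegrableOn _ (Ici δ) := (ha c hc).mono_set fun t ht => hδ.trans_le ht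
      refine (Integrable.mul_bdd (c := δ ^ lam) (g := fun t : ℝ => ((t ^ lam : ℝ) : ℂ)) h3
        (Measurable.aestronglyMeasurable (by fun_prop)) ?_).congr (.of_forall fun t => ?_)
      · filter_upwards [ae_restrict_mem measurableSet_Ici] with t ht
        have ht0 : 0 < t := hδ.trans_le ht
        rw [Complex.norm_real, Real.norm_of_nonneg (by positivity)]
        exact Real.rpow_le_rpow_of_nonpos hδ ht h.le
      · simp only
        push_cast
        ring
    have h3 := h1.union h2
    rwa [Ioo_union_Ici_eq_Ioi hδ] at h3

theorem MemL1exp.integrableOn_gammaIntegrand (hp : 1 ≤ p) {a : ℝ → ℂ} (ha : MemL1exp a)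
    (ha0 : lam < 0 → ∃ δ > 0, IntegrableOn (fun y => a y * ((y ^ lam : ℝ) : ℂ)) (Ioo 0 δ))
    {x : ℝ} (hx : 0 < x) : IntegrableOn (gammaIntegrand lam p a x) (Ioi 0) := by
  have hp0 : 0 < p := by linarith
  rw [integrableOn_gammaIntegrand_iff hp]
  exact ha.integrable_rpow_mul_exp ha0 (by positivity)

/-- Both sides of the projection equation are a function of `x` times `e^{-y/p}`: the functions are
`ψ` and `γ φ`. Existence of the transform and convergence hold for every `φ`, so the domain
condition is exactly that `γ φ` be in `L^q`. -/
theorem isToeplitz_synthesis_iff (hlam : -1 < lam) (hp : 1 ≤ p) (hq : 1 ≤ q) {a : ℝ → ℂ}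
    (ha : LocallyIntegrableOn a (Ioi 0) volume)
    (ha' : ∀ x > 0, IntegrableOn (gammaIntegrand lam p a x) (Ioi 0)) {ψ : ℝ → ℂ}
    (hφ : MemLp φ (ENNReal.ofReal q) volPos) (hψ : MemLp ψ (ENNReal.ofReal q) volPos) :
    IsToeplitz lam q p a (synthesis lam p φ) (synthesis lam p ψ) ↔
      ψ =ᵐ[volPos] fun x => gammaSymbol lam p a x * φ x := by
  have hR := Rop_mul_synthesis hlam hp hq hφ ha
  have hR' : ∀ᵐ x : ℝ, 0 < x → Rop lam p (fun z => a z.im * synthesis lam p φ z) x =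
      gammaSymbol lam p a x * φ x := by
    rw [volPos, EventuallyEq, ae_restrict_iff' measurableSet_Ioi] at hR
    exact hR
  have hR'' := Measure.quasiMeasurePreserving_fst (μ := (volume : Measure ℝ)) (ν := volPos) |>.ae hR'
  have hU := U_synthesis hlam hp hq hψ
  have hell : ∀ y, (ell p y : ℂ) ≠ 0 := fun y => by
    rw [Complex.ofReal_ne_zero]; exact (Real.exp_pos _).ne'
  constructor
  · intro H
    have h := H.proj.eq
    have h2 : ∀ᵐ x : ℝ, 0 < x → ψ x = gammaSymbol lam p a x * φ x := by
      refine ae_of_ae_prod_fst ?_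
      filter_upwards [h, hU, hR''] with w h1 h2 h3 hx
      rw [h1] at h2
      simp only [Function.uncurry, R0, indicator_of_mem (mem_Ioi.2 hx)] at h2
      rw [← h3 hx]
      exact (mul_right_cancel₀ (hell _) h2).symm
    rw [volPos, EventuallyEq, ae_restrict_iff' measurableSet_Ioi]
    exact h2
  · intro h
    refine ⟨memBergman_synthesis hlam hp hq hφ, ⟨⟨_, isPartialFourier_mul_synthesis hlam hp hq hφ ha⟩,
      ropConverges_mul_synthesis hlam hp hq hφ ha ha', memBergman_synthesis hlam hp hq hψ, ?_⟩⟩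
    have h' : ∀ᵐ x : ℝ, 0 < x → ψ x = gammaSymbol lam p a x * φ x := by
      rw [volPos, EventuallyEq, ae_restrict_iff' measurableSet_Ioi] at h
      exact h
    have h'' := Measure.quasiMeasurePreserving_fst (μ := (volume : Measure ℝ)) (ν := volPos) |>.ae h'
    filter_upwards [hU, hR'', h''] with w h1 h2 h3
    rw [h1]
    simp only [Function.uncurry, R0]
    by_cases hx : w.1 ∈ Ioi (0 : ℝ)
    · rw [indicator_of_mem hx, indicator_of_mem hx, h3 hx, ← h2 hx]
      rfl
    · rw [indicator_of_notMem hx, indicator_of_notMem hx]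

/-! ### The norm and the integral formulas -/

theorem mixedNorm_const_mul (hq : 1 ≤ q) (c : ℂ) (Φ : ℝ → ℝ → ℂ) :
    mixedNorm lam q p (fun ξ y => c * Φ ξ y) = ‖c‖ₑ * mixedNorm lam q p Φ := by
  have hq0 : 0 < q := by linarith
  have e : ∀ ξ, eLpNorm (fun y => c * Φ ξ y) (ENNReal.ofReal p) (nu lam) =
      ‖c‖ₑ * eLpNorm (Φ ξ) (ENNReal.ofReal p) (nu lam) := fun ξ =>
    eLpNorm_const_smul c (Φ ξ) _ _
  simp only [mixedNorm, e]
  simp only [ENNReal.mul_rpow_of_nonneg _ _ hq0.le]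
  rw [lintegral_const_mul' _ _ (ENNReal.rpow_ne_top_of_nonneg hq0.le enorm_ne_top),
    ENNReal.mul_rpow_of_nonneg _ _ (by positivity), ← ENNReal.rpow_mul,
    mul_one_div_cancel hq0.ne', ENNReal.rpow_one]

theorem fourierMixedNorm_synthesis (hlam : -1 < lam) (hp : 1 ≤ p) (hq : 1 ≤ q)
    (hφ : MemLp φ (ENNReal.ofReal q) volPos) :
    fourierMixedNorm lam q p (synthesis lam p φ) = eLpNorm φ (ENNReal.ofReal q) volPos := by
  have hpi : 0 < Real.sqrt Real.pi := Real.sqrt_pos.2 Real.pi_pos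
  rw [fourierMixedNorm, mixedNorm_congr (U1_ae_eq (isPartialFourier_synthesis hlam hp hq hφ)),
    mixedNorm_const_mul hq, mixedNorm_fourierDensity hlam hp hq, ← mul_assoc, ← ofReal_norm,
    Complex.norm_real, Real.norm_of_nonneg (by positivity), ← ENNReal.ofReal_mul (by positivity),
    one_div_mul_cancel hpi.ne', ENNReal.ofReal_one, one_mul]

theorem fourierDensity_of_pos {x : ℝ} (hx : 0 < x) (y : ℝ) :
    fourierDensity lam p φ x y =
      ((Real.sqrt Real.pi * theta lam p x : ℝ) : ℂ) * φ x * (Real.exp (-(x * y)) : ℂ) := by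
  rw [fourierDensity, indicator_of_mem (mem_Ioi.2 hx)]

theorem U1_synthesis_slice (hlam : -1 < lam) (hp : 1 ≤ p) (hq : 1 ≤ q)
    (hφ : MemLp φ (ENNReal.ofReal q) volPos) :
    ∀ᵐ x ∂volPos, (fun η => U1 (synthesis lam p φ) x η * (Real.exp (-((p - 1) * x * η)) : ℂ))
      =ᵐ[nu lam] fun η => (theta lam p x : ℂ) * φ x * (Real.exp (-(p * x * η)) : ℂ) := by
  have hpi : 0 < Real.sqrt Real.pi := Real.sqrt_pos.2 Real.pi_pos
  have hpi' : (Real.sqrt Real.pi : ℂ) ≠ 0 := by exact_mod_cast hpi.ne'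
  have h := Measure.ae_ae_of_ae_prod (U1_ae_eq (isPartialFourier_synthesis hlam hp hq hφ))
  filter_upwards [ae_restrict_of_ae h, ae_volPos_pos] with x hx hx0
  filter_upwards [(nu_absolutelyContinuous lam).ae_le hx] with η hη
  simp only [Function.uncurry] at hη
  rw [hη, fourierDensity_of_pos hx0]
  have e : (Real.exp (-(p * x * η)) : ℂ) =
      (Real.exp (-(x * η)) : ℂ) * (Real.exp (-((p - 1) * x * η)) : ℂ) := by
    rw [← Complex.ofReal_mul, ← Real.exp_add]
    congr 2
    ring
  rw [e]
  push_cast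
  field_simp

/-- `θ` is by design the number for which `θ e^{-x η}` has norm one in `L^p(ν_λ)`. -/
theorem theta_rpow_mul_integral (hlam : -1 < lam) (hp : 1 ≤ p) {x : ℝ} (hx : 0 < x) :
    ((theta lam p x ^ (p - 1) : ℝ) : ℂ) * ((theta lam p x : ℂ) *
      ∫ η, (Real.exp (-(p * x * η)) : ℂ) ∂(nu lam)) = 1 := by
  have hp0 : 0 < p := by linarith
  have ht := theta_pos hlam hp hx
  have hg : 0 < Real.Gamma (lam + 2) := Real.Gamma_pos_of_pos (by linarith)
  rw [integral_exp_nu hlam (by positivity), ← mul_assoc, ← Complex.ofReal_mul,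
    ← Real.rpow_add_one ht.ne', sub_add_cancel, theta_rpow hlam hp hx, ← Complex.ofReal_mul,
    div_mul_div_cancel₀ (by positivity), div_self (by positivity), Complex.ofReal_one]

theorem eq_integral_U1_synthesis (hlam : -1 < lam) (hp : 1 ≤ p) (hq : 1 ≤ q)
    (hφ : MemLp φ (ENNReal.ofReal q) volPos) :
    ∀ᵐ x ∂volPos,
      Integrable (fun η : ℝ => U1 (synthesis lam p φ) x η *
        (Real.exp (-((p - 1) * x * η)) : ℂ)) (nu lam) ∧
      φ x = ((theta lam p x ^ (p - 1) : ℝ) : ℂ) * ∫ η : ℝ, U1 (synthesis lam p φ) x η *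
        (Real.exp (-((p - 1) * x * η)) : ℂ) ∂(nu lam) := by
  have hp0 : 0 < p := by linarith
  filter_upwards [U1_synthesis_slice hlam hp hq hφ, ae_volPos_pos] with x hx hx0
  refine ⟨((integrable_exp_nu hlam (by positivity)).const_mul _).congr hx.symm, ?_⟩
  rw [integral_congr_ae hx, integral_const_mul]
  linear_combination (-φ x) * theta_rpow_mul_integral hlam hp hx0

/-- Iterated null sets need not be null for the product without measurability, so the argument
passes through measurable representatives. -/
theorem ae_ae_swap_of_eq {f g : ℝ × ℝ → ℂ} {μ ν : Measure ℝ} [SFinite μ] [SFinite ν]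
    (hf : AEStronglyMeasurable f (μ.prod ν)) (hg : AEStronglyMeasurable g (μ.prod ν))
    (h : ∀ᵐ y ∂ν, ∀ᵐ x ∂μ, f (x, y) = g (x, y)) : f =ᵐ[μ.prod ν] g := by
  have hm : MeasurableSet {w | hf.mk f w = hg.mk g w} :=
    measurableSet_eq_fun hf.stronglyMeasurable_mk.measurable hg.stronglyMeasurable_mk.measurable
  have hsw : ∀ {k l : ℝ × ℝ → ℂ}, k =ᵐ[μ.prod ν] l → ∀ᵐ y ∂ν, ∀ᵐ x ∂μ, k (x, y) = l (x, y) := by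
    intro k l hkl
    have h1 : ∀ᵐ w ∂(ν.prod μ), k w.swap = l w.swap :=
      Measure.measurePreserving_swap.quasiMeasurePreserving.ae hkl
    exact Measure.ae_ae_of_ae_prod h1
  have h1 : ∀ᵐ y ∂ν, ∀ᵐ x ∂μ, hf.mk f (x, y) = hg.mk g (x, y) := by
    filter_upwards [h, hsw hf.ae_eq_mk, hsw hg.ae_eq_mk] with y h1 h2 h3
    filter_upwards [h1, h2, h3] with x h1 h2 h3
    rw [← h2, ← h3, h1]
  have h2 : ∀ᵐ w ∂(μ.prod ν), hf.mk f w = hg.mk g w := by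
    refine (Measure.ae_prod_iff_ae_ae hm).2 ?_
    exact (Measure.ae_ae_comm (p := fun x y => hf.mk f (x, y) = hg.mk g (x, y)) hm).2 h1
  filter_upwards [h2, hf.ae_eq_mk, hg.ae_eq_mk] with w h1 h2 h3
  rw [h2, h3, h1]

theorem aestronglyMeasurable_synthesis_pt (hlam : -1 < lam) (hp : 1 ≤ p) (hq : 1 ≤ q)
    (hφ : MemLp φ (ENNReal.ofReal q) volPos) :
    AEStronglyMeasurable (fun w : ℝ × ℝ => synthesis lam p φ (pt w.1 w.2))
      ((volume : Measure ℝ).prod (nu lam)) := by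
  have h1 : AEStronglyMeasurable (fun w : ℝ × ℝ => synthesis lam p φ (pt w.1 w.2))
      ((volume : Measure ℝ).prod volPos) := by
    rw [volPos, prod_restrict_eq]
    exact (continuousOn_comp_pt (differentiableOn_synthesis hlam hp hq hφ)).aestronglyMeasurable
      (MeasurableSet.univ.prod measurableSet_Ioi)
  exact h1.mono_ac (Measure.AbsolutelyContinuous.rfl.prod (nu_absolutelyContinuous lam))

/-- For `ω = ξ + iη`, `-i x ω̄ = -i x ξ - x η`, so the real exponents add up to `-(p - 1) x η` and
the rest is a Fourier kernel in `ξ`. -/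
theorem areaIntegrand_eq (f : UpperHalfPlane → ℂ) (x : ℝ) (w : ℝ × ℝ) :
    areaIntegrand p f x w = (Real.exp (-((p - 1) * x * w.2)) : ℂ) *
      (Complex.exp (I * w.1 * ((-x : ℝ) : ℂ)) * f (pt w.1 w.2)) := by
  have : Complex.exp (-(I * (x : ℂ) * (starRingEnd ℂ) ((w.1 : ℂ) + (w.2 : ℂ) * I))) *
      ((Real.exp (-(x * (p - 2) * w.2)) : ℝ) : ℂ) = (Real.exp (-((p - 1) * x * w.2)) : ℂ) *
      Complex.exp (I * w.1 * ((-x : ℝ) : ℂ)) := by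
    rw [Complex.ofReal_exp, Complex.ofReal_exp, ← Complex.exp_add, ← Complex.exp_add]
    congr 1
    simp only [map_add, map_mul, Complex.conj_ofReal, Complex.conj_I]
    push_cast
    linear_combination (x * w.2 : ℂ) * I_mul_I
  rw [areaIntegrand, mul_assoc, this]
  ring

theorem integrable_mu_iff {E : Type*} [NormedAddCommGroup E] (f : ℝ × ℝ → E) :
    Integrable f (mu lam) ↔ Integrable f ((volume : Measure ℝ).prod (nu lam)) := by
  rw [mu]
  have h : ENNReal.ofReal (1 / Real.pi) ≠ 0 := by
    simpa using Real.pi_pos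
  exact integrable_smul_measure h ENNReal.ofReal_ne_top

theorem integral_mu (f : ℝ × ℝ → ℂ) : ∫ w, f w ∂(mu lam) =
    ((1 / Real.pi : ℝ) : ℂ) * ∫ w, f w ∂((volume : Measure ℝ).prod (nu lam)) := by
  rw [mu, integral_smul_measure, ENNReal.toReal_ofReal (by have := Real.pi_pos; positivity),
    real_smul]

theorem sqrt_two_pi_mul_invFourier (h : ℝ → ℂ) (x : ℝ) :
    ((Real.sqrt (2 * Real.pi) : ℝ) : ℂ) * invFourier h x = ∫ u : ℝ, Complex.exp (I * u * x) * h u := by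
  have hpi : 0 < Real.sqrt (2 * Real.pi) := Real.sqrt_pos.2 (by positivity)
  rw [invFourier, ← mul_assoc, ← Complex.ofReal_mul, mul_one_div_cancel hpi.ne', ofReal_one,
    one_mul]

/-- If almost every horizontal slice of `R_λ⁻¹ φ` is integrable, then the Fourier transform in the
first variable is given by an integral. -/
theorem ae_integral_exp_mul_synthesis (hlam : -1 < lam) (hp : 1 ≤ p) (hq : 1 ≤ q)
    (hφ : MemLp φ (ENNReal.ofReal q) volPos)
    (h : ∀ᵐ η ∂(nu lam), Integrable fun t => synthesis lam p φ (pt t η)) :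
    (fun w : ℝ × ℝ => ∫ t : ℝ, Complex.exp (I * t * ((-w.1 : ℝ) : ℂ)) *
        synthesis lam p φ (pt t w.2)) =ᵐ[(volume : Measure ℝ).prod (nu lam)]
      fun w => ((Real.sqrt (2 * Real.pi) : ℝ) : ℂ) * fourierDensity lam p φ w.1 w.2 := by
  refine ae_ae_swap_of_eq ?_ ((aestronglyMeasurable_fourierDensity hφ.1 _).const_mul _) ?_
  · refine AEStronglyMeasurable.integral_prod_right'
      (f := fun v : (ℝ × ℝ) × ℝ => Complex.exp (I * v.2 * ((-v.1.1 : ℝ) : ℂ)) *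
        synthesis lam p φ (pt v.2 v.1.2)) ?_
    refine (Continuous.aestronglyMeasurable (by fun_prop)).mul ?_
    refine (aestronglyMeasurable_synthesis_pt hlam hp hq hφ).comp_quasiMeasurePreserving
      (f := fun v : (ℝ × ℝ) × ℝ => (v.2, v.1.2)) ?_
    exact (Measure.measurePreserving_swap.quasiMeasurePreserving).comp
      (QuasiMeasurePreserving.prodMap Measure.quasiMeasurePreserving_snd
        (Measure.QuasiMeasurePreserving.id _))
  -- On such a slice the density and its inverse transform are both integrable, so `L¹` inversion
  -- applies.
  · filter_upwards [h, ae_nu_pos lam] with η hη hη0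
    have hs : (fun t => synthesis lam p φ (pt t η)) =
        invFourier (fun ξ => fourierDensity lam p φ ξ η) :=
      funext (synthesis_pt hlam hp φ hη0)
    rw [hs] at hη
    have := invFourier_invFourier_ae (integrable_fourierDensity hlam hp hq hφ hη0) hη
    have h2 := (Measure.measurePreserving_neg (volume : Measure ℝ)).quasiMeasurePreserving.ae this
    filter_upwards [h2] with x hx
    rw [neg_neg] at hx
    rw [← hx, sqrt_two_pi_mul_invFourier]
    exact integral_congr_ae (.of_forall fun t => by simp only [synthesis_pt hlam hp φ hη0])

/-- On a horizontal line the integrand differs from `f` by a unimodular factor and a nonzero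
constant. -/
theorem ae_integrable_of_integrable_areaIntegrand {f : UpperHalfPlane → ℂ} {x : ℝ}
    (h : Integrable (areaIntegrand p f x) (mu lam)) :
    ∀ᵐ η ∂(nu lam), Integrable fun t => f (pt t η) := by
  have h1 := ((integrable_mu_iff _).1 h).prod_left_ae
  filter_upwards [h1] with η hη
  simp only [areaIntegrand_eq] at hη
  have h2 := hη.const_mul ((Real.exp ((p - 1) * x * η) : ℝ) : ℂ)
  refine (h2.bdd_mul (c := 1) (f := fun t : ℝ => Complex.exp (I * t * (x : ℂ)))
    (Continuous.aestronglyMeasurable (by fun_prop)) (.of_forall fun t => ?_)).congr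
    (.of_forall fun t => ?_)
  · rw [norm_cexp_I_mul]
    simp
  · simp only
    have e1 : ((Real.exp ((p - 1) * x * η) : ℝ) : ℂ) * (Real.exp (-((p - 1) * x * η)) : ℂ) = 1 := by
      rw [← Complex.ofReal_mul, ← Real.exp_add]
      simp
    have e2 : Complex.exp (I * t * (x : ℂ)) * Complex.exp (I * t * ((-x : ℝ) : ℂ)) = 1 := by
      rw [← Complex.exp_add]
      simp
    linear_combination f (pt t η) * (Complex.exp (I * t * (x : ℂ)) *
      Complex.exp (I * t * ((-x : ℝ) : ℂ))) * e1 + f (pt t η) * e2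

theorem eq_integral_areaIntegrand_synthesis (hlam : -1 < lam) (hp : 1 ≤ p) (hq : 1 ≤ q)
    (hφ : MemLp φ (ENNReal.ofReal q) volPos) :
    ∀ᵐ x ∂volPos, Integrable (areaIntegrand p (synthesis lam p φ) x) (mu lam) →
      φ x = ((1 / Real.sqrt 2 * theta lam p x ^ (p - 1) : ℝ) : ℂ) *
        ∫ w, areaIntegrand p (synthesis lam p φ) x w ∂(mu lam) := by
  -- Integrability at a single `x₀` makes almost every slice integrable, a condition that does not
  -- involve `x`; one null set of `x` then serves throughout.
  by_cases hex : ∃ x, Integrable (areaIntegrand p (synthesis lam p φ) x) (mu lam)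
  swap
  · exact .of_forall fun x hx => (hex ⟨x, hx⟩).elim
  obtain ⟨x₀, hx₀⟩ := hex
  have h := Measure.ae_ae_of_ae_prod (ae_integral_exp_mul_synthesis hlam hp hq hφ
    (ae_integrable_of_integrable_areaIntegrand hx₀))
  filter_upwards [ae_restrict_of_ae h, ae_volPos_pos] with x hx hx0 hint
  rw [integral_mu, integral_prod_symm _ ((integrable_mu_iff _).1 hint)]
  have e : (fun η => ∫ t, areaIntegrand p (synthesis lam p φ) x (t, η)) =ᵐ[nu lam]
      fun η => ((Real.sqrt (2 * Real.pi) * Real.sqrt Real.pi : ℝ) : ℂ) * φ x *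
        (theta lam p x) * (Real.exp (-(p * x * η)) : ℂ) := by
    filter_upwards [hx] with η hη
    simp only [areaIntegrand_eq]
    rw [integral_const_mul, hη, fourierDensity_of_pos hx0]
    have e : (Real.exp (-(p * x * η)) : ℂ) =
        (Real.exp (-(x * η)) : ℂ) * (Real.exp (-((p - 1) * x * η)) : ℂ) := by
      rw [← Complex.ofReal_mul, ← Real.exp_add]
      congr 2
      ring
    rw [e]
    push_cast
    ring
  rw [integral_congr_ae e, integral_const_mul]
  have hc : (1 / Real.sqrt 2) * (1 / Real.pi) * (Real.sqrt (2 * Real.pi) * Real.sqrt Real.pi) = 1 := by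
    rw [Real.sqrt_mul (by norm_num), mul_assoc (Real.sqrt 2), Real.mul_self_sqrt Real.pi_pos.le]
    have := Real.pi_pos
    field_simp
  have hc' := congrArg (fun r : ℝ => (r : ℂ)) hc
  have ht := theta_rpow_mul_integral hlam hp hx0
  push_cast at hc' ht ⊢
  linear_combination (-φ x) * hc' - φ x * (1 / (Real.sqrt 2 : ℂ) * (1 / (Real.pi : ℂ)) *
    ((Real.sqrt (2 * Real.pi) : ℂ) * (Real.sqrt Real.pi : ℂ))) * ht

/-! ### The Bergman kernel -/

/-- With this density and `p = q = 1`, the regularized Laplace integral becomes a case of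
`synthesis`, whose holomorphy is known. -/
theorem memLp_exp_neg {ε : ℝ} (hε : 0 < ε) :
    MemLp (fun u : ℝ => (Real.exp (-(ε * u)) : ℂ)) (ENNReal.ofReal 1) volPos := by
  rw [ENNReal.ofReal_one, memLp_one_iff_integrable]
  have : Integrable (fun u : ℝ => Real.exp (-(ε * u))) volPos :=
    (integrable_rpow_mul_exp (by norm_num : (-1 : ℝ) < 0) hε).congr
      (.of_forall fun u => by simp only [Real.rpow_zero, one_mul, mul_comm u ε])
  exact this.ofReal

theorem integral_rpow_mul_cexp_of_real {r : ℝ} (hlam : -1 < lam) (hr : 0 < r) :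
    ∫ u : ℝ, ((u ^ (lam + 1) : ℝ) : ℂ) * Complex.exp (-(r * u)) ∂volPos =
      (Real.Gamma (lam + 2) : ℂ) * (r : ℂ) ^ (-((lam + 2 : ℝ) : ℂ)) := by
  have h := Complex.integral_cpow_mul_exp_neg_mul_Ioi (a := ((lam + 2 : ℝ) : ℂ))
    (by rw [Complex.ofReal_re]; linarith) hr
  have harg : (r : ℂ).arg ≠ Real.pi := by
    rw [Complex.arg_ofReal_of_nonneg hr.le]; exact Real.pi_pos.ne
  rw [one_div, Complex.inv_cpow _ _ harg, ← Complex.cpow_neg, Complex.Gamma_ofReal] at h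
  rw [mul_comm, ← h, volPos]
  refine setIntegral_congr_fun measurableSet_Ioi fun u (hu : 0 < u) => ?_
  rw [Complex.ofReal_cpow hu.le]
  congr 2
  push_cast
  ring

/-- Both sides are holomorphic and agree on the positive imaginary axis by the real Gamma integral;
the identity theorem does the rest. -/
theorem integral_exp_mul_rpow_mul_cexp (hlam : -1 < lam) {ε : ℝ} (hε : 0 < ε) :
    EqOn (fun z : ℂ => ∫ u : ℝ, (Real.exp (-(ε * u)) : ℂ) * ((u ^ ((lam + 1) / 1) : ℝ) : ℂ) *
        Complex.exp (I * u * z) ∂volPos)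
      (fun z => (Real.Gamma (lam + 2) : ℂ) * ((ε : ℂ) - I * z) ^ (-((lam + 2 : ℝ) : ℂ)))
      {z : ℂ | 0 < z.im} := by
  have hopen : IsOpen {z : ℂ | 0 < z.im} := isOpen_lt continuous_const Complex.continuous_im
  have hg : 0 < Real.Gamma (lam + 2) := Real.Gamma_pos_of_pos (by linarith)
  have h1 : DifferentiableOn ℂ (fun z : ℂ => ∫ u : ℝ, (Real.exp (-(ε * u)) : ℂ) *
      ((u ^ ((lam + 1) / 1) : ℝ) : ℂ) * Complex.exp (I * u * z) ∂volPos) {z : ℂ | 0 < z.im} := by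
    have hs := differentiableOn_synthesis hlam le_rfl le_rfl (memLp_exp_neg hε)
    have hc : (1 ^ ((lam + 1) / 1) / (Real.sqrt 2 * (2 ^ lam * Real.Gamma (lam + 2)) ^ (1 / (1 : ℝ)))) ≠
        (0 : ℝ) := by positivity
    refine (hs.const_mul (((1 ^ ((lam + 1) / 1) / (Real.sqrt 2 *
      (2 ^ lam * Real.Gamma (lam + 2)) ^ (1 / (1 : ℝ))) : ℝ) : ℂ)⁻¹)).congr fun z hz => ?_
    simp only [synthesis]
    rw [inv_mul_cancel_left₀ (Complex.ofReal_ne_zero.2 hc),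
      UpperHalfPlane.ofComplex_apply_of_im_pos hz]
  have h2 : DifferentiableOn ℂ (fun z : ℂ => (Real.Gamma (lam + 2) : ℂ) *
      ((ε : ℂ) - I * z) ^ (-((lam + 2 : ℝ) : ℂ))) {z : ℂ | 0 < z.im} := by
    intro z hz
    have hz0 : 0 < z.im := hz
    refine DifferentiableAt.differentiableWithinAt ?_
    refine DifferentiableAt.const_mul (DifferentiableAt.cpow (by fun_prop) (by fun_prop) ?_) _
    left
    simp
    linarith
  have hI : ((Complex.I : ℂ)) ∈ {z : ℂ | 0 < z.im} := by simp
  have hconv : IsPreconnected {z : ℂ | 0 < z.im} :=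
    (convex_halfSpace_im_gt 0).isPreconnected
  refine (h1.analyticOnNhd hopen).eqOn_of_preconnected_of_frequently_eq (h2.analyticOnNhd hopen)
    hconv hI ?_
  -- Points of the imaginary axis accumulating at `i`.
  have ht : Tendsto (fun n : ℕ => ((1 + 1 / ((n : ℝ) + 1) : ℝ) : ℂ) * I) atTop (𝓝[≠] I) := by
    refine tendsto_nhdsWithin_iff.2 ⟨?_, .of_forall fun n => ?_⟩
    · have h3 : Tendsto (fun n : ℕ => (1 + 1 / ((n : ℝ) + 1) : ℝ)) atTop (𝓝 (1 + 0)) :=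
        tendsto_const_nhds.add tendsto_one_div_add_atTop_nhds_zero_nat
      have h4 := ((Complex.continuous_ofReal.tendsto _).comp h3).mul_const I
      simpa using h4
    · intro h
      have h5 := congrArg Complex.im h
      simp only [Complex.mul_im, Complex.ofReal_re, Complex.ofReal_im, Complex.I_im, Complex.I_re] at h5
      have : 0 < 1 / ((n : ℝ) + 1) := by positivity
      linarith
  refine ht.frequently (Frequently.of_forall fun n => ?_)
  have hy : 0 < 1 + 1 / ((n : ℝ) + 1) := by positivity
  set y := 1 + 1 / ((n : ℝ) + 1)
  have h6 := integral_rpow_mul_cexp_of_real hlam (add_pos hε hy)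
  have h7 : (ε : ℂ) - I * ((y : ℂ) * I) = ((ε + y : ℝ) : ℂ) := by
    push_cast
    linear_combination (-y : ℂ) * I_mul_I
  rw [h7, ← h6]
  refine integral_congr_ae (.of_forall fun u => ?_)
  simp only [div_one]
  have h8 : (Real.exp (-(ε * u)) : ℂ) * Complex.exp (I * u * ((y : ℂ) * I)) =
      Complex.exp (-(((ε + y : ℝ) : ℂ) * u)) := by
    rw [Complex.ofReal_exp, ← Complex.exp_add]
    congr 1
    push_cast
    linear_combination (u * y : ℂ) * I_mul_I
  rw [← h8]
  ring

/-- The regularization is removed by taking `ε = Im w / 2` and `z = w - iε`, which is still in the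
half-plane. -/
theorem integral_rpow_mul_cexp (hlam : -1 < lam) {w : ℂ} (hw : 0 < w.im) :
    ∫ u : ℝ, ((u ^ (lam + 1) : ℝ) : ℂ) * Complex.exp (I * u * w) ∂volPos =
      (Real.Gamma (lam + 2) : ℂ) * (-(I * w)) ^ (-((lam + 2 : ℝ) : ℂ)) := by
  have h := integral_exp_mul_rpow_mul_cexp hlam (half_pos hw)
    (x := w - ((w.im / 2 : ℝ) : ℂ) * I) (by simp; linarith)
  simp only at h
  have e1 : ((w.im / 2 : ℝ) : ℂ) - I * (w - ((w.im / 2 : ℝ) : ℂ) * I) = -(I * w) := by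
    linear_combination ((w.im / 2 : ℝ) : ℂ) * I_mul_I
  rw [e1] at h
  rw [← h]
  refine integral_congr_ae (.of_forall fun u => ?_)
  simp only [div_one]
  have e2 : (Real.exp (-(w.im / 2 * u)) : ℂ) *
      Complex.exp (I * u * (w - ((w.im / 2 : ℝ) : ℂ) * I)) = Complex.exp (I * u * w) := by
    rw [Complex.ofReal_exp, ← Complex.exp_add]
    congr 1
    push_cast
    linear_combination (-(u * (w.im / 2)) : ℂ) * I_mul_I
  rw [← e2]
  ring

/-- Write `w = i r` with `Re r > 0`: the arguments of `i` and `r` add up to a value in `(0, π)`, so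
principal powers multiply, and `i^{2+s} = -i^s` accounts for the sign. -/
theorem neg_I_cpow_mul_one_div {w : ℂ} (hw : 0 < w.im) (s : ℝ) :
    -(I ^ (s : ℂ)) * (1 / w ^ ((2 + s : ℝ) : ℂ)) = (-(I * w)) ^ (-((s + 2 : ℝ) : ℂ)) := by
  set r : ℂ := -(I * w) with hr
  have hre : 0 < r.re := by simpa [hr] using hw
  have hr0 : r ≠ 0 := fun h => by simp [h] at hre
  have hwr : w = I * r := by rw [hr]; linear_combination w * I_mul_I
  have harg := abs_lt.1 (Complex.abs_arg_lt_pi_div_two_iff.2 (Or.inl hre))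
  have hlog : Complex.log (I * r) = Complex.log I + Complex.log r := by
    refine Complex.log_mul I_ne_zero hr0 ?_
    rw [Complex.arg_I]
    constructor <;> linarith [harg.1, harg.2, Real.pi_pos]
  have h1 : w ^ ((2 + s : ℝ) : ℂ) = I ^ ((2 + s : ℝ) : ℂ) * r ^ ((2 + s : ℝ) : ℂ) := by
    rw [hwr, Complex.cpow_def_of_ne_zero (mul_ne_zero I_ne_zero hr0), hlog,
      Complex.cpow_def_of_ne_zero I_ne_zero, Complex.cpow_def_of_ne_zero hr0, ← Complex.exp_add,
      add_mul]
  have h2 : I ^ ((2 + s : ℝ) : ℂ) = -(I ^ (s : ℂ)) := by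
    rw [Complex.ofReal_add, Complex.cpow_add _ _ I_ne_zero]
    have : I ^ ((2 : ℝ) : ℂ) = -1 := by
      rw [Complex.ofReal_ofNat, Complex.cpow_ofNat, Complex.I_sq]
    rw [this]
    ring
  have h3 : I ^ (s : ℂ) ≠ 0 := by simp [Complex.cpow_eq_zero_iff]
  have h4 : r ^ ((2 + s : ℝ) : ℂ) ≠ 0 := by simp [Complex.cpow_eq_zero_iff, hr0]
  rw [h1, h2, Complex.cpow_neg, add_comm s 2]
  field_simp

/-- The function whose image under `R_λ⁻¹`, for `p = 2`, gives the Bergman kernel. -/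
def kernelDensity (lam : ℝ) (z : UpperHalfPlane) (u : ℝ) : ℂ :=
  ((theta lam 2 u / (2 * Real.sqrt Real.pi) : ℝ) : ℂ) * Complex.exp (I * u * z)

theorem theta_two_sq (hlam : -1 < lam) {x : ℝ} (hx : 0 < x) :
    theta lam 2 x * theta lam 2 x = 2 * x ^ (lam + 1) / Real.Gamma (lam + 2) := by
  have hg : 0 < Real.Gamma (lam + 2) := Real.Gamma_pos_of_pos (by linarith)
  have h := theta_rpow hlam one_le_two hx
  rw [Real.rpow_two, sq, Real.mul_rpow (by norm_num) hx.le, Real.rpow_add_one (by norm_num)] at h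
  rw [h]
  have : (0 : ℝ) < 2 ^ lam := by positivity
  field_simp

/-- For `w = x + iy`, `z - w̄ = z + (-x + iy)`, so `e^{iu(z - w̄)}` factors into a function of `z`
and the synthesis kernel at the reflected point. -/
theorem bergmanKernel_pt (hlam : -1 < lam) (z : UpperHalfPlane) (x : ℝ) {y : ℝ} (hy : 0 < y) :
    bergmanKernel lam z (pt x y) =
      ((Real.sqrt (2 * Real.pi) : ℝ) : ℂ) * synthesis lam 2 (kernelDensity lam z) (pt (-x) y) := by
  have hg : 0 < Real.Gamma (lam + 2) := Real.Gamma_pos_of_pos (by linarith)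
  have hpi : 0 < Real.sqrt Real.pi := Real.sqrt_pos.2 Real.pi_pos
  set w : ℂ := (z : ℂ) - (starRingEnd ℂ) (pt x y : ℂ) with hw
  have hw' : w = z + (-x : ℝ) + y * I := by
    rw [hw, coe_pt hy]
    simp only [map_add, map_mul, Complex.conj_ofReal, Complex.conj_I]
    push_cast
    ring
  have hwim : 0 < w.im := by
    have := z.im_pos
    rw [hw']
    simp
    linarith
  have h1 := integral_rpow_mul_cexp hlam hwim
  rw [← neg_I_cpow_mul_one_div hwim] at h1
  have h2 : bergmanKernel lam z (pt x y) = ((1 / Real.Gamma (lam + 2) : ℝ) : ℂ) *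
      ∫ u : ℝ, ((u ^ (lam + 1) : ℝ) : ℂ) * Complex.exp (I * u * w) ∂volPos := by
    rw [h1, ← mul_assoc, ← Complex.ofReal_mul, one_div_mul_cancel hg.ne', Complex.ofReal_one,
      one_mul]
    rfl
  rw [h2, synthesis, ← integral_const_mul, ← integral_const_mul, ← integral_const_mul]
  refine integral_congr_ae ?_
  filter_upwards [ae_volPos_pos] with u hu
  have e1 : Complex.exp (I * u * w) = Complex.exp (I * u * z) * Complex.exp (I * u * pt (-x) y) := by
    rw [← Complex.exp_add, hw', coe_pt hy]
    congr 1
    ring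
  rw [kernelDensity, e1]
  have e2 : 1 / Real.Gamma (lam + 2) * u ^ (lam + 1) = Real.sqrt (2 * Real.pi) *
      (2 ^ ((lam + 1) / 2) / (Real.sqrt 2 * (2 ^ lam * Real.Gamma (lam + 2)) ^ (1 / (2 : ℝ))) *
        (theta lam 2 u / (2 * Real.sqrt Real.pi) * u ^ ((lam + 1) / 2))) := by
    have h3 := theta_eq hlam one_le_two hu
    have h4 := theta_two_sq hlam hu
    have h5 : 2 ^ ((lam + 1) / 2) / (Real.sqrt 2 * (2 ^ lam * Real.Gamma (lam + 2)) ^ (1 / (2 : ℝ))) *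
        (theta lam 2 u / (2 * Real.sqrt Real.pi) * u ^ ((lam + 1) / 2)) =
        theta lam 2 u / (Real.sqrt 2 * (2 * Real.sqrt Real.pi)) * (2 ^ ((lam + 1) / 2) /
          (2 ^ lam * Real.Gamma (lam + 2)) ^ (1 / (2 : ℝ)) * u ^ ((lam + 1) / 2)) := by
      field_simp
    have h6 : Real.sqrt 2 ≠ 0 := by positivity
    rw [h5, ← h3, div_mul_eq_mul_div (theta lam 2 u), h4, Real.sqrt_mul (by norm_num)]
    field_simp
  have e2' := congrArg (fun r : ℝ => (r : ℂ)) e2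
  simp only [Complex.ofReal_mul] at e2' ⊢
  linear_combination (Complex.exp (I * u * z) * Complex.exp (I * u * pt (-x) y)) * e2'

theorem memLp_kernelDensity (hlam : -1 < lam) (z : UpperHalfPlane) :
    MemLp (kernelDensity lam z) (ENNReal.ofReal 2) volPos := by
  have hg : 0 < Real.Gamma (lam + 2) := Real.Gamma_pos_of_pos (by linarith)
  have hpi : 0 < Real.sqrt Real.pi := Real.sqrt_pos.2 Real.pi_pos
  have hm : AEStronglyMeasurable (kernelDensity lam z) volPos := by
    refine Measurable.aestronglyMeasurable ?_
    unfold kernelDensity theta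
    fun_prop
  rw [ENNReal.ofReal_ofNat, memLp_two_iff_integrable_sq_norm hm]
  have h1 := (integrable_rpow_mul_exp (by linarith : -1 < lam + 1)
    (mul_pos two_pos z.im_pos)).const_mul
      (2 / Real.Gamma (lam + 2) / (2 * Real.sqrt Real.pi * (2 * Real.sqrt Real.pi)))
  refine h1.congr ?_
  filter_upwards [ae_volPos_pos] with u hu
  have ht := theta_pos hlam one_le_two hu
  rw [kernelDensity, norm_mul, norm_cexp_I_mul, Complex.norm_real,
    Real.norm_of_nonneg (by positivity), mul_pow, sq (_ / _), div_mul_div_comm, theta_two_sq hlam hu,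
    ← Real.exp_nat_mul, UpperHalfPlane.coe_im]
  have : Real.exp (((2 : ℕ) : ℝ) * -(u * z.im)) = Real.exp (-(u * (2 * z.im))) := by
    congr 1; push_cast; ring
  rw [this]
  field_simp

/-- The kernel decays in `x` like a power of exponent `2 + λ > 1`. Integrability on lines is what
permits pointwise inversion in `integral_synthesis_mul_bergmanKernel`. -/
theorem integrable_bergmanKernel_pt (hlam : -1 < lam) (z : UpperHalfPlane) {y : ℝ} (hy : 0 < y) :
    Integrable fun x => bergmanKernel lam z (pt x y) := by
  have hcont : Continuous fun x => bergmanKernel lam z (pt x y) := by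
    have h1 := continuous_invFourier
      (integrable_fourierDensity hlam one_le_two one_le_two (memLp_kernelDensity hlam z) hy)
    have h2 : (fun x => bergmanKernel lam z (pt x y)) = fun x =>
        ((Real.sqrt (2 * Real.pi) : ℝ) : ℂ) *
          invFourier (fun ξ => fourierDensity lam 2 (kernelDensity lam z) ξ y) (-x) := by
      ext x
      rw [bergmanKernel_pt hlam z x hy, synthesis_pt hlam one_le_two _ hy]
    rw [h2]
    fun_prop
  -- Chosen so that `|z - w̄|² = (x - Re z)² + (Im z + y)²` is at least `m² (1 + (x - Re z)²)`.
  set m : ℝ := min 1 (z.im + y) with hm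
  have hm0 : 0 < m := lt_min one_pos (by have := z.im_pos; linarith)
  have h3 := (integrable_rpow_neg_one_add_norm_sq (E := ℝ) (μ := volume) (r := 2 + lam)
    (by simp; linarith)).comp_sub_right z.re
  refine (h3.const_mul (‖-(I ^ (lam : ℂ))‖ * m ^ (-(2 + lam)))).mono' hcont.aestronglyMeasurable
    (.of_forall fun x => ?_)
  have h4 : m * Real.sqrt (1 + ‖x - z.re‖ ^ 2) ≤ ‖(z : ℂ) - (starRingEnd ℂ) (pt x y : ℂ)‖ := by
    rw [coe_pt hy, Complex.norm_def, Complex.normSq_apply]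
    refine Real.le_sqrt_of_sq_le ?_
    rw [mul_pow, Real.sq_sqrt (by positivity), Real.norm_eq_abs, sq_abs]
    simp only [map_add, map_mul, Complex.conj_ofReal, Complex.conj_I, Complex.sub_re,
      Complex.sub_im, Complex.add_re, Complex.add_im, Complex.mul_re, Complex.mul_im,
      Complex.ofReal_re, Complex.ofReal_im, Complex.neg_re, Complex.neg_im, Complex.I_re,
      Complex.I_im, UpperHalfPlane.coe_re, UpperHalfPlane.coe_im]
    have h5 : m ^ 2 ≤ 1 := pow_le_one₀ hm0.le (min_le_left _ _)
    have h6 : m ^ 2 ≤ (z.im + y) ^ 2 := pow_le_pow_left₀ hm0.le (min_le_right _ _) 2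
    nlinarith [mul_le_mul_of_nonneg_right h5 (sq_nonneg (x - z.re))]
  have h7 : 0 < Real.sqrt (1 + ‖x - z.re‖ ^ 2) := Real.sqrt_pos.2 (by positivity)
  rw [bergmanKernel, norm_mul, one_div, norm_inv, Complex.norm_cpow_real, mul_assoc,
    ← Real.rpow_neg (norm_nonneg _)]
  refine mul_le_mul_of_nonneg_left ?_ (norm_nonneg _)
  calc ‖(z : ℂ) - (starRingEnd ℂ) (pt x y : ℂ)‖ ^ (-(2 + lam))
      ≤ (m * Real.sqrt (1 + ‖x - z.re‖ ^ 2)) ^ (-(2 + lam)) :=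
        Real.rpow_le_rpow_of_nonpos (by positivity) h4 (by linarith)
    _ = m ^ (-(2 + lam)) * (1 + ‖x - z.re‖ ^ 2) ^ (-(2 + lam) / 2) := by
        rw [Real.mul_rpow hm0.le h7.le, Real.sqrt_eq_rpow, ← Real.rpow_mul (by positivity)]
        congr 2
        ring

/-! ### Hilbert space estimates -/

theorem eLpNorm_two_sq {α : Type*} [MeasurableSpace α] (f : α → ℂ) (μ : Measure α) :
    eLpNorm f 2 μ ^ 2 = ∫⁻ x, ‖f x‖ₑ ^ 2 ∂μ := by
  have := eLpNorm_nnreal_pow_eq_lintegral (f := f) (μ := μ) (p := 2) two_ne_zero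
  simpa using this

theorem memLp_ofReal_two_iff {f : ℝ → ℂ} {μ : Measure ℝ} :
    MemLp f (ENNReal.ofReal 2) μ ↔ MemLp f 2 μ := by
  rw [ENNReal.ofReal_ofNat]

theorem memLp_two_iff_lintegral {α : Type*} [MeasurableSpace α] {f : α → ℂ} {μ : Measure α}
    (hf : AEStronglyMeasurable f μ) : MemLp f 2 μ ↔ ∫⁻ x, ‖f x‖ₑ ^ 2 ∂μ < ⊤ := by
  rw [← eLpNorm_two_sq, ENNReal.pow_lt_top_iff]
  simp [MemLp, hf]

theorem gammaSymbol_eq_integral_nu (hlam : -1 < lam) (hp : 1 ≤ p) (b : ℝ → ℂ) {x : ℝ} (hx : 0 < x) :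
    gammaSymbol lam p b x = ((theta lam p x ^ p : ℝ) : ℂ) *
      ∫ η, b η * (Real.exp (-(p * x * η)) : ℂ) ∂(nu lam) := by
  have hp0 : 0 < p := by linarith
  have hg : 0 < Real.Gamma (lam + 1) := Real.Gamma_pos_of_pos (by linarith)
  have hl : 0 < lam + 1 := by linarith
  have e : ∫ η, b η * (Real.exp (-(p * x * η)) : ℂ) ∂(nu lam) = (((lam + 1) * 2 ^ lam : ℝ) : ℂ) *
      ∫ t, b t * ((t ^ lam * Real.exp (-(p * x * t)) : ℝ) : ℂ) ∂volPos := by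
    rw [integral_nu hlam, ← integral_const_mul]
    refine integral_congr_ae ?_
    filter_upwards [ae_volPos_pos] with t ht
    rw [Real.mul_rpow (by norm_num) ht.le]
    push_cast
    ring
  rw [gammaSymbol_eq hp b hx, e, ← mul_assoc, ← Complex.ofReal_mul, theta_rpow hlam hp hx,
    show lam + 2 = (lam + 1) + 1 by ring, Real.Gamma_add_one hl.ne']
  congr 3
  have : (0 : ℝ) < 2 ^ lam := by positivity
  field_simp

theorem memLp_fourierDensity_slice (hlam : -1 < lam) (hp : 1 ≤ p) (hφ : MemLp φ 2 volPos) {y : ℝ}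
    (hy : 0 < y) : MemLp (fun ξ => fourierDensity lam p φ ξ y) 2 := by
  have hs : 0 ≤ (lam + 1) / p := div_nonneg (by linarith) (by linarith)
  have hg : 0 < Real.Gamma (lam + 2) := Real.Gamma_pos_of_pos (by linarith)
  have hp0 : 0 < p := by linarith
  obtain ⟨C, hC⟩ := exists_rpow_mul_exp_le hs hy
  have e : (fun ξ => fourierDensity lam p φ ξ y) = (Ioi (0 : ℝ)).indicator
      (fun ξ => ((Real.sqrt Real.pi * theta lam p ξ : ℝ) : ℂ) * φ ξ * (Real.exp (-(ξ * y)) : ℂ)) := by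
    ext ξ
    simp only [fourierDensity, indicator]
    split_ifs <;> simp
  rw [e, memLp_indicator_iff_restrict measurableSet_Ioi]
  set D : ℝ := p ^ ((lam + 1) / p) / (2 ^ lam * Real.Gamma (lam + 2)) ^ (1 / p) with hD
  have hD0 : 0 < D := by positivity
  refine MemLp.of_le_mul (g := φ) (c := Real.sqrt Real.pi * D * C) hφ ?_ ?_
  · refine (AEStronglyMeasurable.mul (Measurable.aestronglyMeasurable ?_) hφ.1).mul
      (Measurable.aestronglyMeasurable ?_)
    · unfold theta
      fun_prop
    · fun_prop
  · filter_upwards [ae_restrict_mem measurableSet_Ioi] with ξ hξ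
    have hξ0 : 0 < ξ := hξ
    have ht := theta_pos hlam hp hξ0
    rw [norm_mul, norm_mul, Complex.norm_real, Complex.norm_real,
      Real.norm_of_nonneg (Real.exp_pos _).le, Real.norm_of_nonneg (by positivity),
      theta_eq hlam hp hξ0, ← hD]
    calc Real.sqrt Real.pi * (D * ξ ^ ((lam + 1) / p)) * ‖φ ξ‖ * Real.exp (-(ξ * y))
        = Real.sqrt Real.pi * D * (ξ ^ ((lam + 1) / p) * Real.exp (-(ξ * y))) * ‖φ ξ‖ := by ring
      _ ≤ _ := by gcongr; exact hC ξ hξ0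

theorem lintegral_synthesis_slice (hlam : -1 < lam) (hp : 1 ≤ p) (hφ : MemLp φ 2 volPos) {y : ℝ}
    (hy : 0 < y) : ∫⁻ x, ‖synthesis lam p φ (pt x y)‖ₑ ^ 2 =
      ∫⁻ ξ, ‖fourierDensity lam p φ ξ y‖ₑ ^ 2 := by
  simp only [synthesis_pt hlam hp φ hy]
  exact eLpNorm_invFourier (integrable_fourierDensity hlam hp one_le_two
    (by rwa [ENNReal.ofReal_ofNat]) hy) (memLp_fourierDensity_slice hlam hp hφ hy)

/-- Plancherel on each line, where `b(y)` is a constant, and then Tonelli. -/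
theorem memLp_mul_synthesis_iff (hlam : -1 < lam) (hp : 1 ≤ p) (hφ : MemLp φ 2 volPos) {b : ℝ → ℂ}
    (hb : AEStronglyMeasurable b (nu lam)) :
    MemLp (fun w : ℝ × ℝ => b w.2 * synthesis lam p φ (pt w.1 w.2)) 2
        ((volume : Measure ℝ).prod (nu lam)) ↔
      MemLp (fun w : ℝ × ℝ => b w.2 * fourierDensity lam p φ w.1 w.2) 2
        ((volume : Measure ℝ).prod (nu lam)) := by
  have hb' : AEStronglyMeasurable (fun w : ℝ × ℝ => b w.2) ((volume : Measure ℝ).prod (nu lam)) :=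
    hb.comp_quasiMeasurePreserving Measure.quasiMeasurePreserving_snd
  have m1 := hb'.mul (aestronglyMeasurable_synthesis_pt hlam hp one_le_two
    (by rwa [ENNReal.ofReal_ofNat] : MemLp φ (ENNReal.ofReal 2) volPos))
  have m2 := hb'.mul (aestronglyMeasurable_fourierDensity (lam := lam) (p := p) hφ.1 (nu lam))
  have e1 := lintegral_prod_symm _ (m1.enorm.pow_const 2)
  have e2 := lintegral_prod_symm _ (m2.enorm.pow_const 2)
  have key : ∫⁻ w : ℝ × ℝ, ‖b w.2 * synthesis lam p φ (pt w.1 w.2)‖ₑ ^ 2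
      ∂((volume : Measure ℝ).prod (nu lam)) = ∫⁻ w : ℝ × ℝ, ‖b w.2 * fourierDensity lam p φ w.1 w.2‖ₑ ^ 2
      ∂((volume : Measure ℝ).prod (nu lam)) := by
    refine e1.trans (Eq.trans ?_ e2.symm)
    refine lintegral_congr_ae ?_
    filter_upwards [ae_nu_pos lam] with y hy
    have hne : ‖b y‖ₑ ^ 2 ≠ ⊤ := ENNReal.pow_ne_top enorm_ne_top
    simp only [Pi.mul_apply, Function.uncurry, enorm_mul, mul_pow]
    rw [lintegral_const_mul' _ _ hne, lintegral_const_mul' _ _ hne,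
      lintegral_synthesis_slice hlam hp hφ hy]
  refine (memLp_two_iff_lintegral m1).trans (Iff.trans ?_ (memLp_two_iff_lintegral m2).symm)
  exact iff_of_eq (congrArg (· < ⊤) key)

theorem memLp_two_mu_iff (f : ℝ × ℝ → ℂ) :
    MemLp f 2 (mu lam) ↔ MemLp f 2 ((volume : Measure ℝ).prod (nu lam)) := by
  have h0 : ENNReal.ofReal (1 / Real.pi) ≠ 0 := by simpa using Real.pi_pos
  constructor
  · intro h
    have := h.smul_measure (c := (ENNReal.ofReal (1 / Real.pi))⁻¹) (ENNReal.inv_ne_top.2 h0)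
    rwa [mu, smul_smul, ENNReal.inv_mul_cancel h0 ENNReal.ofReal_ne_top, one_smul] at this
  · intro h
    exact h.smul_measure ENNReal.ofReal_ne_top

theorem memLp_fourierDensity (hlam : -1 < lam) (hφ : MemLp φ 2 volPos) :
    MemLp (fun w : ℝ × ℝ => fourierDensity lam 2 φ w.1 w.2) 2
      ((volume : Measure ℝ).prod (nu lam)) := by
  have hm := aestronglyMeasurable_fourierDensity (lam := lam) (p := 2) hφ.1 (nu lam)
  have h := mixedNorm_fourierDensity hlam one_le_two one_le_two (q := 2) φ
  have h2 : mixedNorm lam 2 2 (fourierDensity lam 2 φ) < ⊤ := by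
    rw [h, ENNReal.ofReal_ofNat]
    exact ENNReal.mul_lt_top ENNReal.ofReal_lt_top hφ.2
  rw [mixedNorm_lt_top_iff one_le_two] at h2
  refine (memLp_two_iff_lintegral hm).2 ?_
  rw [lintegral_prod _ (hm.enorm.pow_const 2)]
  refine lt_of_eq_of_lt (lintegral_congr fun ξ => ?_) h2
  rw [ENNReal.ofReal_ofNat, ENNReal.rpow_two, eLpNorm_two_sq]
  rfl

theorem gammaSymbol_mul_eq (hlam : -1 < lam) (b φ : ℝ → ℂ) {x : ℝ} (hx : 0 < x) :
    gammaSymbol lam 2 b x * φ x = ((1 / Real.sqrt Real.pi * theta lam 2 x : ℝ) : ℂ) *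
      ∫ η, b η * fourierDensity lam 2 φ x η * (Real.exp (-(x * η)) : ℂ) ∂(nu lam) := by
  have hpi : 0 < Real.sqrt Real.pi := Real.sqrt_pos.2 Real.pi_pos
  have e : ∫ η, b η * fourierDensity lam 2 φ x η * (Real.exp (-(x * η)) : ℂ) ∂(nu lam) =
      ((Real.sqrt Real.pi * theta lam 2 x : ℝ) : ℂ) * φ x *
        ∫ η, b η * (Real.exp (-(2 * x * η)) : ℂ) ∂(nu lam) := by
    rw [← integral_const_mul]
    refine integral_congr_ae (.of_forall fun η => ?_)
    have e : (Real.exp (-(2 * x * η)) : ℂ) =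
        (Real.exp (-(x * η)) : ℂ) * (Real.exp (-(x * η)) : ℂ) := by
      rw [← Complex.ofReal_mul, ← Real.exp_add]
      congr 2
      ring
    simp only
    rw [fourierDensity_of_pos hx, e]
    ring
  have hc : 1 / Real.sqrt Real.pi * theta lam 2 x * (Real.sqrt Real.pi * theta lam 2 x) =
      theta lam 2 x ^ (2 : ℝ) := by
    rw [Real.rpow_two]
    field_simp
  rw [gammaSymbol_eq_integral_nu hlam one_le_two b hx, e, ← hc]
  push_cast
  ring

/-- Cauchy–Schwarz: `γ_b(x) φ(x)` is `π^{-1/2}` times the pairing of `b` times the density with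
`θ(x) e^{-x η}`, a unit vector of `L²(ν_λ)`. -/
theorem enorm_gammaSymbol_mul_le (hlam : -1 < lam) {b φ : ℝ → ℂ} {x : ℝ} (hx : 0 < x)
    (hm : AEStronglyMeasurable (fun η => b η * fourierDensity lam 2 φ x η) (nu lam)) :
    ‖gammaSymbol lam 2 b x * φ x‖ₑ ^ 2 ≤ ENNReal.ofReal (1 / Real.sqrt Real.pi) ^ 2 *
      ∫⁻ η, ‖b η * fourierDensity lam 2 φ x η‖ₑ ^ 2 ∂(nu lam) := by
  have hpi : 0 < Real.sqrt Real.pi := Real.sqrt_pos.2 Real.pi_pos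
  have ht := theta_pos hlam one_le_two hx
  rw [← eLpNorm_two_sq, ← mul_pow]
  refine pow_le_pow_left' ?_ 2
  have h1 : gammaSymbol lam 2 b x * φ x = ∫ η, ((fun η : ℝ =>
      ((1 / Real.sqrt Real.pi * theta lam 2 x : ℝ) : ℂ) * (Real.exp (-(x * η)) : ℂ)) •
        fun η => b η * fourierDensity lam 2 φ x η) η ∂(nu lam) := by
    rw [gammaSymbol_mul_eq hlam b φ hx, ← integral_const_mul]
    refine integral_congr_ae (.of_forall fun η => ?_)
    simp only [Pi.smul_apply', smul_eq_mul]
    ring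
  rw [h1]
  refine (enorm_integral_le_lintegral_enorm _).trans ?_
  rw [← eLpNorm_one_eq_lintegral_enorm]
  refine (eLpNorm_smul_le_mul_eLpNorm (p := 2) (q := 2) (r := 1) hm
    (Continuous.aestronglyMeasurable (by fun_prop))).trans (le_of_eq ?_)
  have h2 := eLpNorm_mul_exp hlam one_le_two ((1 / Real.sqrt Real.pi * theta lam 2 x : ℝ) : ℂ) x
  rw [ENNReal.ofReal_ofNat, if_pos hx] at h2
  rw [h2, ← ofReal_norm, Complex.norm_real, Real.norm_of_nonneg (by positivity),
    ← ENNReal.ofReal_mul (by positivity), mul_assoc, mul_one_div_cancel ht.ne', mul_one]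

/-- This puts `f` in the domain of the Toeplitz operator when `a f` is square integrable, even if
`γ_a` is unbounded. -/
theorem memLp_gammaSymbol_mul (hlam : -1 < lam) {b : ℝ → ℂ}
    (hb : MemLp (fun w : ℝ × ℝ => b w.2 * fourierDensity lam 2 φ w.1 w.2) 2
        ((volume : Measure ℝ).prod (nu lam))) :
    MemLp (fun x => gammaSymbol lam 2 b x * φ x) 2 volPos := by
  have hm : AEStronglyMeasurable (fun x => gammaSymbol lam 2 b x * φ x) volPos := by
    have h1 : AEStronglyMeasurable (fun x : ℝ =>
        ∫ η, b η * fourierDensity lam 2 φ x η * (Real.exp (-(x * η)) : ℂ) ∂(nu lam)) volume :=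
      AEStronglyMeasurable.integral_prod_right' (f := fun w : ℝ × ℝ =>
        b w.2 * fourierDensity lam 2 φ w.1 w.2 * (Real.exp (-(w.1 * w.2)) : ℂ))
        (hb.1.mul (Continuous.aestronglyMeasurable (by fun_prop)))
    have h2 : AEStronglyMeasurable (fun x : ℝ =>
        ((1 / Real.sqrt Real.pi * theta lam 2 x : ℝ) : ℂ)) volPos := by
      refine Measurable.aestronglyMeasurable ?_
      unfold theta
      fun_prop
    refine (h2.mul h1.restrict).congr ?_
    filter_upwards [ae_volPos_pos] with x hx
    exact (gammaSymbol_mul_eq hlam b φ hx).symm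
  rw [memLp_two_iff_lintegral hm]
  have h1 : ∀ᵐ x ∂volPos, ‖gammaSymbol lam 2 b x * φ x‖ₑ ^ 2 ≤
      ENNReal.ofReal (1 / Real.sqrt Real.pi) ^ 2 *
        ∫⁻ η, ‖b η * fourierDensity lam 2 φ x η‖ₑ ^ 2 ∂(nu lam) := by
    filter_upwards [ae_volPos_pos, ae_restrict_of_ae hb.1.prodMk_left] with x hx hx'
    exact enorm_gammaSymbol_mul_le hlam hx hx'
  refine (lintegral_mono_ae h1).trans_lt ?_
  rw [lintegral_const_mul' _ _ (ENNReal.pow_ne_top ENNReal.ofReal_ne_top)]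
  refine ENNReal.mul_lt_top (ENNReal.pow_lt_top ENNReal.ofReal_lt_top) ?_
  refine (lintegral_mono' Measure.restrict_le_self le_rfl).trans_lt ?_
  have h2 := (memLp_two_iff_lintegral hb.1).1 hb
  rwa [lintegral_prod _ (hb.1.enorm.pow_const 2)] at h2

theorem memLp_bergmanKernel (hlam : -1 < lam) (z : UpperHalfPlane) :
    MemLp (fun w : ℝ × ℝ => bergmanKernel lam z (pt w.1 w.2)) 2
      ((volume : Measure ℝ).prod (nu lam)) := by
  have hk := memLp_kernelDensity hlam z
  rw [ENNReal.ofReal_ofNat] at hk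
  have h1 := (memLp_mul_synthesis_iff hlam one_le_two hk (b := fun _ => 1)
    aestronglyMeasurable_const).2 (by simpa only [one_mul] using memLp_fourierDensity hlam hk)
  have h2 := (h1.comp_measurePreserving ((Measure.measurePreserving_neg (volume : Measure ℝ)).prod
    (MeasurePreserving.id (nu lam)))).const_mul ((Real.sqrt (2 * Real.pi) : ℝ) : ℂ)
  refine (memLp_congr_ae ?_).1 h2
  have hpos : ∀ᵐ w ∂((volume : Measure ℝ).prod (nu lam)), 0 < w.2 :=
    Measure.quasiMeasurePreserving_snd.ae (ae_nu_pos lam)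
  filter_upwards [hpos] with w hw
  simp only [Function.comp, Prod.map, one_mul, id_eq]
  exact (bergmanKernel_pt hlam z w.1 hw).symm

theorem invFourier_comp_neg (h : ℝ → ℂ) (x : ℝ) :
    invFourier (fun u => h (-u)) x = invFourier h (-x) := by
  rw [invFourier, invFourier]
  congr 1
  rw [← integral_neg_eq_self]
  refine integral_congr_ae (.of_forall fun u => ?_)
  simp only [neg_neg]
  congr 2
  push_cast
  ring

theorem invFourier_const_mul (c : ℂ) (h : ℝ → ℂ) (x : ℝ) :
    invFourier (fun u => c * h u) x = c * invFourier h x := by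
  rw [invFourier, invFourier, mul_left_comm c, ← integral_const_mul c]
  congr 1
  exact integral_congr_ae (.of_forall fun u : ℝ =>
    mul_left_comm (Complex.exp (I * u * x)) c (h u))

/-- Parseval on one line: the transform moves from `φ` to the kernel slice, which inverts back to
the kernel density. The reflection in `bergmanKernel_pt` makes the pairing bilinear, with no
conjugation. -/
theorem integral_synthesis_mul_bergmanKernel (hlam : -1 < lam) (hφ : MemLp φ 2 volPos)
    (z : UpperHalfPlane) {y : ℝ} (hy : 0 < y) :
    ∫ x, synthesis lam 2 φ (pt x y) * bergmanKernel lam z (pt x y) =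
      ((Real.sqrt (2 * Real.pi) : ℝ) : ℂ) *
        ∫ u, fourierDensity lam 2 φ u y * fourierDensity lam 2 (kernelDensity lam z) u y := by
  have hφ' : MemLp φ (ENNReal.ofReal 2) volPos := by rwa [ENNReal.ofReal_ofNat]
  have hs : 0 < Real.sqrt (2 * Real.pi) := Real.sqrt_pos.2 (by positivity)
  have hD := integrable_fourierDensity hlam one_le_two one_le_two hφ' hy
  have hκ := integrable_fourierDensity hlam one_le_two one_le_two (memLp_kernelDensity hlam z) hy
  have hK := integrable_bergmanKernel_pt hlam z hy
  have e1 : ∀ x, bergmanKernel lam z (pt x y) = ((Real.sqrt (2 * Real.pi) : ℝ) : ℂ) *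
      invFourier (fun ξ => fourierDensity lam 2 (kernelDensity lam z) ξ y) (-x) := fun x => by
    rw [bergmanKernel_pt hlam z x hy, synthesis_pt hlam one_le_two _ hy]
  have hI : Integrable (invFourier fun ξ => fourierDensity lam 2 (kernelDensity lam z) ξ y) := by
    have h2 := (hK.const_mul ((Real.sqrt (2 * Real.pi) : ℝ) : ℂ)⁻¹).comp_neg
    refine h2.congr (.of_forall fun x => ?_)
    simp only
    rw [e1, inv_mul_cancel_left₀ (Complex.ofReal_ne_zero.2 hs.ne'), neg_neg]
  have hinv := invFourier_invFourier_ae hκ hI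
  have h3 := (Measure.measurePreserving_neg (volume : Measure ℝ)).quasiMeasurePreserving.ae hinv
  simp only [synthesis_pt hlam one_le_two φ hy]
  rw [integral_invFourier_mul hD hK, ← integral_const_mul]
  refine integral_congr_ae ?_
  filter_upwards [h3] with u hu
  rw [neg_neg] at hu
  rw [funext e1, invFourier_const_mul, invFourier_comp_neg
    (invFourier fun ξ => fourierDensity lam 2 (kernelDensity lam z) ξ y), hu]
  ring

/-- Two functions in `L²` have an integrable product, both on the half-plane and on the Fourier
side. Integrating along lines first gives Parseval; integrating in `y` first, after the passage to
frequencies, reproduces `γ_b`. -/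
theorem synthesis_gammaSymbol_mul (hlam : -1 < lam) (hφ : MemLp φ 2 volPos) {b : ℝ → ℂ}
    (hb : AEStronglyMeasurable b (nu lam))
    (hbφ : MemLp (fun w : ℝ × ℝ => b w.2 * synthesis lam 2 φ (pt w.1 w.2)) 2 (mu lam))
    (z : UpperHalfPlane) :
    Integrable (fun w : ℝ × ℝ => b w.2 * synthesis lam 2 φ (pt w.1 w.2) *
      bergmanKernel lam z (pt w.1 w.2)) (mu lam) ∧
    synthesis lam 2 (fun x => gammaSymbol lam 2 b x * φ x) z =
      ∫ w : ℝ × ℝ, b w.2 * synthesis lam 2 φ (pt w.1 w.2) *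
        bergmanKernel lam z (pt w.1 w.2) ∂(mu lam) := by
  have hk := memLp_kernelDensity hlam z
  rw [ENNReal.ofReal_ofNat] at hk
  have h1 := (memLp_two_mu_iff _).1 hbφ
  have hD := (memLp_mul_synthesis_iff hlam one_le_two hφ hb).1 h1
  have hi : Integrable (fun w : ℝ × ℝ => b w.2 * synthesis lam 2 φ (pt w.1 w.2) *
      bergmanKernel lam z (pt w.1 w.2)) ((volume : Measure ℝ).prod (nu lam)) :=
    h1.integrable_mul (memLp_bergmanKernel hlam z)
  have hi2 : Integrable (fun w : ℝ × ℝ => b w.2 * fourierDensity lam 2 φ w.1 w.2 *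
      fourierDensity lam 2 (kernelDensity lam z) w.1 w.2) ((volume : Measure ℝ).prod (nu lam)) :=
    hD.integrable_mul (memLp_fourierDensity hlam hk)
  refine ⟨(integrable_mu_iff _).2 hi, ?_⟩
  have e1 : ∫ y, ∫ x, b y * synthesis lam 2 φ (pt x y) * bergmanKernel lam z (pt x y) ∂volume ∂(nu lam)
      = ((Real.sqrt (2 * Real.pi) : ℝ) : ℂ) * ∫ y, ∫ u, b y * fourierDensity lam 2 φ u y *
        fourierDensity lam 2 (kernelDensity lam z) u y ∂volume ∂(nu lam) := by
    rw [← integral_const_mul]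
    refine integral_congr_ae ?_
    filter_upwards [ae_nu_pos lam] with y hy
    simp only [mul_assoc]
    rw [integral_const_mul, integral_const_mul, integral_synthesis_mul_bergmanKernel hlam hφ z hy]
    ring
  rw [integral_mu, integral_prod_symm _ hi]
  simp only
  rw [e1, ← integral_prod_symm (fun w : ℝ × ℝ => b w.2 * fourierDensity lam 2 φ w.1 w.2 *
      fourierDensity lam 2 (kernelDensity lam z) w.1 w.2) hi2, integral_prod _ hi2]
  have hpi : 0 < Real.sqrt Real.pi := Real.sqrt_pos.2 Real.pi_pos
  -- At frequency `u` the two exponentials `e^{-u y}` from the density and the kernel combine, and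
  -- the `y`-integral is that of `gammaSymbol_mul_eq`.
  have e2 : ∀ u : ℝ, ∫ y, b y * fourierDensity lam 2 φ u y *
      fourierDensity lam 2 (kernelDensity lam z) u y ∂(nu lam) = (Ioi (0 : ℝ)).indicator
      (fun u => ((Real.sqrt Real.pi / 2 * theta lam 2 u : ℝ) : ℂ) * (gammaSymbol lam 2 b u * φ u) *
        Complex.exp (I * u * z)) u := by
    intro u
    by_cases hu : u ∈ Ioi (0 : ℝ)
    · have hu0 : 0 < u := hu
      rw [indicator_of_mem hu, gammaSymbol_mul_eq hlam b φ hu0, ← mul_assoc, ← Complex.ofReal_mul,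
        mul_right_comm, ← integral_const_mul]
      refine integral_congr_ae (.of_forall fun y => ?_)
      simp only
      rw [fourierDensity_of_pos hu0 (φ := kernelDensity lam z), kernelDensity]
      have hpi' : (Real.sqrt Real.pi : ℂ) ≠ 0 := Complex.ofReal_ne_zero.2 hpi.ne'
      push_cast
      field_simp
    · rw [indicator_of_notMem hu]
      simp [fourierDensity, indicator_of_notMem hu]
  simp only [e2]
  rw [integral_indicator measurableSet_Ioi, synthesis, ← integral_const_mul, ← integral_const_mul,
    ← integral_const_mul]
  refine integral_congr_ae ?_
  filter_upwards [ae_volPos_pos] with u hu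
  have hc : 2 ^ ((lam + 1) / 2) / (Real.sqrt 2 * (2 ^ lam * Real.Gamma (lam + 2)) ^ (1 / (2 : ℝ))) *
      u ^ ((lam + 1) / 2) = 1 / Real.pi * (Real.sqrt (2 * Real.pi) *
        (Real.sqrt Real.pi / 2 * theta lam 2 u)) := by
    have h4 : Real.sqrt (2 * Real.pi) = Real.sqrt 2 * Real.sqrt Real.pi := Real.sqrt_mul (by norm_num) _
    have h5 : 2 ^ ((lam + 1) / 2) /
        (Real.sqrt 2 * (2 ^ lam * Real.Gamma (lam + 2)) ^ (1 / (2 : ℝ))) * u ^ ((lam + 1) / 2) =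
        theta lam 2 u / Real.sqrt 2 := by
      rw [theta_eq hlam one_le_two hu]
      field_simp
    have h6 : 0 < Real.sqrt 2 := by positivity
    have hpi0 := Real.pi_pos
    rw [h5, h4]
    field_simp
    rw [Real.sq_sqrt hpi0.le, Real.sq_sqrt (by norm_num : (0 : ℝ) ≤ 2)]
    ring
  have hc' := congrArg (fun r : ℝ => (r : ℂ)) hc
  simp only [Complex.ofReal_mul] at hc' ⊢
  linear_combination (gammaSymbol lam 2 b u * φ u * Complex.exp (I * u * z)) * hc'

end MixedFourier

end

/-! ### The theorem, read off through the identification of `f` with its `L^q` density. -/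

theorem mainTheorem2 (lam q p : ℝ) (hlam : -1 < lam) (hq : 1 ≤ q) (hp : 1 ≤ p)
    (a : ℝ → ℂ) (ha : MemL1exp a)
    (ha0 : lam < 0 → ∃ δ > 0, IntegrableOn (fun y => a y * ((y ^ lam : ℝ) : ℂ)) (Ioo 0 δ)) :
    -- the integral that defines `γ_{a,λ}` converges absolutely
    (∀ x > 0, IntegrableOn (gammaIntegrand lam p a x) (Ioi 0)) ∧
    -- `R_λ` is an isometric isomorphism of `𝓐^{q,p}_λ(Π)` onto `L^q(ℝ_+)`
    ∃ R : bergmanSpace lam q p hq hp ≃ₗ[ℂ] Lp ℂ (ENNReal.ofReal q) volPos,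
      (∀ f : bergmanSpace lam q p hq hp, RopConverges lam p f ∧ (R f : ℝ → ℂ) =ᵐ[volPos] Rop lam p f) ∧
      (∀ f : bergmanSpace lam q p hq hp, fourierMixedNorm lam q p f = ENNReal.ofReal ‖R f‖) ∧
      -- the form of `R_λ⁻¹`
      (∀ (φ : Lp ℂ (ENNReal.ofReal q) volPos) (z : UpperHalfPlane),
        Integrable (fun ξ : ℝ =>
          φ ξ * ((ξ ^ ((lam + 1) / p) : ℝ) : ℂ) * Complex.exp (I * ξ * z)) volPos ∧
        (R.symm φ : UpperHalfPlane → ℂ) z =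
          ((p ^ ((lam + 1) / p) /
            (Real.sqrt 2 * (2 ^ lam * Real.Gamma (lam + 2)) ^ (1 / p)) : ℝ) : ℂ) *
          ∫ ξ : ℝ, φ ξ * ((ξ ^ ((lam + 1) / p) : ℝ) : ℂ) * Complex.exp (I * ξ * z) ∂volPos) ∧
      -- the form of `R_λ`, with the inner integral over the real line read as a Fourier transform
      (∀ f : bergmanSpace lam q p hq hp, ∀ᵐ x ∂volPos,
        Integrable (fun η : ℝ => U1 f x η * (Real.exp (-((p - 1) * x * η)) : ℂ)) (nu lam) ∧
        R f x = ((theta lam p x ^ (p - 1) : ℝ) : ℂ) *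
          ∫ η : ℝ, U1 f x η * (Real.exp (-((p - 1) * x * η)) : ℂ) ∂(nu lam)) ∧
      -- the form of `R_λ` as an area integral, where that integral converges absolutely
      (∀ f : bergmanSpace lam q p hq hp, ∀ᵐ x ∂volPos,
        Integrable (areaIntegrand p f x) (mu lam) →
        R f x = ((1 / Real.sqrt 2 * theta lam p x ^ (p - 1) : ℝ) : ℂ) *
          ∫ w, areaIntegrand p f x w ∂(mu lam)) ∧
      -- `R_λ T_a R_λ⁻¹ = γ_{a,λ} I`, domains included
      (∀ φ ψ : Lp ℂ (ENNReal.ofReal q) volPos,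
        IsToeplitz lam q p a (R.symm φ) (R.symm ψ) ↔
          ψ =ᵐ[volPos] fun x => gammaSymbol lam p a x * φ x) ∧
      -- for `p = q = 2` the operator `T_a` is the one given by the classical Bergman projection
      (p = 2 → q = 2 → ∀ f : bergmanSpace lam q p hq hp,
        MemLp (fun w : ℝ × ℝ => a w.2 * (f : UpperHalfPlane → ℂ) (pt w.1 w.2)) 2 (mu lam) →
        ∃ g : bergmanSpace lam q p hq hp, IsToeplitz lam q p a f g ∧
          ∀ z : UpperHalfPlane,
            Integrable (fun w : ℝ × ℝ => a w.2 * (f : UpperHalfPlane → ℂ) (pt w.1 w.2) *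
              bergmanKernel lam z (pt w.1 w.2)) (mu lam) ∧
            (g : UpperHalfPlane → ℂ) z =
              ∫ w : ℝ × ℝ, a w.2 * (f : UpperHalfPlane → ℂ) (pt w.1 w.2) *
                bergmanKernel lam z (pt w.1 w.2) ∂(mu lam)) := by

  refine ⟨fun x hx => ha.integrableOn_gammaIntegrand hp ha0 hx, ?_⟩
  -- `R` is defined as the inverse of the explicit integral, so every claim about `f` becomes one
  -- about `synthesis` of `R f`; agreement with `R_λ` is then a theorem.
  set R := (synthesisEquiv hlam hq hp).symm with hR
  have hsynth : ∀ f : bergmanSpace lam q p hq hp,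
      (f : UpperHalfPlane → ℂ) = synthesis lam p (R f) := fun f => by
    rw [← synthesisEquiv_apply hlam hq hp, hR, LinearEquiv.apply_symm_apply]
  have hgam : ∀ x > 0, IntegrableOn (gammaIntegrand lam p a x) (Ioi 0) :=
    fun x hx => ha.integrableOn_gammaIntegrand hp ha0 hx
  have htoep : ∀ φ ψ : Lp ℂ (ENNReal.ofReal q) volPos,
      IsToeplitz lam q p a (R.symm φ) (R.symm ψ) ↔
        ψ =ᵐ[volPos] fun x => gammaSymbol lam p a x * φ x := fun φ ψ =>
    isToeplitz_synthesis_iff hlam hp hq ha.locallyIntegrableOn hgam (Lp.memLp φ) (Lp.memLp ψ)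
  refine ⟨R, fun f => ?_, fun f => ?_, fun φ z => ?_, fun f => ?_, fun f => ?_, htoep, ?_⟩
  · have hm := Lp.memLp (R f)
    rw [hsynth f]
    exact ⟨ropConverges_synthesis hlam hp hq hm, (Rop_synthesis hlam hp hq hm).symm⟩
  · rw [hsynth f, fourierMixedNorm_synthesis hlam hp hq (Lp.memLp (R f)), Lp.norm_def,
      ENNReal.ofReal_toReal (Lp.eLpNorm_ne_top _)]
  · exact ⟨integrable_synthesis hlam hp hq (Lp.memLp φ) z, rfl⟩
  · have h := eq_integral_U1_synthesis hlam hp hq (Lp.memLp (R f))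
    rwa [← hsynth f] at h
  · have h := eq_integral_areaIntegrand_synthesis hlam hp hq (Lp.memLp (R f))
    rwa [← hsynth f] at h
  · rintro rfl rfl f hf
    have hm : MemLp (R f) 2 volPos := memLp_ofReal_two_iff.1 (Lp.memLp (R f))
    rw [hsynth f] at hf
    have hb : AEStronglyMeasurable a (nu lam) :=
      (ha.locallyIntegrableOn.aestronglyMeasurable).mono_ac (nu_absolutelyContinuous lam)
    have hg₂ : MemLp (fun x => gammaSymbol lam 2 a x * R f x) 2 volPos :=
      memLp_gammaSymbol_mul hlam
        ((memLp_mul_synthesis_iff hlam one_le_two hm hb).1 ((memLp_two_mu_iff _).1 hf))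
    have hg : MemLp (fun x => gammaSymbol lam 2 a x * R f x) (ENNReal.ofReal 2) volPos :=
      memLp_ofReal_two_iff.2 hg₂
    -- The image under `T_a` is dictated by the diagonalization: it has density `γ_a` times that of
    -- `f`.
    refine ⟨R.symm (hg.toLp _), ?_, fun z => ?_⟩
    · have h := (htoep (R f) (hg.toLp _)).2 hg.coeFn_toLp
      rwa [LinearEquiv.symm_apply_apply] at h
    · have h := synthesis_gammaSymbol_mul hlam hm hb hf z
      rw [hsynth f]
      refine ⟨h.1, ?_⟩
      rw [← h.2]
      exact congrFun (synthesis_congr hg.coeFn_toLp) z
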